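/- **Model.** Let $d\in\mathbb N$, $p\in(0,1]$, $B\ge 1$ an integer, $\varepsilon\in(0,1]$, $\beta=1-\varepsilon$, $\eta>0$, $\theta^*\in\mathbb R^d$. A sample is $x=s\tilde x$ with $s\sim\mathrm{Ber}(p)$ and $\tilde x\sim\mathcal N(0,I_d)$ independent; a minibatch $(x_1,\dots,x_B)$ of independent samples has gradient $g(\theta)=\frac1B\sum_i x_i\langle x_i,\theta-\theta^*\rangle$ and is *active* if some gate $s_i$ is $1$, which has probability $P_{\rm batch}=1-(1-p)^B$. A step of momentum SGD is $m^+=\beta m+(1-\beta)g(\theta)$, $\theta^+=\theta-\eta m^+$. An *active update* consists of $j$ steps with zero gradient followed by one step with a minibatch conditioned to be active, where $j$ is independent of everything else and $\mathbb P(j=k)=(1-P_{\rm batch})^kP_{\rm batch}$, $k\ge0$. The active updates happen at the jumps of an independent unit-rate Poisson process of time $t$. Let $R(t)=\mathbb E\|\theta_t-\theta^*\|^2$, $V(t)=\mathbb E\|m_t\|^2$, $C(t)=\mathbb E\langle\theta_t-\theta^*,m_t\rangle$. **Scaling.** For fixed exponents $\kappa,\sigma,\gamma\ge0$ and constants $p_*,B_*,\varepsilon_*,\eta_*>0$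 let, as $d\to\infty$, $$p\sim p_*d^{-\kappa},\quad B\sim B_*d^{\sigma},\quad \varepsilon\sim\varepsilon_*d^{-\gamma},\quad \eta\sim\eta_*\min(d^{\kappa-\gamma},d^{\sigma-1}).$$ Put $\kappa_{\rm eff}=\max(0,\kappa-\sigma)$, $\bar\eta=\eta_*p_*/\varepsilon_*$, $\zeta_*=\varepsilon_*/(p_*B_*)$, and let $P_*=\lim P_{\rm batch}d^{\kappa_{\rm eff}}$, that is, $P_*=1$ if $\kappa<\sigma$; $P_*=p_*B_*$ if $\kappa>\sigma$; $P_*=1-e^{-p_*B_*}$ if $\kappa=\sigma>0$; $P_*=1-(1-p_*)^{B_*}$ if $\kappa=\sigma=0$. For each $d$ let the initial law of $(\theta_0,m_0)$ have finite second moments with $R(0)\to r_0$, $V(0)/p^2\to v_0$, $C(0)/p\to c_0$ (for example $m_0=0$, $v_0=c_0=0$). **Theorem.** (i) *Below resonance.* Let $\gamma<1-\sigma+\kappa$ and $t=\frac{P_*}{p_*B_*}d^{\,1-\sigma+\kappa-\kappa_{\rm eff}}\,\tau$. Then $\eta d/B\to\eta_{\rm eff}:=\eta_*/B_*$, and $R(t)$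 converges, uniformly for $\tau$ in $[0,T]$ for every $T$, to the solution of $$\frac{dR}{d\tau}=-\eta_{\rm eff}(2-\eta_{\rm eff})R,\qquad R(0)=r_0 .$$ The momentum modes are slaved to $R$: with $\mathcal B_1=p/P_{\rm batch}$, $\mathcal B_2=\frac{(d+2)p+p^2(B-1)}{BP_{\rm batch}}$, $Q=1-P_{\rm batch}$, $\bar\beta_2=\frac{P_{\rm batch}\beta^2}{1-Q\beta^2}$, $$V_{\rm sl}=\frac{\varepsilon^2\mathcal B_2}{1-\bar\beta_2},\qquad C_{\rm sl}=(1-Q\beta)(\mathcal B_1-\eta\varepsilon\mathcal B_2)-\frac{\eta P_{\rm batch}\beta^2\mathcal B_2}{1+\beta},$$ one has, uniformly for $\tau\in[\delta,T]$ for all $0<\delta<T$, that $V(t)/V_{\rm sl}$ converges to the same limit as $R(t)$ and $\dfrac{C(t)-C_{\rm sl}R(t)}{(P_{\rm batch}+\varepsilon)\mathcal B_1}\to0$. (ii) *Above resonance.* Let $\gamma>1-\sigma+\kappa$, $\gamma>0$ and $t=\frac{P_*}{\varepsilon_*}d^{\,\gamma-\kappa_{\rm eff}}\,\tau$. Then $(R(t),V(t)/p^2,C(t)/p)$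 converges, uniformly for $\tau$ in $[0,T]$ for every $T$, to a solution of $$\frac{dR}{d\tau}=-2\bar\eta C,\qquad \frac{dV}{d\tau}=2C-2V,\qquad \frac{dC}{d\tau}=R-\bar\eta V-C$$ with initial value $(r_0,v_0,c_0)$. If $(r_0,v_0,c_0)=(x_0^2,y_0^2,x_0y_0)$, this limit is $R=x^2$, $V=y^2$, $C=xy$ with the deterministic heavy-ball system $$\frac{dx}{d\tau}=-\bar\eta\,y,\qquad\frac{dy}{d\tau}=x-y,\qquad x(0)=x_0,\ y(0)=y_0 .$$ (iii) *On the resonance line.* Let $\gamma=1-\sigma+\kappa>0$ and $t$ as in (ii). Then $(R(t),V(t)/p^2,C(t)/p)$ converges, uniformly for $\tau$ in $[0,T]$ for every $T$, to a solution of $$\frac{dR}{d\tau}=-2\bar\eta C,\qquad \frac{dV}{d\tau}=2C-2V+\zeta_*R,\qquad \frac{dC}{d\tau}=R-\bar\eta V-C$$ with initial value $(r_0,v_0,c_0)$. This system is irreducibly three-dimensional: it has no nonzero solution of the form $(x^2,y^2,xy)$ on $[0,\infty)$, and there is no linear differential equation $R''=a_1R'+a_0R$ that holds for the first component of every solution.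 -/

import Mathlib

open MeasureTheory ProbabilityTheory Filter Topology Set

noncomputable section

namespace SparseMomentum

/-! ### The model: momentum SGD on sparsely gated Gaussian least squares -/

/-- The parameters of one instance: gating probability `p`, batch size `B`, momentum decay
`ε = 1 - β` and learning rate `η`. -/
structure Params where
  p : unitInterval
  B : ℕ
  ε : ℝ
  η : ℝ

/-- The parameter space `ℝᵈ` with its Euclidean norm. -/
abbrev Vec (d : ℕ) : Type := EuclideanSpace ℝ (Fin d)

/-- The optimizer state `(θ, m)`. -/
abbrev State (d : ℕ) : Type := Vec d × Vec d

/-- A sample `(s, x̃)`: gate and latent feature. -/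
abbrev Sample (d : ℕ) : Type := Bool × Vec d

/-- The gate is Bernoulli with parameter `p`, the latent feature is an independent standard
Gaussian vector. -/
def sampleLaw (d : ℕ) (p : unitInterval) : Measure (Sample d) :=
  (bernoulliMeasure true false p).prod (stdGaussian (Vec d))

/-- The gated input `x = s x̃`. -/
def gatedInput {d : ℕ} (a : Sample d) : Vec d := if a.1 then a.2 else 0

/-- The minibatch gradient `(1/B) ∑ᵢ xᵢ ⟨xᵢ, θ - θ⋆⟩`. -/
def batchGrad {d B : ℕ} (θstar θ : Vec d) (b : Fin B → Sample d) : Vec d :=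
  (B : ℝ)⁻¹ • ∑ i, (inner ℝ (gatedInput (b i)) (θ - θstar)) • gatedInput (b i)

/-- The minibatches with at least one open gate. -/
def activeBatches (d B : ℕ) : Set (Fin B → Sample d) := {b | ∃ i, (b i).1 = true}

/-- The law of `B` independent samples, conditioned on at least one open gate. -/
def activeBatchLaw (d : ℕ) (P : Params) : Measure (Fin P.B → Sample d) :=
  ProbabilityTheory.cond (Measure.pi fun _ : Fin P.B => sampleLaw d P.p) (activeBatches d P.B)

/-- The probability `1 - (1 - p)^B` that a minibatch is active. -/
def Params.pBatch (P : Params) : unitInterval :=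
  unitInterval.symm (unitInterval.symm P.p ^ P.B)

/-- One step `m⁺ = β m + (1 - β) g`, `θ⁺ = θ - η m⁺`. -/
def momentumStep {d : ℕ} (P : Params) (g : Vec d) (z : State d) : State d :=
  (z.1 - P.η • ((1 - P.ε) • z.2 + P.ε • g), (1 - P.ε) • z.2 + P.ε • g)

/-- The move from one active update to the next: first `j` empty minibatches (zero gradient), then
one active minibatch `b`, whose gradient is taken at the drifted iterate. -/
def activeStep {d : ℕ} (P : Params) (θstar : Vec d) (z : State d) (j : ℕ)
    (b : Fin P.B → Sample d) : State d :=
  momentumStep P (batchGrad θstar ((momentumStep P 0)^[j] z).1 b) ((momentumStep P 0)^[j] z)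

/-- The law of the state after `n` active updates from the initial law `μ₀`. In every round the
number of empty minibatches (geometric: `j` with probability `(1 - P_batch)^j P_batch`) and the
active minibatch are independent of each other and of the past. -/
def activeLaw {d : ℕ} (P : Params) (θstar : Vec d) (μ₀ : Measure (State d)) :
    ℕ → Measure (State d)
  | 0 => μ₀
  | n + 1 =>
    ((activeLaw P θstar μ₀ n).prod ((geometricMeasure P.pBatch).prod (activeBatchLaw d P))).map
      fun w => activeStep P θstar w.1 w.2.1 w.2.2

/-- The law of the Poissonized state at time `t ≥ 0`: active updates arrive at the jumps of an
independent unit-rate Poisson counting variable. -/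
def lawAt {d : ℕ} (P : Params) (θstar : Vec d) (μ₀ : Measure (State d)) (t : ℝ) :
    Measure (State d) :=
  (poissonMeasure t.toNNReal).bind (activeLaw P θstar μ₀)

/-- Squared error `𝔼‖θ - θ⋆‖²`. -/
def risk {d : ℕ} (θstar : Vec d) (μ : Measure (State d)) : ℝ := ∫ z, ‖z.1 - θstar‖ ^ 2 ∂μ

/-- Momentum energy `𝔼‖m‖²`. -/
def energy {d : ℕ} (μ : Measure (State d)) : ℝ := ∫ z, ‖z.2‖ ^ 2 ∂μ

/-- Error-momentum correlation `𝔼⟨θ - θ⋆, m⟩`. -/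
def corr {d : ℕ} (θstar : Vec d) (μ : Measure (State d)) : ℝ :=
  ∫ z, inner ℝ (z.1 - θstar) z.2 ∂μ

/-! ### Batch statistics and the adiabatic values of `V` and `C` -/

/-- `𝔼[N/B | N ≥ 1] = p / P_batch`. -/
def Params.signal (P : Params) : ℝ := P.p / P.pBatch

/-- `(d+2) 𝔼[N/B² | N ≥ 1] + 𝔼[N(N-1)/B² | N ≥ 1]`, the factor in the second moment
`𝔼‖g‖² = 𝓑₂ ‖θ - θ⋆‖²` of the gradient of an active minibatch. -/
def Params.noise (P : Params) (d : ℕ) : ℝ :=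
  ((d : ℝ) + 2) * (P.p / (P.B * P.pBatch)) + (P.p : ℝ) ^ 2 * ((P.B : ℝ) - 1) / (P.B * P.pBatch)

/-- `1 - 𝔼[β^(2K)]` with `K` geometric on `{1, 2, …}` with parameter `P_batch`. -/
def Params.gap₂ (P : Params) : ℝ :=
  1 - P.pBatch * (1 - P.ε) ^ 2 / (1 - (1 - P.pBatch) * (1 - P.ε) ^ 2)

/-- The leading-order value of `V / R` at which `V` is stationary for frozen `R`. -/
def Params.slavedV (P : Params) (d : ℕ) : ℝ := P.ε ^ 2 * P.noise d / P.gap₂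

/-- The leading-order value of `C / R` at which `C` is stationary for frozen `R` and slaved `V`. -/
def Params.slavedC (P : Params) (d : ℕ) : ℝ :=
  (1 - (1 - P.pBatch) * (1 - P.ε)) * (P.signal - P.η * P.ε * P.noise d)
    - P.η * P.pBatch * (1 - P.ε) ^ 2 * P.noise d / (2 - P.ε)

/-! ### Co-scaling -/

/-- The power-law co-scaling with constant prefactors as `d → ∞`:
`p ~ p⋆ d^(-κ)`, `B ~ B⋆ d^σ`, `ε ~ ε⋆ d^(-γ)`, and `η ~ η⋆ d^(-α)` at the order of the largest
stable learning rate, `d^(-α) = min (d^(κ-γ)) (d^(σ-1))`. -/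
structure CoScaling (κ σ γ pS BS εS ηS : ℝ) (P : ℕ → Params) : Prop where
  κ_nonneg : 0 ≤ κ
  σ_nonneg : 0 ≤ σ
  γ_nonneg : 0 ≤ γ
  pS_pos : 0 < pS
  BS_pos : 0 < BS
  εS_pos : 0 < εS
  ηS_pos : 0 < ηS
  p_pos : ∀ d, 0 < ((P d).p : ℝ)
  B_pos : ∀ d, 0 < (P d).B
  ε_pos : ∀ d, 0 < (P d).ε
  ε_le_one : ∀ d, (P d).ε ≤ 1
  η_pos : ∀ d, 0 < (P d).η
  tendsto_p : Tendsto (fun d : ℕ => ((P d).p : ℝ) * (d : ℝ) ^ κ) atTop (𝓝 pS)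
  tendsto_B : Tendsto (fun d : ℕ => ((P d).B : ℝ) / (d : ℝ) ^ σ) atTop (𝓝 BS)
  tendsto_ε : Tendsto (fun d : ℕ => (P d).ε * (d : ℝ) ^ γ) atTop (𝓝 εS)
  tendsto_η : Tendsto (fun d : ℕ => (P d).η * (d : ℝ) ^ max (γ - κ) (1 - σ)) atTop (𝓝 ηS)

/-- The effective sparsity exponent `κ_eff = (κ - σ)₊`, with `P_batch ~ P⋆ d^(-κ_eff)`. -/
def κeff (κ σ : ℝ) : ℝ := max 0 (κ - σ)

/-- The prefactor `P⋆ = lim P_batch d^κ_eff`. -/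
def PStar (κ σ pS BS : ℝ) : ℝ :=
  if κ < σ then 1
  else if σ < κ then pS * BS
  else if σ = 0 then 1 - (1 - pS) ^ BS
  else 1 - Real.exp (-(pS * BS))

/-- Active-update time elapsed when the rescaled time is `τ`, below resonance. -/
def sgdClock (κ σ pS BS : ℝ) (d : ℕ) (τ : ℝ) : ℝ :=
  (d : ℝ) ^ (1 - σ + κ - κeff κ σ) * (PStar κ σ pS BS / (pS * BS)) * τ

/-- Active-update time elapsed when the rescaled time is `τ`, on and above resonance. -/
def momentumClock (κ σ γ pS BS εS : ℝ) (d : ℕ) (τ : ℝ) : ℝ :=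
  (d : ℝ) ^ (γ - κeff κ σ) * (PStar κ σ pS BS / εS) * τ

/-! ### Limit systems on `τ ≥ 0` -/

/-- `dR/dτ = -η_eff (2 - η_eff) R`. -/
def IsSGDFlow (ηeff : ℝ) (R : ℝ → ℝ) : Prop :=
  ∀ τ ∈ Ici (0 : ℝ), HasDerivWithinAt R (-(ηeff * (2 - ηeff)) * R τ) (Ici 0) τ

/-- `dx/dτ = -η̄ y`, `dy/dτ = x - y`. -/
def IsHeavyBallFlow (ηbar : ℝ) (x y : ℝ → ℝ) : Prop :=
  ∀ τ ∈ Ici (0 : ℝ), HasDerivWithinAt x (-ηbar * y τ) (Ici 0) τ ∧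
    HasDerivWithinAt y (x τ - y τ) (Ici 0) τ

/-- `dR/dτ = -2η̄ C`, `dV/dτ = 2C - 2V + ζ R`, `dC/dτ = R - η̄ V - C`. -/
def IsMomentFlow (ηbar ζ : ℝ) (R V C : ℝ → ℝ) : Prop :=
  ∀ τ ∈ Ici (0 : ℝ), HasDerivWithinAt R (-2 * ηbar * C τ) (Ici 0) τ ∧
    HasDerivWithinAt V (2 * C τ - 2 * V τ + ζ * R τ) (Ici 0) τ ∧
    HasDerivWithinAt C (R τ - ηbar * V τ - C τ) (Ici 0) τ

/-- The three-dimensional moment system does not reduce: no nonzero solution is of the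
deterministic two-dimensional form `(x², y², xy)`, and the first component satisfies no linear
differential equation of order at most two valid for all solutions. -/
def IrreducibleMomentFlow (ηbar ζ : ℝ) : Prop :=
  (∀ x y : ℝ → ℝ,
    IsMomentFlow ηbar ζ (fun τ => x τ ^ 2) (fun τ => y τ ^ 2) (fun τ => x τ * y τ) →
      ∀ τ ∈ Ici (0 : ℝ), x τ = 0 ∧ y τ = 0) ∧
  ∀ a₀ a₁ : ℝ, ∃ R V C R₁ R₂ : ℝ → ℝ, IsMomentFlow ηbar ζ R V C ∧
    (∀ τ ∈ Ici (0 : ℝ), HasDerivWithinAt R (R₁ τ) (Ici 0) τ ∧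
      HasDerivWithinAt R₁ (R₂ τ) (Ici 0) τ) ∧
    ∃ τ ∈ Ici (0 : ℝ), R₂ τ ≠ a₁ * R₁ τ + a₀ * R τ

/-- The diagonally balanced moments `(R, V / p², C / p)` of the laws `μ d τ` converge to
`(R, V, C)`, uniformly on bounded time intervals. -/
def BalancedConvergence (P : ℕ → Params) (θstar : ∀ d, Vec d)
    (μ : ∀ d, ℝ → Measure (State d)) (R V C : ℝ → ℝ) : Prop :=
  ∀ T : ℝ,
    TendstoUniformlyOn (fun d τ => risk (θstar d) (μ d τ)) R atTop (Icc 0 T) ∧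
    TendstoUniformlyOn (fun d τ => energy (μ d τ) / ((P d).p : ℝ) ^ 2) V atTop (Icc 0 T) ∧
    TendstoUniformlyOn (fun d τ => corr (θstar d) (μ d τ) / ((P d).p : ℝ)) C atTop (Icc 0 T)

end SparseMomentum

end

open SparseMomentum

/-!
The idea is a change of variables that removes the empty minibatches. Write `β = 1 - ε` and let
`φ = θ - θ⋆ - c m`, with `c = η β / ε`, be the error that remains once all stored momentum has been
spent (`spentError`). A step with zero gradient leaves `φ` unchanged and multiplies `m` by `β`, and
an active minibatch with gradient `g` moves `φ` to `φ - η g` (`spentError_activeStep`). Hence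
`S = 𝔼‖φ‖²`, `Y = 𝔼⟨φ, m⟩`, `V = 𝔼‖m‖²` satisfy a closed linear recursion (`nextLaw_moments`). Its
coefficients need the first two moments of the gradient of an active minibatch, which come from
Wick's formula (`integral_inner_sq_mul_inner_sq_stdGaussian`) and the independence of the samples.
Averaging the powers of the step matrix `A` over a Poisson number of updates gives the flow of
`A - 1` (`hasSum_poisson_pow`, `lawAt_moments`), so all three moments solve an explicit linear
system of ordinary differential equations, exactly and for every `d`
(`exists_isMomentTrajectory`). The observed moments are `R = S + 2 c Y + c² V` and `C = Y + c V`. What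
remains is the limit `d → ∞`.

Below resonance, `c p → 0`, and `Y` and `V` are damped at rates that dominate the rate `η 𝓑₁` of the
risk (`tendsto_rates_atTop`). In the variables `S`, `c Y`, `c² V` the damped components start near
zero. An energy estimate that is uniform in the damping (`sq_add_sq_add_sq_le_of_damped`) bounds the
solution, the damped components then vanish, and `S`, which is asymptotically `R`, follows the
scalar equation (`tendstoUniformlyOn_of_damped`). Dividing `Y` and `V` by their slaved values gives
quantities that relax towards multiples of `R` after an initial layer
(`tendstoUniformlyOn_relaxation_layer`), and an algebraic identity for the slaved correlation
(`slavedC_eq`) combines them into the claim about `C` (`below_resonance`).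

On and above resonance, the coefficient matrix of `(S, Y / p, V / p²)` converges, and linear flows
depend continuously on their data (`tendstoUniformlyOn_linearFlow`). Read in the variables
`(R, V, C)` the limit is the stated moment system, where `ζ` is the limit of `ε 𝓑₂ / (𝓑₁ p)`
(`balancedConvergence`). The squares and the product of the heavy-ball coordinates solve the system
with `ζ = 0`, so uniqueness identifies the limit above resonance (`exists_heavyBallFlow`). With
`ζ ≠ 0` the quantity `R V - C²` has derivative `ζ R²` on the cone `R V = C²`, the reason for
irreducibility (`irreducibleMomentFlow`).

The exponents enter only through `CoScaling.below_limits` and `CoScaling.above_limits`, which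
rest on the asymptotics `P_batch ~ P⋆ d^(-κ_eff)` (`CoScaling.scales_pBatch`).
-/

open SparseMomentum

namespace SparseMomentum

/-! ### Linear flows -/

section LinearFlow

open scoped Matrix Matrix.Norms.Operator

variable {ι : Type*} [Fintype ι] [DecidableEq ι]

/-- The solution `τ ↦ exp (τ L) u` of the linear system `w' = L w`, `w 0 = u`. -/
noncomputable def linearFlow (L : Matrix ι ι ℝ) (u : ι → ℝ) (τ : ℝ) : ι → ℝ :=
  NormedSpace.exp (τ • L) *ᵥ u

theorem linearFlow_zero (L : Matrix ι ι ℝ) (u : ι → ℝ) : linearFlow L u 0 = u := by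
  simp [linearFlow]

theorem hasDerivAt_linearFlow (L : Matrix ι ι ℝ) (u : ι → ℝ) (τ : ℝ) :
    HasDerivAt (linearFlow L u) (L *ᵥ linearFlow L u τ) τ := by
  have h := hasDerivAt_exp_smul_const' (𝕂 := ℝ) L τ
  let ev : Matrix ι ι ℝ →L[ℝ] (ι → ℝ) :=
    LinearMap.toContinuousLinearMap ((Matrix.mulVecBilin ℝ ℝ).flip u)
  have h2 := ev.hasFDerivAt.comp_hasDerivAt τ h
  have e : ev (L * NormedSpace.exp (τ • L)) = L *ᵥ linearFlow L u τ := by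
    simp [ev, linearFlow, Matrix.mulVec_mulVec]
  exact e ▸ h2

/-- Uniqueness for linear systems with constant coefficients. -/
theorem eq_linearFlow {L : Matrix ι ι ℝ} {w : ℝ → ι → ℝ}
    (hw : ∀ τ, HasDerivAt w (L *ᵥ w τ) τ) (τ : ℝ) : w τ = linearFlow L (w 0) τ := by
  let T : (ι → ℝ) →L[ℝ] (ι → ℝ) := LinearMap.toContinuousLinearMap (Matrix.mulVecLin L)
  have := ODE_solution_unique_univ (v := fun _ x => L *ᵥ x) (s := fun _ => univ)
    (K := ‖T‖₊) (t₀ := 0) (f := w) (g := linearFlow L (w 0))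
    (fun t => (T.lipschitz.lipschitzOnWith : LipschitzOnWith _ T univ))
    (fun t => ⟨hw t, mem_univ _⟩) (fun t => ⟨hasDerivAt_linearFlow L (w 0) t, mem_univ _⟩)
    (by simp [linearFlow_zero])
  exact congrFun this τ

theorem continuous_linearFlow_dotProduct :
    Continuous fun x : ((Matrix ι ι ℝ) × (ι → ℝ) × (ι → ℝ)) × ℝ =>
      x.1.2.2 ⬝ᵥ linearFlow x.1.1 x.1.2.1 x.2 := by
  unfold linearFlow
  have h : Continuous fun x : ((Matrix ι ι ℝ) × (ι → ℝ) × (ι → ℝ)) × ℝ =>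
      NormedSpace.exp (x.2 • x.1.1) :=
    NormedSpace.exp_continuous.comp (by fun_prop)
  exact Continuous.dotProduct (by fun_prop) (Continuous.matrix_mulVec h (by fun_prop))

/-- Linear functionals of linear flows converge uniformly on bounded time intervals when the
generators, the initial values and the functionals converge. -/
theorem tendstoUniformlyOn_linearFlow {L : ℕ → Matrix ι ι ℝ} {L' : Matrix ι ι ℝ}
    {u a : ℕ → ι → ℝ} {u' a' : ι → ℝ} (hL : Tendsto L atTop (𝓝 L')) (hu : Tendsto u atTop (𝓝 u'))
    (ha : Tendsto a atTop (𝓝 a')) (T : ℝ) :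
    TendstoUniformlyOn (fun d τ => a d ⬝ᵥ linearFlow (L d) (u d) τ)
      (fun τ => a' ⬝ᵥ linearFlow L' u' τ) atTop (Icc 0 T) := by
  have hc : Tendsto (fun d => (L d, u d, a d)) atTop (𝓝 (L', u', a')) :=
    hL.prodMk_nhds (hu.prodMk_nhds ha)
  let F : (Matrix ι ι ℝ) × (ι → ℝ) × (ι → ℝ) → ℝ → ℝ := fun x τ => x.2.2 ⬝ᵥ linearFlow x.1 x.2.1 τ
  have hF : Continuous (Function.uncurry F) := continuous_linearFlow_dotProduct
  have key : TendstoUniformlyOn F (F (L', u', a')) (𝓝 (L', u', a')) (Icc 0 T) := by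
    rw [Metric.tendstoUniformlyOn_iff]
    intro ε hε
    have := (isCompact_Icc (a := (0 : ℝ)) (b := T)).mem_uniformity_of_prod
      (f := F) (s := univ) (q := (L', u', a')) hF.continuousOn (mem_univ _)
      (Metric.dist_mem_uniformity hε)
    obtain ⟨v, hv, hv'⟩ := this
    rw [nhdsWithin_univ] at hv
    filter_upwards [hv] with q hq τ hτ
    rw [dist_comm]
    exact hv' q hq τ hτ
  exact fun s hs => hc.eventually (key s hs)

/-- The Poisson mixture of the powers of `A` is the flow of `A - 1`. -/
theorem hasSum_poisson_pow (A : Matrix ι ι ℝ) (u : ι → ℝ) (t : ℝ) :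
    HasSum (fun n : ℕ => (Real.exp (-t) * t ^ n / n.factorial) • (A ^ n *ᵥ u))
      (linearFlow (A - 1) u t) := by
  have h1 := NormedSpace.exp_series_hasSum_exp' (𝕂 := ℝ) (t • A)
  let ev : Matrix ι ι ℝ →L[ℝ] (ι → ℝ) :=
    LinearMap.toContinuousLinearMap ((Matrix.mulVecBilin ℝ ℝ).flip u)
  have h2 := (ev.hasSum h1).const_smul (Real.exp (-t))
  have e : linearFlow (A - 1) u t = Real.exp (-t) • ev (NormedSpace.exp (t • A)) := by
    have : t • (A - 1) = t • A + (-t) • (1 : Matrix ι ι ℝ) := by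
      rw [smul_sub, neg_smul, sub_eq_add_neg]
    rw [linearFlow, this, Matrix.exp_add_of_commute]
    · have : NormedSpace.exp ((-t) • (1 : Matrix ι ι ℝ)) = Real.exp (-t) • 1 := by
        rw [Matrix.smul_one_eq_diagonal, Matrix.exp_diagonal, Matrix.smul_one_eq_diagonal]
        congr 1
        funext i
        rw [Pi.coe_exp, Real.exp_eq_exp_ℝ]
      rw [this]
      simp [ev, Matrix.smul_mulVec]
    · exact (Commute.one_right _).smul_right _
  have e2 : (fun n : ℕ => (Real.exp (-t) * t ^ n / n.factorial) • (A ^ n *ᵥ u)) =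
      fun n : ℕ => Real.exp (-t) • ev ((n.factorial : ℝ)⁻¹ • (t • A) ^ n) := by
    funext n
    simp only [ev, smul_pow, map_smul, LinearMap.coe_toContinuousLinearMap', LinearMap.flip_apply,
      Matrix.mulVecBilin_apply, smul_smul]
    ring_nf
  rw [e, e2]
  exact h2

end LinearFlow

/-! ### Scalar relaxation equations -/

/-- Solutions of `w' = -G w + f` with `|f| ≤ G ρ` decay at the rate `G` down to the level `ρ`. -/
theorem abs_le_of_relaxation {w f : ℝ → ℝ} {G ρ T : ℝ}
    (hw : ∀ τ, HasDerivAt w (-G * w τ + f τ) τ) (hf : ∀ τ ∈ Icc 0 T, |f τ| ≤ G * ρ) (hρ : 0 ≤ ρ) :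
    ∀ τ ∈ Icc 0 T, |w τ| ≤ |w 0| * Real.exp (-(G * τ)) + ρ := by
  have upper : ∀ {w f : ℝ → ℝ}, (∀ τ, HasDerivAt w (-G * w τ + f τ) τ) →
      (∀ τ ∈ Icc 0 T, |f τ| ≤ G * ρ) → ∀ τ ∈ Icc 0 T, w τ ≤ |w 0| * Real.exp (-(G * τ)) + ρ := by
    intro w f hw hf τ hτ
    have hd : ∀ τ, HasDerivAt (fun τ => Real.exp (G * τ) * (w τ - ρ))
        (Real.exp (G * τ) * (f τ - G * ρ)) τ := by
      intro τ
      have h1 : HasDerivAt (fun τ : ℝ => Real.exp (G * τ)) (Real.exp (G * τ) * (G * 1)) τ :=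
        ((hasDerivAt_id τ).const_mul G).exp
      exact (h1.mul ((hw τ).sub_const ρ)).congr_deriv (by ring)
    have hanti : AntitoneOn (fun τ => Real.exp (G * τ) * (w τ - ρ)) (Icc 0 T) := by
      refine antitoneOn_of_deriv_nonpos (convex_Icc 0 T)
        (fun τ _ => (hd τ).continuousAt.continuousWithinAt)
        (fun τ _ => (hd τ).differentiableAt.differentiableWithinAt) fun τ hτ => ?_
      rw [(hd τ).deriv]
      have := (abs_le.1 (hf τ (interior_subset hτ))).2
      exact mul_nonpos_of_nonneg_of_nonpos (Real.exp_pos _).le (by linarith)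
    have h := hanti ⟨le_rfl, hτ.1.trans hτ.2⟩ hτ hτ.1
    simp only [mul_zero, Real.exp_zero, one_mul] at h
    have h2 : w τ - ρ ≤ |w 0| * Real.exp (-(G * τ)) := by
      rw [Real.exp_neg, ← div_eq_mul_inv, le_div_iff₀ (Real.exp_pos _), mul_comm]
      linarith [le_abs_self (w 0)]
    linarith
  intro τ hτ
  refine abs_le'.2 ⟨upper hw hf τ hτ, ?_⟩
  have := upper (w := fun τ => -w τ) (f := fun τ => -f τ)
    (fun τ => (hw τ).neg.congr_deriv (by ring)) (fun τ hτ => by simpa using hf τ hτ) τ hτ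
  simpa using this

/-- A quantity that relaxes at a rate `G` towards `f`, where `f` is close to a slowly varying `F`,
is close to `F` once the initial layer has decayed. -/
theorem abs_sub_le_of_relaxation {w f F F' : ℝ → ℝ} {G K ρ T : ℝ} (hG : 0 < G) (hK : 0 ≤ K)
    (hρ : 0 ≤ ρ) (hw : ∀ τ, HasDerivAt w (-G * (w τ - f τ)) τ) (hF : ∀ τ, HasDerivAt F (F' τ) τ)
    (hF' : ∀ τ ∈ Icc 0 T, |F' τ| ≤ K) (hf : ∀ τ ∈ Icc 0 T, |f τ - F τ| ≤ ρ) :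
    ∀ τ ∈ Icc 0 T, |w τ - F τ| ≤ |w 0 - F 0| * Real.exp (-(G * τ)) + (ρ + K / G) := by
  refine abs_le_of_relaxation (w := fun τ => w τ - F τ)
    (f := fun τ => G * (f τ - F τ) - F' τ)
    (fun τ => ((hw τ).sub (hF τ)).congr_deriv (by ring)) (fun τ hτ => ?_) (by positivity)
  calc |G * (f τ - F τ) - F' τ| ≤ |G * (f τ - F τ)| + |F' τ| := abs_sub _ _
    _ ≤ G * ρ + K := by
      rw [abs_mul, abs_of_pos hG]
      gcongr
      exacts [hf τ hτ, hF' τ hτ]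
    _ = G * (ρ + K / G) := by field_simp

/-- A quantity that relaxes at a diverging rate towards `f → F` converges to `F`, uniformly up to
time zero when its initial values converge to `F 0`. -/
theorem tendstoUniformlyOn_relaxation {w f : ℕ → ℝ → ℝ} {F F' : ℝ → ℝ} {G : ℕ → ℝ} {K T : ℝ}
    (hG : Tendsto G atTop atTop) (hw : ∀ d τ, HasDerivAt (w d) (-G d * (w d τ - f d τ)) τ)
    (hF : ∀ τ, HasDerivAt F (F' τ) τ) (hF' : ∀ τ ∈ Icc 0 T, |F' τ| ≤ K)
    (hf : TendstoUniformlyOn f F atTop (Icc 0 T)) (h0 : Tendsto (fun d => w d 0) atTop (𝓝 (F 0))) :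
    TendstoUniformlyOn w F atTop (Icc 0 T) := by
  rw [Metric.tendstoUniformlyOn_iff] at hf ⊢
  intro ε hε
  rcases (Icc 0 T).eq_empty_or_nonempty with he | ⟨τ₀, hτ₀⟩
  · simp [he]
  have hK : 0 ≤ K := (abs_nonneg _).trans (hF' τ₀ hτ₀)
  have h1 : ∀ᶠ d in atTop, |w d 0 - F 0| < ε / 4 := by
    simpa [Real.dist_eq] using Metric.tendsto_nhds.1 h0 (ε / 4) (by positivity)
  have h2 : ∀ᶠ d in atTop, K / G d < ε / 4 :=
    (hG.const_div_atTop K).eventually (gt_mem_nhds (by positivity))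
  filter_upwards [hf (ε / 4) (by positivity), h1, h2, hG.eventually_gt_atTop 0]
    with d hfd h1 h2 hGd τ hτ
  have := abs_sub_le_of_relaxation hGd hK (by positivity : 0 ≤ ε / 4) (hw d) hF hF'
    (fun τ hτ => by rw [abs_sub_comm]; exact (hfd τ hτ).le) τ hτ
  have h3 : Real.exp (-(G d * τ)) ≤ 1 := Real.exp_le_one_iff.2 (by nlinarith [hτ.1])
  have h4 : |w d 0 - F 0| * Real.exp (-(G d * τ)) ≤ |w d 0 - F 0| * 1 := by gcongr
  rw [Real.dist_eq, abs_sub_comm]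
  linarith

/-- Without convergence of the initial values, the convergence holds outside an initial layer. -/
theorem tendstoUniformlyOn_relaxation_layer {w f : ℕ → ℝ → ℝ} {F F' : ℝ → ℝ} {G : ℕ → ℝ}
    {K K₀ δ T : ℝ} (hδ : 0 < δ)
    (hG : Tendsto G atTop atTop) (hw : ∀ d τ, HasDerivAt (w d) (-G d * (w d τ - f d τ)) τ)
    (hF : ∀ τ, HasDerivAt F (F' τ) τ) (hF' : ∀ τ ∈ Icc 0 T, |F' τ| ≤ K)
    (hf : TendstoUniformlyOn f F atTop (Icc 0 T)) (h0 : ∀ᶠ d in atTop, |w d 0| ≤ K₀) :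
    TendstoUniformlyOn w F atTop (Icc δ T) := by
  rw [Metric.tendstoUniformlyOn_iff] at hf ⊢
  intro ε hε
  rcases (Icc 0 T).eq_empty_or_nonempty with he | ⟨τ₀, hτ₀⟩
  · refine Eventually.of_forall fun d τ hτ => ?_
    have : τ ∈ Icc 0 T := ⟨hδ.le.trans hτ.1, hτ.2⟩
    simp [he] at this
  have hK : 0 ≤ K := (abs_nonneg _).trans (hF' τ₀ hτ₀)
  have h1 : Tendsto (fun d => (K₀ + |F 0|) * Real.exp (-(G d * δ))) atTop (𝓝 0) := by
    simpa using (Real.tendsto_exp_neg_atTop_nhds_zero.comp (hG.atTop_mul_const hδ)).const_mul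
      (K₀ + |F 0|)
  have h2 : ∀ᶠ d in atTop, K / G d < ε / 4 :=
    (hG.const_div_atTop K).eventually (gt_mem_nhds (by positivity))
  filter_upwards [hf (ε / 4) (by positivity), h0, h2, hG.eventually_gt_atTop 0,
    h1.eventually (gt_mem_nhds (by positivity : 0 < ε / 4))] with d hfd h0 h2 hGd h1 τ hτ
  have := abs_sub_le_of_relaxation hGd hK (by positivity : 0 ≤ ε / 4) (hw d) hF hF'
    (fun τ hτ => by rw [abs_sub_comm]; exact (hfd τ hτ).le) τ ⟨hδ.le.trans hτ.1, hτ.2⟩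
  have h3 : |w d 0 - F 0| * Real.exp (-(G d * τ)) ≤ (K₀ + |F 0|) * Real.exp (-(G d * δ)) := by
    have h4 : |w d 0 - F 0| ≤ K₀ + |F 0| := (abs_sub (w d 0) (F 0)).trans (by gcongr)
    have h5 := (abs_nonneg _).trans h4
    gcongr
    exact hτ.1
  rw [Real.dist_eq, abs_sub_comm]
  linarith

/-- Solutions of `s' = a s + f` converge uniformly to `r e^(a' τ)` when `a → a'`, `f → 0` and
`s 0 → r`. -/
theorem tendstoUniformlyOn_exp_of_hasDerivAt {s f : ℕ → ℝ → ℝ} {a : ℕ → ℝ} {a' r T : ℝ}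
    (ha : Tendsto a atTop (𝓝 a')) (hs : ∀ d τ, HasDerivAt (s d) (a d * s d τ + f d τ) τ)
    (hf : TendstoUniformlyOn f (fun _ => 0) atTop (Icc 0 T))
    (h0 : Tendsto (fun d => s d 0) atTop (𝓝 r)) :
    TendstoUniformlyOn s (fun τ => r * Real.exp (a' * τ)) atTop (Icc 0 T) := by
  rw [Metric.tendstoUniformlyOn_iff] at hf ⊢
  intro ε hε
  rcases (Icc 0 T).eq_empty_or_nonempty with he | ⟨τ₀, hτ₀⟩
  · simp [he]
  have hT : 0 ≤ T := hτ₀.1.trans hτ₀.2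
  -- with the weight `e^(-c τ)` the difference to the limit relaxes at a rate at least one.
  set c : ℝ := |a'| + 2 with hc
  have hc0 : 0 ≤ c := by positivity
  set M : ℝ := |r| * Real.exp (|a'| * T) + 1 with hM
  have hM0 : 0 < M := by positivity
  set ε' : ℝ := ε / 4 * Real.exp (-(c * T)) with hε'
  have hε'0 : 0 < ε' := by positivity
  have h1 : ∀ᶠ d in atTop, |s d 0 - r| < ε' := by
    simpa [Real.dist_eq] using Metric.tendsto_nhds.1 h0 ε' hε'0
  have h2 : ∀ᶠ d in atTop, |a d - a'| < min 1 (ε' / M) := by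
    simpa [Real.dist_eq] using Metric.tendsto_nhds.1 ha (min 1 (ε' / M)) (by positivity)
  filter_upwards [hf ε' hε'0, h1, h2] with d hfd h1 h2 τ hτ
  have hF : ∀ τ, HasDerivAt (fun τ => r * Real.exp (a' * τ)) (a' * (r * Real.exp (a' * τ))) τ := by
    intro τ
    exact ((((hasDerivAt_id τ).const_mul a').exp).const_mul r).congr_deriv (by simp; ring)
  have hE : ∀ τ, HasDerivAt (fun τ => Real.exp (-(c * τ))) (-c * Real.exp (-(c * τ))) τ := by
    intro τ
    exact ((((hasDerivAt_id τ).const_mul c).neg).exp).congr_deriv (by simp; ring)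
  have hGd : 1 ≤ c - a d := by
    have := (abs_lt.1 (h2.trans_le (min_le_left _ _))).2
    linarith [le_abs_self a']
  have hb := abs_le_of_relaxation (G := c - a d) (ρ := 2 * ε') (T := T)
    (w := fun τ => Real.exp (-(c * τ)) * (s d τ - r * Real.exp (a' * τ)))
    (f := fun τ => Real.exp (-(c * τ)) * ((a d - a') * (r * Real.exp (a' * τ)) + f d τ))
    (fun τ => ((hE τ).mul ((hs d τ).sub (hF τ))).congr_deriv (by simp only [Pi.sub_apply]; ring))
    (fun τ hτ => by
      have e1 : Real.exp (-(c * τ)) ≤ 1 := Real.exp_le_one_iff.2 (by nlinarith [hτ.1])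
      have e2 : |r * Real.exp (a' * τ)| ≤ M := by
        rw [abs_mul, abs_of_pos (Real.exp_pos _), hM]
        have : Real.exp (a' * τ) ≤ Real.exp (|a'| * T) := by
          refine Real.exp_le_exp.2 ?_
          calc a' * τ ≤ |a'| * τ := by gcongr; exacts [hτ.1, le_abs_self _]
            _ ≤ |a'| * T := by gcongr; exact hτ.2
        nlinarith [abs_nonneg r]
      have e3 : |(a d - a') * (r * Real.exp (a' * τ))| ≤ ε' := by
        rw [abs_mul]
        calc |a d - a'| * |r * Real.exp (a' * τ)| ≤ (ε' / M) * M := by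
              gcongr
              exact (h2.trans_le (min_le_right _ _)).le
          _ = ε' := by field_simp
      have e4 : |f d τ| ≤ ε' := by simpa [Real.dist_eq] using (hfd τ hτ).le
      calc |Real.exp (-(c * τ)) * ((a d - a') * (r * Real.exp (a' * τ)) + f d τ)|
          = Real.exp (-(c * τ)) * |(a d - a') * (r * Real.exp (a' * τ)) + f d τ| := by
            rw [abs_mul, abs_of_pos (Real.exp_pos _)]
        _ ≤ 1 * (ε' + ε') := by
            gcongr
            exact (abs_add_le _ _).trans (add_le_add e3 e4)
        _ ≤ (c - a d) * (2 * ε') := by nlinarith)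
    (by positivity) τ hτ
  have h3 : Real.exp (-((c - a d) * τ)) ≤ 1 := Real.exp_le_one_iff.2 (by nlinarith [hτ.1])
  have h4 : |Real.exp (-(c * 0)) * (s d 0 - r * Real.exp (a' * 0))| ≤ ε' := by
    simpa using h1.le
  have h5 : Real.exp (-(c * τ)) * |s d τ - r * Real.exp (a' * τ)| ≤ 3 * ε' := by
    rw [abs_mul, abs_of_pos (Real.exp_pos (-(c * τ)))] at hb
    have : |Real.exp (-(c * 0)) * (s d 0 - r * Real.exp (a' * 0))| *
        Real.exp (-((c - a d) * τ)) ≤ ε' * 1 := by gcongr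
    linarith
  rw [Real.dist_eq, abs_sub_comm]
  have h6 : Real.exp (-(c * T)) ≤ Real.exp (-(c * τ)) := Real.exp_le_exp.2 (by nlinarith [hτ.2])
  have h7 : Real.exp (-(c * T)) * |s d τ - r * Real.exp (a' * τ)| ≤ 3 * ε' :=
    (mul_le_mul_of_nonneg_right h6 (abs_nonneg _)).trans h5
  rw [hε'] at h7
  have h8 := Real.exp_pos (-(c * T))
  by_contra hcon
  push Not at hcon
  nlinarith

/-- A-priori bound: damping of two components with nonnegative rates does not affect the
exponential growth bound of a linear system. -/
theorem sq_add_sq_add_sq_le_of_damped {s x n fs fx fn : ℝ → ℝ} {G₁ G₂ K T : ℝ} (hG₁ : 0 ≤ G₁)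
    (hG₂ : 0 ≤ G₂) (hK : 0 ≤ K)
    (hs : ∀ τ, HasDerivAt s (fs τ) τ) (hx : ∀ τ, HasDerivAt x (-G₁ * x τ + fx τ) τ)
    (hn : ∀ τ, HasDerivAt n (-G₂ * n τ + fn τ) τ)
    (hfs : ∀ τ, |fs τ| ≤ K * (|s τ| + |x τ| + |n τ|))
    (hfx : ∀ τ, |fx τ| ≤ K * (|s τ| + |x τ| + |n τ|))
    (hfn : ∀ τ, |fn τ| ≤ K * (|s τ| + |x τ| + |n τ|)) :
    ∀ τ ∈ Icc 0 T, s τ ^ 2 + x τ ^ 2 + n τ ^ 2 ≤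
      (s 0 ^ 2 + x 0 ^ 2 + n 0 ^ 2) * Real.exp (6 * K * T) := by
  intro τ hτ
  have hE : ∀ τ, HasDerivAt (fun τ => Real.exp (-(6 * K * τ)))
      (-(6 * K) * Real.exp (-(6 * K * τ))) τ := by
    intro τ
    exact ((((hasDerivAt_id τ).const_mul (6 * K)).neg).exp).congr_deriv (by simp; ring)
  have hd : ∀ τ, HasDerivAt (fun τ => Real.exp (-(6 * K * τ)) * (s τ ^ 2 + x τ ^ 2 + n τ ^ 2))
      (Real.exp (-(6 * K * τ)) * (2 * (s τ * fs τ + x τ * (-G₁ * x τ + fx τ) +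
        n τ * (-G₂ * n τ + fn τ)) - 6 * K * (s τ ^ 2 + x τ ^ 2 + n τ ^ 2))) τ := fun τ =>
    ((hE τ).mul ((((hs τ).pow 2).add ((hx τ).pow 2)).add ((hn τ).pow 2))).congr_deriv
      (by simp; ring)
  have hanti : Antitone (fun τ => Real.exp (-(6 * K * τ)) * (s τ ^ 2 + x τ ^ 2 + n τ ^ 2)) := by
    refine antitone_of_deriv_nonpos (fun τ => (hd τ).differentiableAt) fun τ => ?_
    rw [(hd τ).deriv]
    refine mul_nonpos_of_nonneg_of_nonpos (Real.exp_pos _).le ?_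
    have prod : ∀ {a b : ℝ}, |b| ≤ K * (|s τ| + |x τ| + |n τ|) →
        a * b ≤ |a| * (K * (|s τ| + |x τ| + |n τ|)) := fun {a b} hb =>
      (le_abs_self _).trans (by rw [abs_mul]; gcongr)
    have h1 := prod (a := s τ) (hfs τ)
    have h2 := prod (a := x τ) (hfx τ)
    have h3 := prod (a := n τ) (hfn τ)
    have h4 : (|s τ| + |x τ| + |n τ|) * (|s τ| + |x τ| + |n τ|) ≤
        3 * (s τ ^ 2 + x τ ^ 2 + n τ ^ 2) := by
      rw [← sq_abs (s τ), ← sq_abs (x τ), ← sq_abs (n τ)]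
      nlinarith [sq_nonneg (|s τ| - |x τ|), sq_nonneg (|s τ| - |n τ|), sq_nonneg (|x τ| - |n τ|)]
    have h5 := mul_le_mul_of_nonneg_left h4 hK
    have h6 := mul_nonneg hG₁ (sq_nonneg (x τ))
    have h7 := mul_nonneg hG₂ (sq_nonneg (n τ))
    nlinarith
  have h := hanti hτ.1
  simp only [mul_zero, neg_zero, Real.exp_zero, one_mul] at h
  rw [Real.exp_neg, inv_mul_le_iff₀ (Real.exp_pos _), mul_comm] at h
  refine h.trans ?_
  gcongr
  exact hτ.2

/-! ### Moments of Gaussian vectors -/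

section Gaussian

open scoped NNReal RealInnerProductSpace

/-- The fourth moment, as the fourth derivative at zero of the moment generating function
`e^(v t² / 2)`. -/
theorem integral_pow_four_gaussianReal (v : ℝ≥0) :
    ∫ x, x ^ 4 ∂gaussianReal 0 v = 3 * (v : ℝ) ^ 2 := by
  have h0 : (0 : ℝ) ∈ interior (integrableExpSet id (gaussianReal 0 v)) := by
    simp [integrableExpSet_id_gaussianReal]
  have h := iteratedDeriv_mgf_zero h0 4
  have hE : ∀ t : ℝ, HasDerivAt (fun t : ℝ => Real.exp (v * t ^ 2 / 2))
      (v * t * Real.exp (v * t ^ 2 / 2)) t := fun t =>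
    (((((hasDerivAt_id t).pow 2).const_mul (v : ℝ)).div_const 2).exp).congr_deriv (by simp; ring)
  have e0 : mgf id (gaussianReal 0 v) = fun t => Real.exp (v * t ^ 2 / 2) := by
    rw [mgf_id_gaussianReal]; simp
  have step : ∀ {q q' : ℝ → ℝ}, (∀ t, HasDerivAt q (q' t) t) →
      deriv (fun t => q t * Real.exp (v * t ^ 2 / 2)) =
        fun t => (q' t + q t * (v * t)) * Real.exp (v * t ^ 2 / 2) := fun {q q'} hq => by
    funext t
    rw [((hq t).fun_mul (hE t)).deriv]; ring
  have key : iteratedDeriv 4 (mgf id (gaussianReal 0 v)) 0 = 3 * (v : ℝ) ^ 2 := by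
    rw [e0]
    simp only [iteratedDeriv_succ, iteratedDeriv_zero]
    have d1 : deriv (fun t : ℝ => Real.exp (v * t ^ 2 / 2)) =
        fun t => (v * t) * Real.exp (v * t ^ 2 / 2) := by
      funext t; rw [(hE t).deriv]
    rw [d1, step (q' := fun _ => v) fun t => by simpa using (hasDerivAt_id t).const_mul (v : ℝ),
      step (q' := fun t => 2 * v ^ 2 * t) fun t => by
        have h1 := (hasDerivAt_id t).const_mul (v : ℝ)
        have := (h1.mul h1).const_add (v : ℝ)
        exact this.congr_deriv (by simp; ring),
      step (q' := fun t => 2 * v ^ 2 + v * (v : ℝ) + 3 * v ^ 3 * t ^ 2) fun t => by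
        have h1 := (hasDerivAt_id t).const_mul (2 * (v : ℝ) ^ 2)
        have h3 := (hasDerivAt_id t).const_mul (v : ℝ)
        have h2 := (h3.mul h3).const_add (v : ℝ)
        exact (h1.add (h2.mul h3)).congr_deriv (by simp; ring)]
    simp; ring
  rw [key] at h
  simpa using h.symm

variable {E : Type*} [NormedAddCommGroup E] [InnerProductSpace ℝ E] [FiniteDimensional ℝ E]
  [MeasurableSpace E] [BorelSpace E]

theorem map_inner_stdGaussian (u : E) :
    (stdGaussian E).map (fun x => ⟪x, u⟫) = gaussianReal 0 (‖u‖ ^ 2).toNNReal := by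
  have h := IsGaussian.map_eq_gaussianReal (μ := stdGaussian E) (innerSL ℝ u)
  rw [integral_strongDual_stdGaussian, variance_dual_stdGaussian, innerSL_apply_norm] at h
  rw [← h]
  congr 1
  funext x
  simp [real_inner_comm]

theorem integral_inner_sq_stdGaussian (u : E) : ∫ x, ⟪x, u⟫ ^ 2 ∂stdGaussian E = ‖u‖ ^ 2 := by
  have h : ∫ x, ⟪x, u⟫ ^ 2 ∂stdGaussian E = ∫ y, y ^ 2 ∂gaussianReal 0 (‖u‖ ^ 2).toNNReal := by
    rw [← map_inner_stdGaussian, integral_map (by fun_prop) (by fun_prop)]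
  have h2 := variance_fun_id_gaussianReal (μ := 0) (v := (‖u‖ ^ 2).toNNReal)
  rw [variance_eq_integral (by fun_prop)] at h2
  simp only [integral_id_gaussianReal, sub_zero] at h2
  rw [h, h2, Real.coe_toNNReal _ (by positivity)]

theorem integral_inner_pow_four_stdGaussian (u : E) :
    ∫ x, ⟪x, u⟫ ^ 4 ∂stdGaussian E = 3 * ‖u‖ ^ 4 := by
  have h : ∫ x, ⟪x, u⟫ ^ 4 ∂stdGaussian E = ∫ y, y ^ 4 ∂gaussianReal 0 (‖u‖ ^ 2).toNNReal := by
    rw [← map_inner_stdGaussian, integral_map (by fun_prop) (by fun_prop)]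
  rw [h, integral_pow_four_gaussianReal, Real.coe_toNNReal _ (by positivity)]
  ring

theorem integrable_norm_pow_stdGaussian (n : ℕ) :
    Integrable (fun x => ‖x‖ ^ n) (stdGaussian E) :=
  (IsGaussian.memLp_id (stdGaussian E) n (by simp)).integrable_norm_pow'

theorem integrable_inner_mul_inner_stdGaussian (u v : E) :
    Integrable (fun x => ⟪x, u⟫ * ⟪x, v⟫) (stdGaussian E) := by
  refine ((integrable_norm_pow_stdGaussian (E := E) 2).const_mul (‖u‖ * ‖v‖)).mono'
    (by fun_prop) (.of_forall fun x => ?_)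
  rw [norm_mul]
  calc ‖⟪x, u⟫‖ * ‖⟪x, v⟫‖ ≤ (‖x‖ * ‖u‖) * (‖x‖ * ‖v‖) := by
        gcongr <;> exact norm_inner_le_norm _ _
    _ = ‖u‖ * ‖v‖ * ‖x‖ ^ 2 := by ring

theorem integrable_inner_sq_mul_inner_sq_stdGaussian (u v : E) :
    Integrable (fun x => ⟪x, u⟫ ^ 2 * ⟪x, v⟫ ^ 2) (stdGaussian E) := by
  refine ((integrable_norm_pow_stdGaussian (E := E) 4).const_mul (‖u‖ ^ 2 * ‖v‖ ^ 2)).mono'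
    (by fun_prop) (.of_forall fun x => ?_)
  rw [norm_mul, norm_pow, norm_pow]
  calc ‖⟪x, u⟫‖ ^ 2 * ‖⟪x, v⟫‖ ^ 2 ≤ (‖x‖ * ‖u‖) ^ 2 * (‖x‖ * ‖v‖) ^ 2 := by
        gcongr <;> exact norm_inner_le_norm _ _
    _ = ‖u‖ ^ 2 * ‖v‖ ^ 2 * ‖x‖ ^ 4 := by ring

theorem integral_inner_mul_inner_stdGaussian (u v : E) :
    ∫ x, ⟪x, u⟫ * ⟪x, v⟫ ∂stdGaussian E = ⟪u, v⟫ := by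
  have e : ∀ x : E, ⟪x, u⟫ * ⟪x, v⟫ =
      2⁻¹ * ⟪x, u + v⟫ ^ 2 - (2⁻¹ * ⟪x, u⟫ ^ 2 + 2⁻¹ * ⟪x, v⟫ ^ 2) := by
    intro x; rw [inner_add_right]; ring
  have i : ∀ w : E, Integrable (fun x => 2⁻¹ * ⟪x, w⟫ ^ 2) (stdGaussian E) := fun w => by
    simpa [sq] using (integrable_inner_mul_inner_stdGaussian w w).const_mul 2⁻¹
  simp_rw [e]
  rw [integral_sub (i _) ((i _).fun_add (i _)), integral_add (i _) (i _)]
  simp_rw [integral_const_mul, integral_inner_sq_stdGaussian]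
  rw [norm_add_sq_real]; ring

/-- Wick's formula `𝔼⟨x, u⟩²⟨x, v⟩² = ‖u‖²‖v‖² + 2⟨u, v⟩²`, by polarization of the fourth moment. -/
theorem integral_inner_sq_mul_inner_sq_stdGaussian (u v : E) :
    ∫ x, ⟪x, u⟫ ^ 2 * ⟪x, v⟫ ^ 2 ∂stdGaussian E = ‖u‖ ^ 2 * ‖v‖ ^ 2 + 2 * ⟪u, v⟫ ^ 2 := by
  have e : ∀ x : E, ⟪x, u⟫ ^ 2 * ⟪x, v⟫ ^ 2 = (12⁻¹ * ⟪x, u + v⟫ ^ 4 + 12⁻¹ * ⟪x, u - v⟫ ^ 4) -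
      (6⁻¹ * ⟪x, u⟫ ^ 4 + 6⁻¹ * ⟪x, v⟫ ^ 4) := by
    intro x; rw [inner_add_right, inner_sub_right]; ring
  have i : ∀ (c : ℝ) (w : E), Integrable (fun x => c * ⟪x, w⟫ ^ 4) (stdGaussian E) := fun c w => by
    simpa [← pow_add] using (integrable_inner_sq_mul_inner_sq_stdGaussian w w).const_mul c
  simp_rw [e]
  rw [integral_sub ((i _ _).fun_add (i _ _)) ((i _ _).fun_add (i _ _)),
    integral_add (i _ _) (i _ _), integral_add (i _ _) (i _ _)]
  simp_rw [integral_const_mul, integral_inner_pow_four_stdGaussian]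
  have h1 := norm_add_sq_real u v
  have h2 := norm_sub_sq_real u v
  have h3 : ‖u + v‖ ^ 4 = (‖u + v‖ ^ 2) ^ 2 := by ring
  have h4 : ‖u - v‖ ^ 4 = (‖u - v‖ ^ 2) ^ 2 := by ring
  rw [h3, h4, h1, h2]; ring

/-- `𝔼⟨x, u⟩²‖x‖² = (dim E + 2) ‖u‖²`: Wick's formula summed over an orthonormal basis. This is the
origin of the factor `d + 2` in `Params.noise`. -/
theorem integral_inner_sq_mul_norm_sq_stdGaussian (u : E) :
    ∫ x, ⟪x, u⟫ ^ 2 * ‖x‖ ^ 2 ∂stdGaussian E = (Module.finrank ℝ E + 2) * ‖u‖ ^ 2 := by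
  let b := stdOrthonormalBasis ℝ E
  have e : ∀ x : E, ⟪x, u⟫ ^ 2 * ‖x‖ ^ 2 = ∑ i, ⟪x, u⟫ ^ 2 * ⟪x, b i⟫ ^ 2 := by
    intro x
    rw [← b.sum_sq_inner_left x, Finset.mul_sum]
  simp_rw [e]
  rw [integral_finsetSum _ fun i _ => integrable_inner_sq_mul_inner_sq_stdGaussian _ _]
  simp_rw [integral_inner_sq_mul_inner_sq_stdGaussian]
  rw [Finset.sum_add_distrib, ← Finset.mul_sum, ← Finset.mul_sum, b.sum_sq_inner_left u]
  simp; ring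

end Gaussian

/-! ### Moments of the minibatch gradient -/

section Batch

open scoped RealInnerProductSpace

variable {d B : ℕ}

instance (p : unitInterval) : IsProbabilityMeasure (sampleLaw d p) := by
  unfold sampleLaw; infer_instance

@[fun_prop]
theorem measurable_gatedInput : Measurable (gatedInput (d := d)) :=
  Measurable.ite (measurable_fst (MeasurableSet.singleton true)) measurable_snd measurable_const

theorem norm_gatedInput_le (a : Sample d) : ‖gatedInput a‖ ≤ ‖a.2‖ := by
  unfold gatedInput; split_ifs <;> simp

theorem integrable_norm_gatedInput_pow (p : unitInterval) (n : ℕ) :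
    Integrable (fun a : Sample d => ‖gatedInput a‖ ^ n) (sampleLaw d p) := by
  refine ((integrable_norm_pow_stdGaussian (E := Vec d) n).comp_snd
    (bernoulliMeasure true false p)).mono' ?_ (.of_forall fun a => ?_)
  · fun_prop
  · rw [norm_pow, norm_norm]
    exact pow_le_pow_left₀ (norm_nonneg _) (norm_gatedInput_le a) n

theorem integral_gatedInput (p : unitInterval) {f : Vec d → ℝ} (hf : Measurable f) (hf0 : f 0 = 0)
    (hi : Integrable f (stdGaussian (Vec d))) :
    ∫ a, f (gatedInput a) ∂sampleLaw d p = p * ∫ x, f x ∂stdGaussian (Vec d) := by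
  have hi' : Integrable (fun a : Sample d => f (gatedInput a)) (sampleLaw d p) := by
    refine (hi.comp_snd (bernoulliMeasure true false p)).mono
      (hf.comp measurable_gatedInput).aestronglyMeasurable (.of_forall fun a => ?_)
    unfold gatedInput
    split_ifs <;> simp [hf0]
  unfold sampleLaw at hi' ⊢
  rw [integral_prod _ hi', integral_bernoulliMeasure]
  simp [gatedInput, hf0]

/-- The gradient of a minibatch as a linear map of the error vector, `u ↦ (1/B) ∑ᵢ xᵢ ⟨xᵢ, u⟩`. -/
noncomputable def batchMap (b : Fin B → Sample d) (u : Vec d) : Vec d :=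
  (B : ℝ)⁻¹ • ∑ i, (inner ℝ (gatedInput (b i)) u) • gatedInput (b i)

theorem batchGrad_eq_batchMap (θstar θ : Vec d) (b : Fin B → Sample d) :
    batchGrad θstar θ b = batchMap b (θ - θstar) := rfl

/-- The trace `(1/B) ∑ᵢ ‖xᵢ‖²`, an upper bound for the operator norm of `batchMap`. -/
noncomputable def batchTrace (b : Fin B → Sample d) : ℝ := (B : ℝ)⁻¹ * ∑ i, ‖gatedInput (b i)‖ ^ 2

theorem norm_batchMap_le (b : Fin B → Sample d) (u : Vec d) :
    ‖batchMap b u‖ ≤ batchTrace b * ‖u‖ := by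
  unfold batchMap batchTrace
  rw [norm_smul, norm_inv, Real.norm_natCast, mul_assoc]
  gcongr
  rw [Finset.sum_mul]
  refine (norm_sum_le _ _).trans (Finset.sum_le_sum fun i _ => ?_)
  rw [norm_smul]
  calc ‖⟪gatedInput (b i), u⟫‖ * ‖gatedInput (b i)‖
      ≤ (‖gatedInput (b i)‖ * ‖u‖) * ‖gatedInput (b i)‖ := by
        gcongr; exact norm_inner_le_norm _ _
    _ = ‖gatedInput (b i)‖ ^ 2 * ‖u‖ := by ring

theorem measurable_batchMap :
    Measurable fun x : (Fin B → Sample d) × Vec d => batchMap x.1 x.2 := by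
  unfold batchMap
  fun_prop

/-- An inactive minibatch has zero gradient, so conditioning on activity only rescales the moments
of the gradient by `1 / P_batch`. -/
theorem batchMap_eq_zero_of_notMem {b : Fin B → Sample d} (hb : b ∉ activeBatches d B) (u : Vec d) :
    batchMap b u = 0 := by
  have h : ∀ i, gatedInput (b i) = 0 := fun i => by
    have : ¬ (b i).1 = true := fun h => hb ⟨i, h⟩
    simp [gatedInput, this]
  simp [batchMap, h]

theorem integrable_eval_pi {p : unitInterval} {f : Sample d → ℝ} (hf : Integrable f (sampleLaw d p))
    (i : Fin B) :
    Integrable (fun b : Fin B → Sample d => f (b i)) (Measure.pi fun _ => sampleLaw d p) :=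
  (measurePreserving_eval (fun _ : Fin B => sampleLaw d p) i).integrable_comp_of_integrable hf

theorem integral_eval_pi {p : unitInterval} {f : Sample d → ℝ} (hf : Measurable f) (i : Fin B) :
    ∫ b, f (b i) ∂(Measure.pi fun _ : Fin B => sampleLaw d p) = ∫ a, f a ∂sampleLaw d p := by
  have h := (measurePreserving_eval (fun _ : Fin B => sampleLaw d p) i)
  conv_rhs => rw [← h.map_eq]
  rw [integral_map h.measurable.aemeasurable hf.aestronglyMeasurable]

theorem memLp_norm_gatedInput_sq_eval (p : unitInterval) (i : Fin B) :
    MemLp (fun b : Fin B → Sample d => ‖gatedInput (b i)‖ ^ 2) 2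
      (Measure.pi fun _ => sampleLaw d p) := by
  have hm : Measurable fun b : Fin B → Sample d => ‖gatedInput (b i)‖ ^ 2 := by fun_prop
  rw [memLp_two_iff_integrable_sq hm.aestronglyMeasurable]
  have := integrable_eval_pi (B := B) (integrable_norm_gatedInput_pow (d := d) p 4) i
  refine this.congr (.of_forall fun b => ?_)
  ring

theorem memLp_batchTrace_pi (p : unitInterval) :
    MemLp (batchTrace (d := d) (B := B)) 2 (Measure.pi fun _ => sampleLaw d p) := by
  have h : ∀ i ∈ (Finset.univ : Finset (Fin B)), MemLp
      (fun b : Fin B → Sample d => ‖gatedInput (b i)‖ ^ 2) 2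
      (Measure.pi fun _ => sampleLaw d p) := fun i _ => memLp_norm_gatedInput_sq_eval p i
  exact (memLp_finsetSum Finset.univ h).const_mul _

theorem integrable_gated_inner_mul_inner (p : unitInterval) (u v : Vec d) :
    Integrable (fun a : Sample d => ⟪gatedInput a, u⟫ * ⟪gatedInput a, v⟫) (sampleLaw d p) := by
  refine ((integrable_norm_gatedInput_pow (d := d) p 2).const_mul (‖u‖ * ‖v‖)).mono' ?_
    (.of_forall fun a => ?_)
  · fun_prop
  · rw [norm_mul]
    calc ‖⟪gatedInput a, u⟫‖ * ‖⟪gatedInput a, v⟫‖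
        ≤ (‖gatedInput a‖ * ‖u‖) * (‖gatedInput a‖ * ‖v‖) := by
          gcongr <;> exact norm_inner_le_norm _ _
      _ = ‖u‖ * ‖v‖ * ‖gatedInput a‖ ^ 2 := by ring

theorem integral_gated_inner_mul_inner (p : unitInterval) (u v : Vec d) :
    ∫ a, ⟪gatedInput a, u⟫ * ⟪gatedInput a, v⟫ ∂sampleLaw d p = p * ⟪u, v⟫ := by
  rw [integral_gatedInput (f := fun x => ⟪x, u⟫ * ⟪x, v⟫) p (by fun_prop) (by simp)
    (integrable_inner_mul_inner_stdGaussian u v), integral_inner_mul_inner_stdGaussian]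

theorem integral_gated_inner_sq_mul_norm_sq (p : unitInterval) (u : Vec d) :
    ∫ a, ⟪gatedInput a, u⟫ ^ 2 * ‖gatedInput a‖ ^ 2 ∂sampleLaw d p = p * ((d + 2) * ‖u‖ ^ 2) := by
  rw [integral_gatedInput (f := fun x => ⟪x, u⟫ ^ 2 * ‖x‖ ^ 2) p (by fun_prop) (by simp) ?_,
    integral_inner_sq_mul_norm_sq_stdGaussian]
  · simp
  · refine ((integrable_norm_pow_stdGaussian (E := Vec d) 4).const_mul (‖u‖ ^ 2)).mono'
      (by fun_prop) (.of_forall fun x => ?_)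
    rw [norm_mul, norm_pow, norm_pow, norm_norm]
    calc ‖⟪x, u⟫‖ ^ 2 * ‖x‖ ^ 2 ≤ (‖x‖ * ‖u‖) ^ 2 * ‖x‖ ^ 2 := by
          gcongr; exact norm_inner_le_norm _ _
      _ = ‖u‖ ^ 2 * ‖x‖ ^ 4 := by ring

theorem integral_inner_batchMap_pi (p : unitInterval) (hB : 0 < B) (u v : Vec d) :
    ∫ b, ⟪v, batchMap b u⟫ ∂(Measure.pi fun _ : Fin B => sampleLaw d p) = p * ⟪v, u⟫ := by
  have e : ∀ b : Fin B → Sample d, ⟪v, batchMap b u⟫ =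
      (B : ℝ)⁻¹ * ∑ i, ⟪gatedInput (b i), u⟫ * ⟪gatedInput (b i), v⟫ := fun b => by
    simp [batchMap, inner_smul_right, inner_sum, real_inner_comm v]
  simp_rw [e]
  have hm : Measurable fun a : Sample d => ⟪gatedInput a, u⟫ * ⟪gatedInput a, v⟫ := by fun_prop
  rw [integral_const_mul, integral_finsetSum _ fun i _ =>
    integrable_eval_pi (integrable_gated_inner_mul_inner p u v) i]
  simp_rw [integral_eval_pi hm, integral_gated_inner_mul_inner, real_inner_comm v u]
  simp
  field_simp

/-- The gradient contribution `xᵢ ⟨xᵢ, u⟩` of one sample. -/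
noncomputable def sampleGrad (u : Vec d) (a : Sample d) : Vec d :=
  ⟪gatedInput a, u⟫ • gatedInput a

theorem measurable_sampleGrad (u : Vec d) : Measurable (sampleGrad u) := by
  unfold sampleGrad; fun_prop

theorem norm_sampleGrad_le (u : Vec d) (a : Sample d) :
    ‖sampleGrad u a‖ ≤ ‖gatedInput a‖ ^ 2 * ‖u‖ := by
  rw [sampleGrad, norm_smul]
  calc ‖⟪gatedInput a, u⟫‖ * ‖gatedInput a‖ ≤ (‖gatedInput a‖ * ‖u‖) * ‖gatedInput a‖ := by
        gcongr; exact norm_inner_le_norm _ _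
    _ = ‖gatedInput a‖ ^ 2 * ‖u‖ := by ring

theorem memLp_sampleGrad_eval (p : unitInterval) (u : Vec d) (i : Fin B) :
    MemLp (fun b : Fin B → Sample d => sampleGrad u (b i)) 2
      (Measure.pi fun _ => sampleLaw d p) := by
  have hm : Measurable fun b : Fin B → Sample d => sampleGrad u (b i) :=
    (measurable_sampleGrad u).comp (measurable_pi_apply i)
  have h4 : MemLp (fun b : Fin B → Sample d => ‖gatedInput (b i)‖ ^ 2 * ‖u‖) 2
      (Measure.pi fun _ => sampleLaw d p) := (memLp_norm_gatedInput_sq_eval p i).mul_const ‖u‖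
  exact h4.mono hm.aestronglyMeasurable (.of_forall fun b =>
    (norm_sampleGrad_le u (b i)).trans (le_abs_self _))

/-- Distinct samples contribute independent gradients of mean `p u`. -/
theorem integral_inner_sampleGrad_of_ne (p : unitInterval) (u : Vec d) {i k : Fin B} (hik : i ≠ k) :
    ∫ b, ⟪sampleGrad u (b i), sampleGrad u (b k)⟫ ∂(Measure.pi fun _ : Fin B => sampleLaw d p) =
      (p : ℝ) ^ 2 * ‖u‖ ^ 2 := by
  have coord : ∀ (a : Sample d) (l : Fin d), sampleGrad u a l =
      ⟪gatedInput a, u⟫ * ⟪gatedInput a, EuclideanSpace.single l 1⟫ := fun a l => by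
    simp [sampleGrad, EuclideanSpace.inner_single_right]
  have hm : ∀ l : Fin d, Measurable fun a : Sample d => sampleGrad u a l := fun l =>
    (EuclideanSpace.proj (𝕜 := ℝ) l).measurable.comp (measurable_sampleGrad u)
  have hint : ∀ (l : Fin d) (i : Fin B), ∫ b, sampleGrad u (b i) l
      ∂(Measure.pi fun _ : Fin B => sampleLaw d p) = p * u l := fun l i => by
    rw [integral_eval_pi (hm l)]
    simp_rw [coord]
    rw [integral_gated_inner_mul_inner]
    simp [EuclideanSpace.inner_single_right]
  have hi : ∀ (l : Fin d) (i : Fin B), Integrable (fun b : Fin B → Sample d => sampleGrad u (b i) l)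
      (Measure.pi fun _ : Fin B => sampleLaw d p) := fun l i => by
    refine integrable_eval_pi (f := fun a => sampleGrad u a l) ?_ i
    simp_rw [coord]
    exact integrable_gated_inner_mul_inner p u _
  have hind : ∀ l : Fin d, IndepFun (fun b : Fin B → Sample d => sampleGrad u (b i) l)
      (fun b : Fin B → Sample d => sampleGrad u (b k) l)
      (Measure.pi fun _ : Fin B => sampleLaw d p) := fun l =>
    (iIndepFun_pi (X := fun (_ : Fin B) a => sampleGrad u a l)
      fun _ => (hm l).aemeasurable).indepFun hik
  have e : ∀ b : Fin B → Sample d, ⟪sampleGrad u (b i), sampleGrad u (b k)⟫ =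
      ∑ l, sampleGrad u (b i) l * sampleGrad u (b k) l := fun b => by
    simp [PiLp.inner_apply, mul_comm]
  simp_rw [e]
  have hi2 : ∀ l, Integrable
      (fun b : Fin B → Sample d => sampleGrad u (b i) l * sampleGrad u (b k) l)
      (Measure.pi fun _ : Fin B => sampleLaw d p) := fun l =>
    (hind l).integrable_mul (hi l i) (hi l k)
  rw [integral_finsetSum _ fun l _ => hi2 l]
  have e2 : ∀ l, ∫ b, sampleGrad u (b i) l * sampleGrad u (b k) l
      ∂(Measure.pi fun _ : Fin B => sampleLaw d p) = (p : ℝ) ^ 2 * u l ^ 2 := fun l => by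
    have := (hind l).integral_mul_eq_mul_integral (hi l i).1 (hi l k).1
    rw [hint, hint] at this
    rw [show (p : ℝ) ^ 2 * u l ^ 2 = p * u l * (p * u l) by ring, ← this]
    rfl
  simp_rw [e2]
  rw [← Finset.mul_sum, EuclideanSpace.real_norm_sq_eq]

theorem integral_norm_batchMap_sq_pi (p : unitInterval) (hB : 0 < B) (u : Vec d) :
    ∫ b, ‖batchMap b u‖ ^ 2 ∂(Measure.pi fun _ : Fin B => sampleLaw d p) =
      ((d + 2) * (p / B) + (p : ℝ) ^ 2 * (B - 1) / B) * ‖u‖ ^ 2 := by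
  have e : ∀ b : Fin B → Sample d, ‖batchMap b u‖ ^ 2 =
      ((B : ℝ)⁻¹) ^ 2 * ∑ i, ∑ k, ⟪sampleGrad u (b i), sampleGrad u (b k)⟫ := fun b => by
    have : batchMap b u = (B : ℝ)⁻¹ • ∑ i, sampleGrad u (b i) := rfl
    rw [this, norm_smul, mul_pow, ← real_inner_self_eq_norm_sq (∑ i, sampleGrad u (b i)), sum_inner]
    simp [inner_sum]
  have hint : ∀ i k : Fin B, Integrable
      (fun b : Fin B → Sample d => ⟪sampleGrad u (b i), sampleGrad u (b k)⟫)
      (Measure.pi fun _ : Fin B => sampleLaw d p) := fun i k => by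
    have := L2.integrable_inner (𝕜 := ℝ) (memLp_sampleGrad_eval p u i).toLp
      (memLp_sampleGrad_eval p u k).toLp
    refine this.congr ?_
    filter_upwards [(memLp_sampleGrad_eval p u i).coeFn_toLp,
      (memLp_sampleGrad_eval p u k).coeFn_toLp] with b h1 h2
    rw [h1, h2]
  have hval : ∀ i k : Fin B, ∫ b, ⟪sampleGrad u (b i), sampleGrad u (b k)⟫
      ∂(Measure.pi fun _ : Fin B => sampleLaw d p) =
        (if i = k then (p : ℝ) * ((d + 2) * ‖u‖ ^ 2) - (p : ℝ) ^ 2 * ‖u‖ ^ 2 else 0) +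
          (p : ℝ) ^ 2 * ‖u‖ ^ 2 := fun i k => by
    split_ifs with h
    · subst h
      have : ∀ a : Sample d, ⟪sampleGrad u a, sampleGrad u a⟫ =
          ⟪gatedInput a, u⟫ ^ 2 * ‖gatedInput a‖ ^ 2 := fun a => by
        rw [real_inner_self_eq_norm_sq, sampleGrad, norm_smul, mul_pow, Real.norm_eq_abs, sq_abs]
      simp_rw [this]
      rw [integral_eval_pi (f := fun a => ⟪gatedInput a, u⟫ ^ 2 * ‖gatedInput a‖ ^ 2)
        (by fun_prop), integral_gated_inner_sq_mul_norm_sq]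
      ring
    · rw [integral_inner_sampleGrad_of_ne p u h]; ring
  simp_rw [e]
  rw [integral_const_mul,
    integral_finsetSum _ fun i _ => integrable_finsetSum _ fun k _ => hint i k]
  simp_rw [integral_finsetSum _ fun k _ => hint _ k, hval]
  simp [Finset.sum_add_distrib]
  field_simp
  ring

end Batch

/-! ### Active minibatches -/

section ActiveBatch

open scoped RealInnerProductSpace

variable {d : ℕ}

theorem pBatch_eq (P : Params) : (P.pBatch : ℝ) = 1 - (1 - (P.p : ℝ)) ^ P.B := by
  simp [Params.pBatch]

theorem pBatch_pos {P : Params} (hp : 0 < (P.p : ℝ)) (hB : 0 < P.B) : 0 < (P.pBatch : ℝ) := by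
  rw [pBatch_eq]
  have : (1 - (P.p : ℝ)) ^ P.B < 1 :=
    pow_lt_one₀ (by linarith [P.p.2.2]) (by linarith) hB.ne'
  linarith

theorem measurableSet_activeBatches (d B : ℕ) : MeasurableSet (activeBatches d B) := by
  have : activeBatches d B = ⋃ i : Fin B, (fun b : Fin B → Sample d => (b i).1) ⁻¹' {true} := by
    ext b; simp [activeBatches]
  rw [this]
  exact MeasurableSet.iUnion fun i => (by fun_prop : Measurable fun b : Fin B → Sample d => (b i).1)
    (MeasurableSet.singleton true)

theorem real_activeBatches (d : ℕ) (P : Params) :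
    (Measure.pi fun _ : Fin P.B => sampleLaw d P.p).real (activeBatches d P.B) = P.pBatch := by
  have hc : (activeBatches d P.B)ᶜ =
      Set.pi univ fun _ : Fin P.B => ({false} : Set Bool) ×ˢ (univ : Set (Vec d)) := by
    ext b
    simp [activeBatches]
  have h1 : sampleLaw d P.p (({false} : Set Bool) ×ˢ (univ : Set (Vec d))) =
      ENNReal.ofReal (1 - P.p) := by
    rw [sampleLaw, Measure.prod_prod, measure_univ, mul_one,
      bernoulliMeasure_apply_of_notMem_of_mem _ (MeasurableSet.singleton _) (by simp) (by simp)]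
    rw [ENNReal.ofReal]
    congr 1
    ext
    have := P.p.2.2
    simp [Real.coe_toNNReal _ (show (0 : ℝ) ≤ 1 - P.p by linarith)]
  have h2 : (Measure.pi fun _ : Fin P.B => sampleLaw d P.p).real (activeBatches d P.B)ᶜ =
      (1 - (P.p : ℝ)) ^ P.B := by
    rw [hc, measureReal_def, Measure.pi_pi]
    simp only [h1, Finset.prod_const, Finset.card_univ, Fintype.card_fin, ENNReal.toReal_pow]
    rw [ENNReal.toReal_ofReal (by linarith [P.p.2.2])]
  rw [probReal_compl_eq_one_sub (measurableSet_activeBatches d P.B)] at h2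
  rw [pBatch_eq]
  linarith

theorem measure_activeBatches_ne_zero {P : Params} (hp : 0 < (P.p : ℝ)) (hB : 0 < P.B) :
    (Measure.pi fun _ : Fin P.B => sampleLaw d P.p) (activeBatches d P.B) ≠ 0 := fun h => by
  have := real_activeBatches d P
  rw [measureReal_def, h] at this
  exact (pBatch_pos hp hB).ne (by simpa using this)

theorem isProbabilityMeasure_activeBatchLaw {P : Params} (hp : 0 < (P.p : ℝ)) (hB : 0 < P.B) :
    IsProbabilityMeasure (activeBatchLaw d P) :=
  cond_isProbabilityMeasure (measure_activeBatches_ne_zero hp hB)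

theorem integral_activeBatchLaw {P : Params} {f : (Fin P.B → Sample d) → ℝ}
    (hf : ∀ b ∉ activeBatches d P.B, f b = 0) :
    ∫ b, f b ∂activeBatchLaw d P =
      (P.pBatch : ℝ)⁻¹ * ∫ b, f b ∂(Measure.pi fun _ : Fin P.B => sampleLaw d P.p) := by
  rw [activeBatchLaw, ProbabilityTheory.cond, integral_smul_measure,
    setIntegral_eq_integral_of_forall_compl_eq_zero hf, ENNReal.toReal_inv, ← measureReal_def,
    real_activeBatches, smul_eq_mul]

theorem memLp_batchTrace {P : Params} (hp : 0 < (P.p : ℝ)) (hB : 0 < P.B) :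
    MemLp (batchTrace (d := d)) 2 (activeBatchLaw d P) :=
  ((memLp_batchTrace_pi P.p).restrict _).smul_measure
    (ENNReal.inv_ne_top.2 (measure_activeBatches_ne_zero hp hB))

theorem integral_inner_batchMap (P : Params) (hB : 0 < P.B) (u v : Vec d) :
    ∫ b, ⟪v, batchMap b u⟫ ∂activeBatchLaw d P = P.signal * ⟪v, u⟫ := by
  rw [integral_activeBatchLaw fun b hb => by simp [batchMap_eq_zero_of_notMem hb],
    integral_inner_batchMap_pi _ hB, Params.signal]
  ring

theorem integral_norm_batchMap_sq (P : Params) (hB : 0 < P.B) (u : Vec d) :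
    ∫ b, ‖batchMap b u‖ ^ 2 ∂activeBatchLaw d P = P.noise d * ‖u‖ ^ 2 := by
  rw [integral_activeBatchLaw fun b hb => by simp [batchMap_eq_zero_of_notMem hb],
    integral_norm_batchMap_sq_pi _ hB, Params.noise]
  simp only [div_eq_mul_inv, mul_inv]
  ring

variable {Ω : Type*} [MeasurableSpace Ω] {μ : Measure Ω}

theorem integrable_inner_of_memLp {f g : Ω → Vec d} (hf : MemLp f 2 μ) (hg : MemLp g 2 μ) :
    Integrable (fun x => ⟪f x, g x⟫) μ := by
  refine (L2.integrable_inner (𝕜 := ℝ) hf.toLp hg.toLp).congr ?_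
  filter_upwards [hf.coeFn_toLp, hg.coeFn_toLp] with b h1 h2
  rw [h1, h2]

/-- Bilinear expansion of the expected inner product of two linear combinations. -/
theorem integral_inner_combination {f g f' g' : Ω → Vec d} (hf : MemLp f 2 μ) (hg : MemLp g 2 μ)
    (hf' : MemLp f' 2 μ) (hg' : MemLp g' 2 μ) (a b a' b' : ℝ) :
    ∫ x, ⟪a • f x + b • g x, a' • f' x + b' • g' x⟫ ∂μ =
      a * a' * ∫ x, ⟪f x, f' x⟫ ∂μ + a * b' * ∫ x, ⟪f x, g' x⟫ ∂μ +
        (b * a' * ∫ x, ⟪g x, f' x⟫ ∂μ + b * b' * ∫ x, ⟪g x, g' x⟫ ∂μ) := by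
  have e : ∀ x, ⟪a • f x + b • g x, a' • f' x + b' • g' x⟫ =
      (a * a' * ⟪f x, f' x⟫ + a * b' * ⟪f x, g' x⟫) +
        (b * a' * ⟪g x, f' x⟫ + b * b' * ⟪g x, g' x⟫) := fun x => by
    simp only [inner_add_left, inner_add_right, inner_smul_left, inner_smul_right]
    simp; ring
  have i1 := (integrable_inner_of_memLp hf hf').const_mul (a * a')
  have i2 := (integrable_inner_of_memLp hf hg').const_mul (a * b')
  have i3 := (integrable_inner_of_memLp hg hf').const_mul (b * a')
  have i4 := (integrable_inner_of_memLp hg hg').const_mul (b * b')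
  simp_rw [e]
  rw [integral_add (i1.fun_add i2) (i3.fun_add i4), integral_add i1 i2, integral_add i3 i4]
  simp_rw [integral_const_mul]

theorem memLp_batchMap_prod {P : Params} (hp : 0 < (P.p : ℝ)) (hB : 0 < P.B) {u : Ω → Vec d}
    [SFinite μ] (hu : MemLp u 2 μ) :
    MemLp (fun y : Ω × (Fin P.B → Sample d) => batchMap y.2 (u y.1)) 2
      (μ.prod (activeBatchLaw d P)) := by
  have := isProbabilityMeasure_activeBatchLaw (d := d) hp hB
  have hm : AEStronglyMeasurable (fun y : Ω × (Fin P.B → Sample d) => batchMap y.2 (u y.1))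
      (μ.prod (activeBatchLaw d P)) :=
    (measurable_batchMap.comp_aemeasurable
      (measurable_snd.aemeasurable.prodMk hu.1.comp_fst.aemeasurable)).aestronglyMeasurable
  rw [memLp_two_iff_integrable_sq_norm hm]
  have h1 := hu.integrable_norm_pow (p := 2) (by norm_num)
  have h2 := (memLp_batchTrace (d := d) hp hB).integrable_sq
  refine (h1.mul_prod h2).mono' (hm.norm.pow 2) (.of_forall fun y => ?_)
  rw [norm_pow, norm_norm, mul_comm, ← mul_pow]
  exact pow_le_pow_left₀ (norm_nonneg _) (norm_batchMap_le _ _) 2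

variable [IsProbabilityMeasure μ]

theorem integral_inner_batchMap_prod {P : Params} (hp : 0 < (P.p : ℝ)) (hB : 0 < P.B)
    {u a : Ω → Vec d} (hu : MemLp u 2 μ) (ha : MemLp a 2 μ) :
    ∫ y, ⟪a y.1, batchMap y.2 (u y.1)⟫ ∂μ.prod (activeBatchLaw d P) =
      P.signal * ∫ x, ⟪a x, u x⟫ ∂μ := by
  have := isProbabilityMeasure_activeBatchLaw (d := d) hp hB
  rw [integral_prod _ (integrable_inner_of_memLp (ha.comp_fst _) (memLp_batchMap_prod hp hB hu))]
  simp_rw [integral_inner_batchMap P hB, integral_const_mul]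

theorem integral_norm_batchMap_sq_prod {P : Params} (hp : 0 < (P.p : ℝ)) (hB : 0 < P.B)
    {u : Ω → Vec d} (hu : MemLp u 2 μ) :
    ∫ y, ⟪batchMap y.2 (u y.1), batchMap y.2 (u y.1)⟫ ∂μ.prod (activeBatchLaw d P) =
      P.noise d * ∫ x, ⟪u x, u x⟫ ∂μ := by
  have := isProbabilityMeasure_activeBatchLaw (d := d) hp hB
  have h := memLp_batchMap_prod hp hB hu
  rw [integral_prod _ (integrable_inner_of_memLp h h)]
  simp_rw [real_inner_self_eq_norm_sq, integral_norm_batchMap_sq P hB, integral_const_mul]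

theorem integral_inner_fst {Ω' : Type*} [MeasurableSpace Ω'] (ν : Measure Ω')
    [IsProbabilityMeasure ν] (f g : Ω → Vec d) :
    ∫ y, ⟪f y.1, g y.1⟫ ∂μ.prod ν = ∫ x, ⟪f x, g x⟫ ∂μ := by
  rw [integral_fun_fst (fun x => ⟪f x, g x⟫)]; simp

end ActiveBatch

/-! ### The recursion for the second moments -/

section Recursion

open scoped RealInnerProductSpace

variable {d : ℕ}

/-- `𝔼[x^j]` for the number `j` of empty minibatches before an active one. -/
noncomputable def Params.idle (P : Params) (x : ℝ) : ℝ := P.pBatch / (1 - (1 - P.pBatch) * x)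

theorem integral_pow_geometricMeasure {P : Params} (hP : 0 < (P.pBatch : ℝ)) {x : ℝ} (hx0 : 0 ≤ x)
    (hx1 : x ≤ 1) :
    ∫ j, x ^ j ∂geometricMeasure P.pBatch = P.idle x := by
  have hne : P.pBatch ≠ 0 := fun h => by simp [h] at hP
  have hQ : 0 ≤ 1 - (P.pBatch : ℝ) := by linarith [P.pBatch.2.2]
  rw [integral_geometricMeasure hne]
  have e : ∀ n : ℕ, ((1 - (P.pBatch : ℝ)) ^ n * P.pBatch) • x ^ n =
      P.pBatch * ((1 - P.pBatch) * x) ^ n := fun n => by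
    rw [smul_eq_mul, mul_pow]; ring
  simp_rw [e]
  rw [tsum_mul_left, tsum_geometric_of_lt_one (by positivity) (by nlinarith), Params.idle,
    div_eq_mul_inv]

/-- The total displacement `η (β + β² + ⋯) = η β / ε` of the iterate per unit of momentum when no
further gradient arrives. -/
noncomputable def Params.drift (P : Params) : ℝ := P.η * (1 - P.ε) / P.ε

/-- The error after all stored momentum has been spent, `θ - θ⋆ - (η β / ε) m`. It does not change
in steps with zero gradient. -/
noncomputable def spentError (P : Params) (θstar : Vec d) (z : State d) : Vec d :=
  z.1 - θstar - P.drift • z.2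

theorem iterate_momentumStep_zero {P : Params} (hε : P.ε ≠ 0) (z : State d) (j : ℕ) :
    (momentumStep P 0)^[j] z =
      (z.1 - (P.drift * (1 - (1 - P.ε) ^ j)) • z.2, (1 - P.ε) ^ j • z.2) := by
  induction j with
  | zero => simp
  | succ j ih =>
    rw [Function.iterate_succ_apply', ih]
    have h : P.drift * (1 - (1 - P.ε) ^ j) + P.η * (1 - P.ε) * (1 - P.ε) ^ j =
        P.drift * (1 - (1 - P.ε) ^ (j + 1)) := by
      unfold Params.drift; field_simp; ring
    ext1
    · simp only [momentumStep, smul_zero, add_zero]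
      rw [← h, add_smul, smul_smul, smul_smul, sub_sub, mul_assoc P.η]
    · simp only [momentumStep, smul_zero, add_zero, smul_smul, pow_succ']

theorem activeStep_snd {P : Params} (hε : P.ε ≠ 0) (θstar : Vec d) (z : State d) (j : ℕ)
    (b : Fin P.B → Sample d) :
    (activeStep P θstar z j b).2 = (1 - P.ε) • ((1 - P.ε) ^ j • z.2) +
      P.ε • batchMap b (spentError P θstar z + P.drift • ((1 - P.ε) ^ j • z.2)) := by
  have h : ((momentumStep P 0)^[j] z).1 - θstar =
      spentError P θstar z + P.drift • ((1 - P.ε) ^ j • z.2) := by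
    rw [iterate_momentumStep_zero hε, spentError]
    module
  rw [activeStep, momentumStep, batchGrad_eq_batchMap, h, iterate_momentumStep_zero hε]

/-- The spent error moves by a plain gradient step `φ ↦ φ - η g` in every active update. -/
theorem spentError_activeStep {P : Params} (hε : P.ε ≠ 0) (θstar : Vec d) (z : State d) (j : ℕ)
    (b : Fin P.B → Sample d) :
    spentError P θstar (activeStep P θstar z j b) = spentError P θstar z -
      P.η • batchMap b (spentError P θstar z + P.drift • ((1 - P.ε) ^ j • z.2)) := by
  have h : ((momentumStep P 0)^[j] z).1 - θstar =
      spentError P θstar z + P.drift • ((1 - P.ε) ^ j • z.2) := by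
    rw [iterate_momentumStep_zero hε, spentError]
    module
  have h1 : (activeStep P θstar z j b).1 - θstar =
      (spentError P θstar z + P.drift • ((1 - P.ε) ^ j • z.2)) -
        P.η • (activeStep P θstar z j b).2 := by
    rw [← h]
    simp only [activeStep, momentumStep]
    abel
  have h2 : P.η * (1 - P.ε) = P.drift * P.ε := by unfold Params.drift; field_simp
  rw [spentError, h1, activeStep_snd hε]
  set g := batchMap b (spentError P θstar z + P.drift • ((1 - P.ε) ^ j • z.2))
  set q := (1 - P.ε) ^ j • z.2
  have h3 : P.drift = P.η * (1 - P.ε) + P.drift * (1 - P.ε) := by rw [h2]; ring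
  have e1 : spentError P θstar z + P.drift • q - P.η • ((1 - P.ε) • q + P.ε • g) -
      P.drift • ((1 - P.ε) • q + P.ε • g) = spentError P θstar z +
        (P.drift - (P.η * (1 - P.ε) + P.drift * (1 - P.ε))) • q -
        (P.η * P.ε + P.drift * P.ε) • g := by module
  rw [e1, ← h3, ← h2, sub_self, zero_smul, add_zero]
  congr 2
  ring

theorem measurable_spentError (P : Params) (θstar : Vec d) : Measurable (spentError P θstar) := by
  unfold spentError; fun_prop

/-- Measurability of a map into the state space can be tested in the coordinates `(φ, m)`. -/
theorem measurable_of_spentError {Ω : Type*} [MeasurableSpace Ω] {P : Params} {θstar : Vec d}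
    {f : Ω → State d} (hs : Measurable fun y => spentError P θstar (f y))
    (h2 : Measurable fun y => (f y).2) : Measurable f := by
  have h1 : (fun y => (f y).1) =
      fun y => spentError P θstar (f y) + θstar + P.drift • (f y).2 := by
    funext y
    rw [spentError]; abel
  have h1' : Measurable fun y => (f y).1 := by
    rw [h1]
    exact (hs.add_const θstar).add (h2.const_smul P.drift :
      Measurable fun y => P.drift • (f y).2)
  exact h1'.prodMk h2

theorem measurable_const_pow_snd {α : Type*} [MeasurableSpace α] (x : ℝ) :
    Measurable fun y : α × ℕ => x ^ y.2 :=
  (Measurable.of_discrete (f := fun j : ℕ => x ^ j)).comp measurable_snd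

theorem measurable_batchMap_fst {α : Type*} [MeasurableSpace α] {B : ℕ} {f : α → Vec d}
    (hf : Measurable f) : Measurable fun y : α × (Fin B → Sample d) => batchMap y.2 (f y.1) := by
  unfold batchMap
  fun_prop

theorem measurable_drifted (P : Params) (θstar : Vec d) : Measurable fun x : State d × ℕ =>
    spentError P θstar x.1 + P.drift • ((1 - P.ε) ^ x.2 • x.1.2) := by
  have h1 : Measurable fun x : State d × ℕ => spentError P θstar x.1 :=
    (measurable_spentError P θstar).comp measurable_fst
  have h2 : Measurable fun x : State d × ℕ => (1 - P.ε) ^ x.2 := measurable_const_pow_snd _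
  have h3 : Measurable fun x : State d × ℕ => x.1.2 := by fun_prop
  fun_prop

theorem measurable_batchMap_drifted {B : ℕ} (P : Params) (θstar : Vec d) :
    Measurable fun y : (State d × ℕ) × (Fin B → Sample d) => batchMap y.2
      (spentError P θstar y.1.1 + P.drift • ((1 - P.ε) ^ y.1.2 • y.1.1.2)) := by
  have := measurable_batchMap_fst (B := B) (measurable_drifted P θstar)
  exact this

theorem measurable_activeStep {P : Params} (hε : P.ε ≠ 0) (θstar : Vec d) :
    Measurable fun y : (State d × ℕ) × (Fin P.B → Sample d) =>
      activeStep P θstar y.1.1 y.1.2 y.2 := by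
  have hg := measurable_batchMap_drifted (B := P.B) P θstar
  refine measurable_of_spentError (P := P) (θstar := θstar) ?_ ?_
  · simp_rw [spentError_activeStep hε]
    have h1 : Measurable fun x : (State d × ℕ) × (Fin P.B → Sample d) => spentError P θstar x.1.1 :=
      (measurable_spentError P θstar).comp (measurable_fst.comp measurable_fst)
    exact h1.sub (hg.const_smul P.η :)
  · simp_rw [activeStep_snd hε]
    have h2 : Measurable fun x : (State d × ℕ) × (Fin P.B → Sample d) => (1 - P.ε) ^ x.1.2 :=
      (measurable_const_pow_snd (α := State d) _).comp measurable_fst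
    have h3 : Measurable fun x : (State d × ℕ) × (Fin P.B → Sample d) => x.1.1.2 := by fun_prop
    fun_prop

/-- The second moments `𝔼‖φ‖²`, `𝔼⟨φ, m⟩`, `𝔼‖m‖²` of the spent error `φ` and the momentum `m`. -/
noncomputable def moments (P : Params) (θstar : Vec d) (μ : Measure (State d)) : Fin 3 → ℝ :=
  ![∫ z, ⟪spentError P θstar z, spentError P θstar z⟫ ∂μ, ∫ z, ⟪spentError P θstar z, z.2⟫ ∂μ,
    ∫ z, ⟪z.2, z.2⟫ ∂μ]

/-- The matrix by which one active update multiplies `moments`. -/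
noncomputable def stepMatrix (P : Params) (d : ℕ) : Matrix (Fin 3) (Fin 3) ℝ :=
  let β := 1 - P.ε
  let c := P.drift
  let E₁ := P.idle β
  let E₂ := P.idle (β ^ 2)
  let b₁ := P.signal
  let b₂ := P.noise d
  !![1 - 2 * P.η * b₁ + P.η ^ 2 * b₂, 2 * c * E₁ * (P.η ^ 2 * b₂ - P.η * b₁),
      P.η ^ 2 * b₂ * c ^ 2 * E₂;
    P.ε * b₁ - P.η * P.ε * b₂, β * E₁ - 2 * P.η * P.ε * b₂ * c * E₁,
      -(P.η * β * b₁ * c * E₂) - P.η * P.ε * b₂ * c ^ 2 * E₂;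
    P.ε ^ 2 * b₂, 2 * β * P.ε * b₁ * E₁ + 2 * P.ε ^ 2 * b₂ * c * E₁,
      β ^ 2 * E₂ + 2 * β * P.ε * b₁ * c * E₂ + P.ε ^ 2 * b₂ * c ^ 2 * E₂]

/-- The law of the state one active update later. -/
noncomputable def nextLaw (P : Params) (θstar : Vec d) (μ : Measure (State d)) :
    Measure (State d) :=
  (μ.prod ((geometricMeasure P.pBatch).prod (activeBatchLaw d P))).map
    fun w => activeStep P θstar w.1 w.2.1 w.2.2

theorem map_prod_assoc {α β γ δ : Type*} [MeasurableSpace α] [MeasurableSpace β]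
    [MeasurableSpace γ] [MeasurableSpace δ] (μ : Measure α) (ν : Measure β) (τ : Measure γ)
    [SFinite μ] [SFinite ν] [SFinite τ] {f : α → β → γ → δ}
    (hf : Measurable fun y : (α × β) × γ => f y.1.1 y.1.2 y.2) :
    (μ.prod (ν.prod τ)).map (fun w => f w.1 w.2.1 w.2.2) =
      ((μ.prod ν).prod τ).map fun y => f y.1.1 y.1.2 y.2 := by
  have hm : Measurable fun w : α × β × γ => f w.1 w.2.1 w.2.2 :=
    hf.comp MeasurableEquiv.prodAssoc.symm.measurable
  rw [← Measure.prodAssoc_prod, Measure.map_map hm MeasurableEquiv.prodAssoc.measurable]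
  rfl

theorem nextLaw_eq {P : Params} (hp : 0 < (P.p : ℝ)) (hB : 0 < P.B) (hε : P.ε ≠ 0) (θstar : Vec d)
    (μ : Measure (State d)) [IsProbabilityMeasure μ] :
    nextLaw P θstar μ = ((μ.prod (geometricMeasure P.pBatch)).prod (activeBatchLaw d P)).map
      fun y => activeStep P θstar y.1.1 y.1.2 y.2 := by
  have := isProbabilityMeasure_activeBatchLaw (d := d) hp hB
  exact map_prod_assoc _ _ _ (measurable_activeStep hε θstar)

variable {P : Params} {θstar : Vec d} {μ : Measure (State d)} [IsProbabilityMeasure μ]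

theorem isProbabilityMeasure_nextLaw (hp : 0 < (P.p : ℝ)) (hB : 0 < P.B) (hε : P.ε ≠ 0) :
    IsProbabilityMeasure (nextLaw P θstar μ) := by
  have := isProbabilityMeasure_activeBatchLaw (d := d) hp hB
  rw [nextLaw_eq hp hB hε]
  exact Measure.isProbabilityMeasure_map (measurable_activeStep hε θstar).aemeasurable

theorem memLp_spentError (hθ : MemLp (fun z : State d => z.1) 2 μ)
    (hm : MemLp (fun z : State d => z.2) 2 μ) : MemLp (spentError P θstar) 2 μ :=
  (hθ.sub (memLp_const θstar)).sub (hm.const_smul P.drift)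

/-- The recursion. With `q = β^j m` the momentum after `j` empty minibatches and `g` the gradient at
the error `φ + c q`, `c` the drift, one active update is `φ ↦ φ - η g`, `m ↦ β q + ε g`. The idle
time `j` enters the second moments only through `𝔼 β^j` and `𝔼 β^(2j)`, and the minibatch only
through `𝔼 g = 𝓑₁ (φ + c q)` and `𝔼‖g‖² = 𝓑₂ ‖φ + c q‖²`, so they close linearly. -/
theorem nextLaw_moments (hp : 0 < (P.p : ℝ)) (hB : 0 < P.B) (hε : 0 < P.ε) (hε1 : P.ε ≤ 1)
    (hφ : MemLp (spentError P θstar) 2 μ) (hm : MemLp (fun z : State d => z.2) 2 μ) :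
    MemLp (spentError P θstar) 2 (nextLaw P θstar μ) ∧
      MemLp (fun z : State d => z.2) 2 (nextLaw P θstar μ) ∧
      moments P θstar (nextLaw P θstar μ) = (stepMatrix P d).mulVec (moments P θstar μ) := by
  have := isProbabilityMeasure_activeBatchLaw (d := d) hp hB
  have hstep := measurable_activeStep hε.ne' θstar (d := d)
  have hβ0 : 0 ≤ 1 - P.ε := by linarith
  have hβ1 : 1 - P.ε ≤ 1 := by linarith
  have hPb := pBatch_pos hp hB
  set geo := geometricMeasure P.pBatch with hgeo
  -- the spent error and the momentum after the empty minibatches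
  let φ : State d × ℕ → Vec d := fun x => spentError P θstar x.1
  let q : State d × ℕ → Vec d := fun x => (1 - P.ε) ^ x.2 • x.1.2
  have hφ' : MemLp φ 2 (μ.prod geo) := hφ.comp_fst geo
  have hpow : AEStronglyMeasurable (fun x : State d × ℕ => (1 - P.ε) ^ x.2) (μ.prod geo) :=
    ((measurable_from_top (f := fun j : ℕ => (1 - P.ε) ^ j)).comp
      measurable_snd).aestronglyMeasurable
  have hq : MemLp q 2 (μ.prod geo) := by
    refine (hm.comp_fst geo).mono (hpow.smul (hm.comp_fst geo).1) (.of_forall fun x => ?_)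
    rw [norm_smul, norm_pow, Real.norm_of_nonneg hβ0]
    exact mul_le_of_le_one_left (norm_nonneg _) (pow_le_one₀ hβ0 hβ1)
  have hφφ : ∫ x, ⟪φ x, φ x⟫ ∂μ.prod geo = moments P θstar μ 0 :=
    integral_inner_fst geo (spentError P θstar) (spentError P θstar)
  have hφq : ∫ x, ⟪φ x, q x⟫ ∂μ.prod geo = P.idle (1 - P.ε) * moments P θstar μ 1 := by
    simp only [φ, q, inner_smul_right]
    have := integral_prod_mul (μ := μ) (ν := geo) (fun z => ⟪spentError P θstar z, z.2⟫)
      (fun j : ℕ => (1 - P.ε) ^ j)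
    rw [integral_pow_geometricMeasure hPb hβ0 hβ1] at this
    simpa [moments, mul_comm] using this
  have hqq : ∫ x, ⟪q x, q x⟫ ∂μ.prod geo = P.idle ((1 - P.ε) ^ 2) * moments P θstar μ 2 := by
    have := integral_prod_mul (μ := μ) (ν := geo) (fun z => ⟪z.2, z.2⟫)
      (fun j : ℕ => ((1 - P.ε) ^ 2) ^ j)
    rw [integral_pow_geometricMeasure hPb (by positivity) (pow_le_one₀ hβ0 hβ1)] at this
    rw [mul_comm, moments]
    refine Eq.trans (integral_congr_ae (.of_forall fun x => ?_)) this
    simp only [q, inner_smul_right, inner_smul_left, RCLike.conj_to_real]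
    generalize 1 - P.ε = β
    ring
  let u : State d × ℕ → Vec d := fun x => (1 : ℝ) • φ x + P.drift • q x
  have hu : MemLp u 2 (μ.prod geo) := (hφ'.const_smul (1 : ℝ)).add (hq.const_smul P.drift)
  have hqφ : ∫ x, ⟪q x, φ x⟫ ∂μ.prod geo = P.idle (1 - P.ε) * moments P θstar μ 1 := by
    rw [← hφq]; simp_rw [real_inner_comm]
  have huu := integral_inner_combination hφ' hq hφ' hq 1 P.drift 1 P.drift
  rw [hφφ, hφq, hqφ, hqq] at huu
  have hφu : ∫ x, ⟪φ x, u x⟫ ∂μ.prod geo = moments P θstar μ 0 +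
      P.drift * (P.idle (1 - P.ε) * moments P θstar μ 1) := by
    have h := integral_inner_combination hφ' hφ' hφ' hq 1 0 1 P.drift
    rw [hφφ, hφq] at h
    simp only [one_smul, zero_smul, add_zero] at h
    simp only [u, one_smul]
    rw [h]; ring
  have hqu : ∫ x, ⟪q x, u x⟫ ∂μ.prod geo = P.idle (1 - P.ε) * moments P θstar μ 1 +
      P.drift * (P.idle ((1 - P.ε) ^ 2) * moments P θstar μ 2) := by
    have h := integral_inner_combination hq hq hφ' hq 1 0 1 P.drift
    rw [hqφ, hqq] at h
    simp only [one_smul, zero_smul, add_zero] at h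
    simp only [u, one_smul]
    rw [h]; ring
  -- the gradient of the active minibatch, taken at the error `u`
  set act := activeBatchLaw d P with hact
  let g : (State d × ℕ) × (Fin P.B → Sample d) → Vec d := fun y => batchMap y.2 (u y.1)
  have hg : MemLp g 2 ((μ.prod geo).prod act) := memLp_batchMap_prod hp hB hu
  have hgg : ∫ y, ⟪g y, g y⟫ ∂(μ.prod geo).prod act = P.noise d * ∫ x, ⟪u x, u x⟫ ∂μ.prod geo :=
    integral_norm_batchMap_sq_prod hp hB hu
  have hφg : ∫ y, ⟪φ y.1, g y⟫ ∂(μ.prod geo).prod act =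
      P.signal * ∫ x, ⟪φ x, u x⟫ ∂μ.prod geo := integral_inner_batchMap_prod hp hB hu hφ'
  have hqg : ∫ y, ⟪q y.1, g y⟫ ∂(μ.prod geo).prod act =
      P.signal * ∫ x, ⟪q x, u x⟫ ∂μ.prod geo := integral_inner_batchMap_prod hp hB hu hq
  have hgφ : ∫ y, ⟪g y, φ y.1⟫ ∂(μ.prod geo).prod act =
      P.signal * ∫ x, ⟪φ x, u x⟫ ∂μ.prod geo := by
    rw [← hφg]; simp_rw [real_inner_comm]
  have hgq : ∫ y, ⟪g y, q y.1⟫ ∂(μ.prod geo).prod act =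
      P.signal * ∫ x, ⟪q x, u x⟫ ∂μ.prod geo := by
    rw [← hqg]; simp_rw [real_inner_comm]
  have hφ'' : MemLp (fun y : (State d × ℕ) × (Fin P.B → Sample d) => φ y.1) 2
      ((μ.prod geo).prod act) := hφ'.comp_fst act
  have hq'' : MemLp (fun y : (State d × ℕ) × (Fin P.B → Sample d) => q y.1) 2
      ((μ.prod geo).prod act) := hq.comp_fst act
  have eφ : ∀ y : (State d × ℕ) × (Fin P.B → Sample d),
      spentError P θstar (activeStep P θstar y.1.1 y.1.2 y.2) =
        (1 : ℝ) • φ y.1 + (-P.η) • g y := fun y => by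
    rw [spentError_activeStep hε.ne', neg_smul, one_smul, ← sub_eq_add_neg]
    simp only [g, u, one_smul, φ, q]
  have em : ∀ y : (State d × ℕ) × (Fin P.B → Sample d),
      (activeStep P θstar y.1.1 y.1.2 y.2).2 = (1 - P.ε) • q y.1 + P.ε • g y := fun y => by
    rw [activeStep_snd hε.ne']
    simp only [g, u, one_smul, φ, q]
  have hφφ' : ∫ y, ⟪φ y.1, φ y.1⟫ ∂(μ.prod geo).prod act = moments P θstar μ 0 := by
    rw [integral_inner_fst act φ φ, hφφ]
  have hφq' : ∫ y, ⟪φ y.1, q y.1⟫ ∂(μ.prod geo).prod act =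
      P.idle (1 - P.ε) * moments P θstar μ 1 := by
    rw [integral_inner_fst act φ q, hφq]
  have hqq' : ∫ y, ⟪q y.1, q y.1⟫ ∂(μ.prod geo).prod act =
      P.idle ((1 - P.ε) ^ 2) * moments P θstar μ 2 := by
    rw [integral_inner_fst act q q, hqq]
  have I₀ := integral_inner_combination hφ'' hg hφ'' hg 1 (-P.η) 1 (-P.η)
  have I₁ := integral_inner_combination hφ'' hg hq'' hg 1 (-P.η) (1 - P.ε) P.ε
  have I₂ := integral_inner_combination hq'' hg hq'' hg (1 - P.ε) P.ε (1 - P.ε) P.ε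
  rw [hφφ', hφg, hgφ, hgg, huu, hφu] at I₀
  rw [hφq', hφg, hgq, hgg, huu, hφu, hqu] at I₁
  rw [hqq', hqg, hgq, hgg, huu, hqu] at I₂
  have hms := measurable_spentError P θstar (d := d)
  rw [nextLaw_eq hp hB hε.ne']
  refine ⟨(memLp_map_measure_iff hms.aestronglyMeasurable hstep.aemeasurable).2 ?_,
    (memLp_map_measure_iff measurable_snd.aestronglyMeasurable hstep.aemeasurable).2 ?_, ?_⟩
  · exact ((hφ''.const_smul (1 : ℝ)).add (hg.const_smul (-P.η))).ae_eq
      (.of_forall fun y => (eφ y).symm)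
  · exact ((hq''.const_smul (1 - P.ε)).add (hg.const_smul P.ε)).ae_eq
      (.of_forall fun y => (em y).symm)
  · rw [moments, integral_map hstep.aemeasurable (hms.inner hms).aestronglyMeasurable,
      integral_map hstep.aemeasurable (hms.inner measurable_snd).aestronglyMeasurable,
      integral_map hstep.aemeasurable (measurable_snd.inner measurable_snd).aestronglyMeasurable]
    simp_rw [eφ, em]
    rw [I₀, I₁, I₂]
    ext i
    have hc : P.drift * P.ε = P.η * (1 - P.ε) := by unfold Params.drift; field_simp
    fin_cases i <;> simp [stepMatrix, Matrix.mulVec, dotProduct, Fin.sum_univ_three]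
    · ring
    · linear_combination P.idle (1 - P.ε) * moments P θstar μ 1 * P.signal * hc
    · ring

end Recursion

/-! ### The moments of the Poissonized law -/

section Poissonization

open scoped RealInnerProductSpace Matrix

variable {d : ℕ} {P : Params} {θstar : Vec d} {μ : Measure (State d)}

theorem sub_eq_spentError_add (P : Params) (θstar : Vec d) (z : State d) :
    z.1 - θstar = (1 : ℝ) • spentError P θstar z + P.drift • z.2 := by
  rw [spentError, one_smul]; abel

theorem risk_eq_moments (hφ : MemLp (spentError P θstar) 2 μ)
    (hm : MemLp (fun z : State d => z.2) 2 μ) :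
    risk θstar μ = ![1, 2 * P.drift, P.drift ^ 2] ⬝ᵥ moments P θstar μ := by
  have h := integral_inner_combination hφ hm hφ hm 1 P.drift 1 P.drift
  have hs : ∫ z, ⟪z.2, spentError P θstar z⟫ ∂μ = ∫ z, ⟪spentError P θstar z, z.2⟫ ∂μ := by
    simp_rw [real_inner_comm]
  rw [hs] at h
  simp_rw [← sub_eq_spentError_add, real_inner_self_eq_norm_sq (_ - θstar)] at h
  rw [risk, h]
  simp [moments, dotProduct, Fin.sum_univ_three]
  ring

theorem corr_eq_moments (hφ : MemLp (spentError P θstar) 2 μ)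
    (hm : MemLp (fun z : State d => z.2) 2 μ) :
    corr θstar μ = ![0, 1, P.drift] ⬝ᵥ moments P θstar μ := by
  have h := integral_inner_combination hφ hm hm hm 1 P.drift 1 0
  simp_rw [← sub_eq_spentError_add, one_smul, zero_smul, add_zero] at h
  rw [corr, h]
  simp [moments, dotProduct, Fin.sum_univ_three]

theorem energy_eq_moments (P : Params) (θstar : Vec d) (μ : Measure (State d)) :
    energy μ = ![0, 0, 1] ⬝ᵥ moments P θstar μ := by
  simp [energy, moments, dotProduct, Fin.sum_univ_three]

theorem activeLaw_moments (hp : 0 < (P.p : ℝ)) (hB : 0 < P.B) (hε : 0 < P.ε) (hε1 : P.ε ≤ 1)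
    [IsProbabilityMeasure μ] (hφ : MemLp (spentError P θstar) 2 μ)
    (hm : MemLp (fun z : State d => z.2) 2 μ) (n : ℕ) :
    IsProbabilityMeasure (activeLaw P θstar μ n) ∧
      MemLp (spentError P θstar) 2 (activeLaw P θstar μ n) ∧
      MemLp (fun z : State d => z.2) 2 (activeLaw P θstar μ n) ∧
      moments P θstar (activeLaw P θstar μ n) = stepMatrix P d ^ n *ᵥ moments P θstar μ := by
  induction n with
  | zero => exact ⟨‹_›, hφ, hm, by simp [activeLaw]⟩
  | succ n ih =>
    obtain ⟨hprob, h1, h2, h3⟩ := ih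
    have h := nextLaw_moments hp hB hε hε1 h1 h2
    refine ⟨isProbabilityMeasure_nextLaw hp hB hε.ne', h.1, h.2.1, ?_⟩
    rw [pow_succ', ← Matrix.mulVec_mulVec, ← h3]
    exact h.2.2

theorem hasSum_poisson_dotProduct {ι : Type*} [Fintype ι] [DecidableEq ι] (A : Matrix ι ι ℝ)
    (a u : ι → ℝ) (t : ℝ) :
    HasSum (fun n : ℕ => (Real.exp (-t) * t ^ n / n.factorial) * (a ⬝ᵥ (A ^ n *ᵥ u)))
      (a ⬝ᵥ linearFlow (A - 1) u t) := by
  have h := hasSum_poisson_pow A u t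
  have h2 : ∀ i, HasSum (fun n : ℕ => a i * ((Real.exp (-t) * t ^ n / n.factorial) *
      (A ^ n *ᵥ u) i)) (a i * linearFlow (A - 1) u t i) := fun i =>
    (by simpa using Pi.hasSum.1 h i : HasSum _ _).mul_left (a i)
  have h3 := hasSum_sum (s := Finset.univ) fun i _ => h2 i
  have e : (fun n : ℕ => (Real.exp (-t) * t ^ n / n.factorial) * (a ⬝ᵥ (A ^ n *ᵥ u))) =
      fun n : ℕ => ∑ i, a i * ((Real.exp (-t) * t ^ n / n.factorial) * (A ^ n *ᵥ u) i) := by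
    funext n
    rw [dotProduct, Finset.mul_sum]
    exact Finset.sum_congr rfl fun i _ => by ring
  rw [e]
  exact h3

/-- Integration of a quadratic observable `f` against the Poissonized law. The dominating
observable `g` provides integrability. -/
theorem integral_lawAt {A : Matrix (Fin 3) (Fin 3) ℝ} {a a' u : Fin 3 → ℝ} {f g : State d → ℝ}
    (hf : Measurable f) (hfg : ∀ z, |f z| ≤ g z)
    (hgi : ∀ n, Integrable g (activeLaw P θstar μ n))
    (hfn : ∀ n, ∫ z, f z ∂activeLaw P θstar μ n = a ⬝ᵥ (A ^ n *ᵥ u))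
    (hgn : ∀ n, ∫ z, g z ∂activeLaw P θstar μ n = a' ⬝ᵥ (A ^ n *ᵥ u)) {t : ℝ} (ht : 0 ≤ t) :
    ∫ z, f z ∂lawAt P θstar μ t = a ⬝ᵥ linearFlow (A - 1) u t := by
  let κ : Kernel ℕ (State d) := ⟨activeLaw P θstar μ, measurable_of_countable _⟩
  have hκ : lawAt P θstar μ t = (poissonMeasure t.toNNReal).bind κ := rfl
  have hnn : ((t.toNNReal : NNReal) : ℝ) = t := Real.coe_toNNReal t ht
  have hfi : ∀ n, Integrable f (activeLaw P θstar μ n) := fun n =>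
    (hgi n).mono' hf.aestronglyMeasurable (.of_forall hfg)
  have hsum := hasSum_poisson_dotProduct A a' u t
  have hint : Integrable f (lawAt P θstar μ t) := by
    rw [hκ, Measure.integrable_comp_iff hf.aestronglyMeasurable]
    refine ⟨.of_forall fun n => hfi n, integrable_poissonMeasure_iff.2 ?_⟩
    rw [hnn]
    refine hsum.summable.of_nonneg_of_le (fun n => by positivity) fun n => ?_
    refine mul_le_mul_of_nonneg_left ?_ (by positivity)
    rw [Real.norm_of_nonneg (by positivity), ← hgn n]
    exact integral_mono (hfi n).norm (hgi n) hfg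
  have h1 : ∫ z, f z ∂lawAt P θstar μ t =
      ∫ n, ∫ z, f z ∂activeLaw P θstar μ n ∂poissonMeasure t.toNNReal := by
    rw [hκ, Measure.comp_eq_comp_const_apply] at hint ⊢
    rw [Kernel.integral_comp hint]
    simp [κ]
  rw [h1, integral_poissonMeasure]
  simp_rw [hfn, hnn, smul_eq_mul]
  exact (hasSum_poisson_dotProduct A a u t).tsum_eq

/-- The second moments of the Poissonized law are linear functionals of a linear flow. -/
theorem lawAt_moments (hp : 0 < (P.p : ℝ)) (hB : 0 < P.B) (hε : 0 < P.ε) (hε1 : P.ε ≤ 1)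
    [IsProbabilityMeasure μ] (hθ : MemLp (fun z : State d => z.1) 2 μ)
    (hm : MemLp (fun z : State d => z.2) 2 μ) {t : ℝ} (ht : 0 ≤ t) :
    risk θstar (lawAt P θstar μ t) = ![1, 2 * P.drift, P.drift ^ 2] ⬝ᵥ
        linearFlow (stepMatrix P d - 1) (moments P θstar μ) t ∧
      energy (lawAt P θstar μ t) = ![0, 0, 1] ⬝ᵥ
        linearFlow (stepMatrix P d - 1) (moments P θstar μ) t ∧
      corr θstar (lawAt P θstar μ t) = ![0, 1, P.drift] ⬝ᵥ
        linearFlow (stepMatrix P d - 1) (moments P θstar μ) t := by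
  have H := activeLaw_moments (θstar := θstar) hp hB hε hε1 (memLp_spentError hθ hm) hm
  have hR : ∀ n, ∫ z, ‖z.1 - θstar‖ ^ 2 ∂activeLaw P θstar μ n =
      ![1, 2 * P.drift, P.drift ^ 2] ⬝ᵥ (stepMatrix P d ^ n *ᵥ moments P θstar μ) := fun n => by
    rw [← (H n).2.2.2]; exact risk_eq_moments (H n).2.1 (H n).2.2.1
  have hV : ∀ n, ∫ z, ‖z.2‖ ^ 2 ∂activeLaw P θstar μ n =
      ![0, 0, 1] ⬝ᵥ (stepMatrix P d ^ n *ᵥ moments P θstar μ) := fun n => by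
    rw [← (H n).2.2.2]; exact energy_eq_moments _ _ _
  have hC : ∀ n, ∫ z, ⟪z.1 - θstar, z.2⟫ ∂activeLaw P θstar μ n =
      ![0, 1, P.drift] ⬝ᵥ (stepMatrix P d ^ n *ᵥ moments P θstar μ) := fun n => by
    rw [← (H n).2.2.2]; exact corr_eq_moments (H n).2.1 (H n).2.2.1
  have hRi : ∀ n, Integrable (fun z : State d => ‖z.1 - θstar‖ ^ 2) (activeLaw P θstar μ n) :=
    fun n => by
      have h : MemLp (fun z : State d => z.1 - θstar) 2 (activeLaw P θstar μ n) := by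
        simp_rw [sub_eq_spentError_add P θstar]
        exact ((H n).2.1.const_smul (1 : ℝ)).add ((H n).2.2.1.const_smul P.drift)
      exact h.integrable_norm_pow (p := 2) (by norm_num)
  have hVi : ∀ n, Integrable (fun z : State d => ‖z.2‖ ^ 2) (activeLaw P θstar μ n) := fun n =>
    (H n).2.2.1.integrable_norm_pow (p := 2) (by norm_num)
  refine ⟨?_, ?_, ?_⟩
  · exact integral_lawAt (g := fun z => ‖z.1 - θstar‖ ^ 2) (by fun_prop)
      (fun z => (abs_of_nonneg (by positivity)).le) hRi hR hR ht
  · exact integral_lawAt (g := fun z => ‖z.2‖ ^ 2) (by fun_prop)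
      (fun z => (abs_of_nonneg (by positivity)).le) hVi hV hV ht
  · refine integral_lawAt (g := fun z => ‖z.1 - θstar‖ ^ 2 + ‖z.2‖ ^ 2)
      (a' := ![1, 2 * P.drift, P.drift ^ 2] + ![0, 0, 1]) (by fun_prop)
      (fun z => ?_) (fun n => (hRi n).add (hVi n)) hC (fun n => ?_) ht
    · refine (abs_real_inner_le_norm _ _).trans ?_
      nlinarith [sq_nonneg (‖z.1 - θstar‖ - ‖z.2‖), sq_nonneg ‖z.1 - θstar‖, sq_nonneg ‖z.2‖]
    · rw [integral_add (hRi n) (hVi n), hR, hV, add_dotProduct]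

end Poissonization

/-! ### The moment equations -/

section MomentEquations

open scoped Matrix

/-- `1 - 𝔼[β^K]` for `K` geometric on `{1, 2, …}` with parameter `P_batch`: the relaxation rate of
the correlation with the momentum. -/
noncomputable def Params.gap₁ (P : Params) : ℝ := 1 - (1 - P.ε) * P.idle (1 - P.ε)

/-- The equations of motion of the moments `S = 𝔼‖φ‖²`, `Y = 𝔼⟨φ, m⟩`, `V = 𝔼‖m‖²` of the spent
error `φ` and the momentum `m`, in a time unit of `Θ` active updates. -/
structure IsMomentTrajectory (P : Params) (d : ℕ) (Θ : ℝ) (S Y V : ℝ → ℝ) : Prop where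
  hasDerivAt_S : ∀ τ, HasDerivAt S (Θ * (-(2 * (P.η * P.signal)) *
    (S τ + P.drift * P.idle (1 - P.ε) * Y τ) + P.η ^ 2 * P.noise d *
    (S τ + 2 * (P.drift * P.idle (1 - P.ε) * Y τ) +
      P.drift ^ 2 * P.idle ((1 - P.ε) ^ 2) * V τ))) τ
  hasDerivAt_Y : ∀ τ, HasDerivAt Y (Θ * (-P.gap₁ * Y τ + P.ε * P.signal *
    (S τ - P.drift ^ 2 * P.idle ((1 - P.ε) ^ 2) * V τ) - P.η * P.ε * P.noise d *
    (S τ + 2 * (P.drift * P.idle (1 - P.ε) * Y τ) +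
      P.drift ^ 2 * P.idle ((1 - P.ε) ^ 2) * V τ))) τ
  hasDerivAt_V : ∀ τ, HasDerivAt V (Θ * (-P.gap₂ * V τ + 2 * (1 - P.ε) * P.ε * P.signal *
    (P.idle (1 - P.ε) * Y τ + P.drift * P.idle ((1 - P.ε) ^ 2) * V τ) + P.ε ^ 2 * P.noise d *
    (S τ + 2 * (P.drift * P.idle (1 - P.ε) * Y τ) +
      P.drift ^ 2 * P.idle ((1 - P.ε) ^ 2) * V τ))) τ

theorem gap₂_eq_one_sub (P : Params) :
    P.gap₂ = 1 - (1 - P.ε) ^ 2 * P.idle ((1 - P.ε) ^ 2) := by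
  unfold Params.gap₂ Params.idle; ring

theorem drift_mul_ε {P : Params} (hε : P.ε ≠ 0) : P.drift * P.ε = P.η * (1 - P.ε) := by
  unfold Params.drift; field_simp

variable {d : ℕ} {P : Params}

theorem isMomentTrajectory_linearFlow (hε : P.ε ≠ 0) (Θ : ℝ) (u : Fin 3 → ℝ) :
    IsMomentTrajectory P d Θ (fun τ => linearFlow (stepMatrix P d - 1) u (Θ * τ) 0)
      (fun τ => linearFlow (stepMatrix P d - 1) u (Θ * τ) 1)
      (fun τ => linearFlow (stepMatrix P d - 1) u (Θ * τ) 2) := by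
  have h : ∀ (i : Fin 3) (τ : ℝ), HasDerivAt
      (fun τ => linearFlow (stepMatrix P d - 1) u (Θ * τ) i)
      (((stepMatrix P d - 1) *ᵥ linearFlow (stepMatrix P d - 1) u (Θ * τ)) i * Θ) τ :=
    fun i τ => by
    have h1 : HasDerivAt (fun τ : ℝ => Θ * τ) Θ τ := by simpa using (hasDerivAt_id τ).const_mul Θ
    exact (hasDerivAt_pi.1 (hasDerivAt_linearFlow (stepMatrix P d - 1) u (Θ * τ)) i).comp τ h1
  have hc := drift_mul_ε hε
  refine ⟨fun τ => (h 0 τ).congr_deriv ?_, fun τ => (h 1 τ).congr_deriv ?_,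
    fun τ => (h 2 τ).congr_deriv ?_⟩ <;>
  generalize linearFlow (stepMatrix P d - 1) u (Θ * τ) = w
  · simp [stepMatrix, Matrix.mulVec, dotProduct, Fin.sum_univ_three]
    ring
  · simp [stepMatrix, Matrix.mulVec, dotProduct, Fin.sum_univ_three,
      Params.gap₁]
    linear_combination (Θ * P.signal * P.drift * P.idle ((1 - P.ε) ^ 2) * w 2) * hc
  · rw [gap₂_eq_one_sub]
    simp [stepMatrix, Matrix.mulVec, dotProduct, Fin.sum_univ_three]
    ring

variable {θstar : Vec d} {μ : Measure (State d)} [IsProbabilityMeasure μ]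

/-- Risk, energy and correlation of the Poissonized law are determined by a trajectory of the
moment equations. -/
theorem exists_isMomentTrajectory (hp : 0 < (P.p : ℝ)) (hB : 0 < P.B) (hε : 0 < P.ε)
    (hε1 : P.ε ≤ 1) (hθ : MemLp (fun z : State d => z.1) 2 μ)
    (hm : MemLp (fun z : State d => z.2) 2 μ) {Θ : ℝ} (hΘ : 0 ≤ Θ) :
    ∃ S Y V : ℝ → ℝ, IsMomentTrajectory P d Θ S Y V ∧
      S 0 = risk θstar μ - 2 * P.drift * corr θstar μ + P.drift ^ 2 * energy μ ∧
      Y 0 = corr θstar μ - P.drift * energy μ ∧ V 0 = energy μ ∧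
      ∀ τ, 0 ≤ τ → risk θstar (lawAt P θstar μ (Θ * τ)) =
          S τ + 2 * P.drift * Y τ + P.drift ^ 2 * V τ ∧
        energy (lawAt P θstar μ (Θ * τ)) = V τ ∧
        corr θstar (lawAt P θstar μ (Θ * τ)) = Y τ + P.drift * V τ := by
  have hφ := memLp_spentError (P := P) (θstar := θstar) hθ hm
  have hR := risk_eq_moments hφ hm
  have hV := energy_eq_moments P θstar μ
  have hC := corr_eq_moments hφ hm
  simp only [dotProduct, Fin.sum_univ_three, Matrix.cons_val_zero, Matrix.cons_val_one,
    Matrix.cons_val, zero_mul, one_mul, zero_add] at hR hV hC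
  refine ⟨_, _, _, isMomentTrajectory_linearFlow hε.ne' Θ (moments P θstar μ), ?_, ?_, ?_,
    fun τ hτ => ?_⟩
  · simp only [mul_zero, linearFlow_zero]
    rw [hR, hV, hC]; ring
  · simp only [mul_zero, linearFlow_zero]
    rw [hV, hC]; ring
  · simp only [mul_zero, linearFlow_zero]
    rw [hV]
  · have h := lawAt_moments (θstar := θstar) hp hB hε hε1 hθ hm (mul_nonneg hΘ hτ)
    simp only [dotProduct, Fin.sum_univ_three, Matrix.cons_val_zero, Matrix.cons_val_one,
      Matrix.cons_val, zero_mul, one_mul, zero_add] at h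
    exact h

end MomentEquations

/-! ### Elementary bounds for the parameters -/

section ParameterBounds

variable {P : Params}

theorem idle_nonneg {x : ℝ} (hx0 : 0 ≤ x) (hx1 : x ≤ 1) : 0 ≤ P.idle x := by
  have := P.pBatch.2.1
  have := P.pBatch.2.2
  exact div_nonneg P.pBatch.2.1 (by nlinarith)

theorem idle_le_one {x : ℝ} (hx1 : x ≤ 1) : P.idle x ≤ 1 := by
  have := P.pBatch.2.1
  have := P.pBatch.2.2
  exact div_le_one_of_le₀ (by nlinarith) (by nlinarith)

theorem idle_denom_pos (hP : 0 < (P.pBatch : ℝ)) {x : ℝ} (hx1 : x ≤ 1) :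
    0 < 1 - (1 - P.pBatch) * x := by
  have := P.pBatch.2.2
  nlinarith

theorem gap₁_eq (hP : 0 < (P.pBatch : ℝ)) (hε : 0 < P.ε) :
    P.gap₁ = P.ε / (1 - (1 - P.pBatch) * (1 - P.ε)) := by
  have h := idle_denom_pos hP (show 1 - P.ε ≤ 1 by linarith)
  unfold Params.gap₁ Params.idle
  rw [eq_div_iff h.ne', sub_mul, mul_assoc, div_mul_cancel₀ _ h.ne']
  ring

theorem gap₂_eq (hP : 0 < (P.pBatch : ℝ)) (hε : 0 < P.ε) (hε1 : P.ε ≤ 1) :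
    P.gap₂ = P.ε * (2 - P.ε) / (1 - (1 - P.pBatch) * (1 - P.ε) ^ 2) := by
  have h := idle_denom_pos hP (show (1 - P.ε) ^ 2 ≤ 1 from pow_le_one₀ (by linarith) (by linarith))
  unfold Params.gap₂
  rw [eq_div_iff h.ne', sub_mul, div_mul_cancel₀ _ h.ne']
  ring

theorem gap₁_pos (hP : 0 < (P.pBatch : ℝ)) (hε : 0 < P.ε) : 0 < P.gap₁ := by
  rw [gap₁_eq hP hε]
  exact div_pos hε (idle_denom_pos hP (by linarith))

theorem gap₂_pos (hP : 0 < (P.pBatch : ℝ)) (hε : 0 < P.ε) (hε1 : P.ε ≤ 1) : 0 < P.gap₂ := by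
  rw [gap₂_eq hP hε hε1]
  exact div_pos (mul_pos hε (by linarith))
    (idle_denom_pos hP (pow_le_one₀ (by linarith) (by linarith)))

theorem denom₁_le (hε : 0 < P.ε) :
    1 - (1 - (P.pBatch : ℝ)) * (1 - P.ε) ≤ P.pBatch + P.ε := by
  have := P.pBatch.2.1
  nlinarith

theorem denom₂_le (hε : 0 < P.ε) (hε1 : P.ε ≤ 1) :
    1 - (1 - (P.pBatch : ℝ)) * (1 - P.ε) ^ 2 ≤ 2 * (P.pBatch + P.ε) := by
  have h0 := P.pBatch.2.1
  have h1 : 0 ≤ P.pBatch * (P.ε * (2 - P.ε)) := mul_nonneg h0 (mul_nonneg hε.le (by linarith))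
  nlinarith [sq_nonneg P.ε]

theorem pBatch_le_denom₂ (hε : 0 < P.ε) (hε1 : P.ε ≤ 1) :
    (P.pBatch : ℝ) ≤ 1 - (1 - (P.pBatch : ℝ)) * (1 - P.ε) ^ 2 := by
  have h1 := P.pBatch.2.2
  have h2 : (1 - P.ε) ^ 2 ≤ 1 := pow_le_one₀ (by linarith) (by linarith)
  nlinarith

theorem signal_pos (hp : 0 < (P.p : ℝ)) (hB : 0 < P.B) : 0 < P.signal :=
  div_pos hp (pBatch_pos hp hB)

theorem noise_pos (hp : 0 < (P.p : ℝ)) (hB : 0 < P.B) (d : ℕ) : 0 < P.noise d := by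
  have hB' : (1 : ℝ) ≤ P.B := by exact_mod_cast hB
  have hP := pBatch_pos hp hB
  unfold Params.noise
  have h2 : 0 ≤ (P.p : ℝ) ^ 2 * ((P.B : ℝ) - 1) / (P.B * P.pBatch) :=
    div_nonneg (mul_nonneg (by positivity) (by linarith)) (by positivity)
  have h1 : 0 < ((d : ℝ) + 2) * (P.p / (P.B * P.pBatch)) := by positivity
  linarith

/-- The slaved correlation in terms of the moments of the spent error: the stationary value
`D (𝓑₁ - η 𝓑₂)` of `𝔼⟨φ, m⟩ / R` plus the drift times the slaved energy, where
`D = 1 - (1 - P_batch) β`. -/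
theorem slavedC_eq (hP : 0 < (P.pBatch : ℝ)) (hε : 0 < P.ε) (hε1 : P.ε ≤ 1) (d : ℕ) :
    P.slavedC d = (1 - (1 - P.pBatch) * (1 - P.ε)) * (P.signal - P.η * P.noise d) +
      P.drift * P.slavedV d := by
  have h := idle_denom_pos hP (show (1 - P.ε) ^ 2 ≤ 1 from pow_le_one₀ (by linarith) (by linarith))
  have h2 : 2 - P.ε ≠ 0 := by linarith
  unfold Params.slavedC Params.slavedV Params.drift
  rw [gap₂_eq hP hε hε1]
  field_simp
  ring

end ParameterBounds

/-! ### Uniform convergence on time intervals -/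

section Uniform

variable {I : Set ℝ} {a b : ℕ → ℝ} {f : ℕ → ℝ → ℝ} {F : ℝ → ℝ} {a' K : ℝ}

theorem tendstoUniformlyOn_zero_of_abs_le (hb : Tendsto b atTop (𝓝 0))
    (h : ∀ᶠ d in atTop, ∀ τ ∈ I, |f d τ| ≤ b d) :
    TendstoUniformlyOn f (fun _ => 0) atTop I := by
  rw [Metric.tendstoUniformlyOn_iff]
  intro ε hε
  filter_upwards [h, hb.eventually (gt_mem_nhds hε)] with d hd hbd τ hτ
  rw [Real.dist_eq, zero_sub, abs_neg]
  exact (hd τ hτ).trans_lt hbd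

theorem tendstoUniformlyOn_bdd_mul_zero (ha : ∀ᶠ d in atTop, |a d| ≤ K)
    (hf : TendstoUniformlyOn f (fun _ => 0) atTop I) :
    TendstoUniformlyOn (fun d τ => a d * f d τ) (fun _ => 0) atTop I := by
  rw [Metric.tendstoUniformlyOn_iff] at hf ⊢
  intro ε hε
  filter_upwards [ha, hf (ε / (|K| + 1)) (by positivity)] with d had hfd τ hτ
  have h := hfd τ hτ
  rw [Real.dist_eq, zero_sub, abs_neg] at h ⊢
  rw [lt_div_iff₀ (by positivity)] at h
  rw [abs_mul, mul_comm]
  refine lt_of_le_of_lt ?_ h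
  gcongr
  linarith [le_abs_self K]

theorem tendstoUniformlyOn_mul (ha : Tendsto a atTop (𝓝 a'))
    (hf : TendstoUniformlyOn f F atTop I) (hF : ∀ τ ∈ I, |F τ| ≤ K) :
    TendstoUniformlyOn (fun d τ => a d * f d τ) (fun τ => a' * F τ) atTop I := by
  have h1 : TendstoUniformlyOn (fun d τ => a d * (f d τ - F τ)) (fun _ => 0) atTop I := by
    refine tendstoUniformlyOn_bdd_mul_zero (K := |a'| + 1) ?_ ?_
    · filter_upwards [ha.abs.eventually (gt_mem_nhds (lt_add_one _))] with d hd using hd.le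
    · rw [Metric.tendstoUniformlyOn_iff] at hf ⊢
      intro ε hε
      filter_upwards [hf ε hε] with d hd τ hτ
      have := hd τ hτ
      rw [Real.dist_eq, abs_sub_comm] at this
      rwa [Real.dist_eq, zero_sub, abs_neg]
  have h2 : TendstoUniformlyOn (fun d τ => (a d - a') * F τ) (fun _ => 0) atTop I := by
    refine tendstoUniformlyOn_zero_of_abs_le (b := fun d => |a d - a'| * |K|) ?_ ?_
    · have h3 : Tendsto (fun d => a d - a') atTop (𝓝 0) := by simpa using ha.sub_const a'
      simpa using h3.abs.mul_const |K|
    · refine Eventually.of_forall fun d τ hτ => ?_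
      rw [abs_mul]
      exact mul_le_mul_of_nonneg_left ((hF τ hτ).trans (le_abs_self K)) (abs_nonneg _)
  have h3 : TendstoUniformlyOn (fun (_ : ℕ) τ => a' * F τ) (fun τ => a' * F τ) atTop I := by
    rw [Metric.tendstoUniformlyOn_iff]
    exact fun ε hε => Eventually.of_forall fun d τ _ => by simpa using hε
  refine (((h1.add h2).add h3).congr (Eventually.of_forall fun d τ _ => ?_)).congr_right
    fun τ _ => ?_
  · simp only [Pi.add_apply]; ring
  · simp

end Uniform

/-! ### Slaving of the momentum modes below resonance -/

section Slaving

/-- Two strongly damped components `x`, `n` that start near zero vanish in the limit, and the slow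
component `s` decouples. The a-priori bound of `sq_add_sq_add_sq_le_of_damped`, which is uniform in
the damping, makes the coupling of `x` and `n` to `s` a bounded force. -/
theorem tendstoUniformlyOn_of_damped {s x n : ℕ → ℝ → ℝ} {β H K G₁ G₂ E₁ E₂ : ℕ → ℝ} {e r : ℝ}
    (hs : ∀ d τ, HasDerivAt (s d) ((K d - 2 * H d) * s d τ +
      (2 * (K d - H d) * E₁ d * x d τ + K d * E₂ d * n d τ)) τ)
    (hx : ∀ d τ, HasDerivAt (x d) (-G₁ d * x d τ + β d * (H d * (s d τ - E₂ d * n d τ) -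
      K d * (s d τ + 2 * E₁ d * x d τ + E₂ d * n d τ))) τ)
    (hn : ∀ d τ, HasDerivAt (n d) (-G₂ d * n d τ + β d ^ 2 *
      (2 * H d * (E₁ d * x d τ + E₂ d * n d τ) +
      K d * (s d τ + 2 * E₁ d * x d τ + E₂ d * n d τ))) τ)
    (hβ : ∀ d, |β d| ≤ 1) (hE₁ : ∀ d, |E₁ d| ≤ 1) (hE₂ : ∀ d, |E₂ d| ≤ 1)
    (hH : Tendsto H atTop (𝓝 e)) (hK : Tendsto K atTop (𝓝 (e ^ 2)))
    (hG₁ : Tendsto G₁ atTop atTop) (hG₂ : Tendsto G₂ atTop atTop)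
    (hs0 : Tendsto (fun d => s d 0) atTop (𝓝 r)) (hx0 : Tendsto (fun d => x d 0) atTop (𝓝 0))
    (hn0 : Tendsto (fun d => n d 0) atTop (𝓝 0)) (T : ℝ) :
    TendstoUniformlyOn s (fun τ => r * Real.exp ((e ^ 2 - 2 * e) * τ)) atTop (Icc 0 T) ∧
    TendstoUniformlyOn x (fun _ => 0) atTop (Icc 0 T) ∧
    TendstoUniformlyOn n (fun _ => 0) atTop (Icc 0 T) := by
  -- a common bound for the coefficients `H` and `K`
  set L : ℝ := |e| + e ^ 2 + 1 with hL
  have hL0 : 0 ≤ L := by positivity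
  have hHL : ∀ᶠ d in atTop, |H d| ≤ L := by
    filter_upwards [hH.abs.eventually (gt_mem_nhds (lt_add_one _))] with d hd
    nlinarith [sq_nonneg e]
  have hKL : ∀ᶠ d in atTop, |K d| ≤ L := by
    filter_upwards [hK.abs.eventually (gt_mem_nhds (lt_add_one _))] with d hd
    rw [abs_of_nonneg (sq_nonneg e)] at hd
    linarith [abs_nonneg e]
  have hm : ∀ {a b A c : ℝ}, |a| ≤ A → |b| ≤ 1 → |a * b * c| ≤ A * |c| := fun {a b A c} ha hb => by
    rw [abs_mul, abs_mul]
    have := mul_le_mul ha hb (abs_nonneg _) ((abs_nonneg _).trans ha)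
    rw [mul_one] at this
    gcongr
  have hforce : ∀ᶠ d in atTop, ∀ τ,
      |(K d - 2 * H d) * s d τ + (2 * (K d - H d) * E₁ d * x d τ + K d * E₂ d * n d τ)|
        ≤ 4 * L * (|s d τ| + |x d τ| + |n d τ|) ∧
      |β d * (H d * (s d τ - E₂ d * n d τ) -
        K d * (s d τ + 2 * E₁ d * x d τ + E₂ d * n d τ))|
        ≤ 4 * L * (|s d τ| + |x d τ| + |n d τ|) ∧
      |β d ^ 2 * (2 * H d * (E₁ d * x d τ + E₂ d * n d τ) +
        K d * (s d τ + 2 * E₁ d * x d τ + E₂ d * n d τ))|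
        ≤ 4 * L * (|s d τ| + |x d τ| + |n d τ|) := by
    filter_upwards [hHL, hKL] with d h1 h2 τ
    have a1 : |(K d - 2 * H d) * 1 * s d τ| ≤ 3 * L * |s d τ| :=
      hm (by rw [abs_le] at *; constructor <;> linarith) (by simp)
    have a2 : |2 * (K d - H d) * E₁ d * x d τ| ≤ 4 * L * |x d τ| :=
      hm (by rw [abs_le] at *; constructor <;> linarith) (hE₁ d)
    have a3 : |K d * E₂ d * n d τ| ≤ L * |n d τ| := hm h2 (hE₂ d)
    have a4 : |(H d - K d) * 1 * s d τ| ≤ 2 * L * |s d τ| :=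
      hm (by rw [abs_le] at *; constructor <;> linarith) (by simp)
    have a5 : |-(H d + K d) * E₂ d * n d τ| ≤ 2 * L * |n d τ| :=
      hm (by rw [abs_le] at *; constructor <;> linarith) (hE₂ d)
    have a6 : |(-2 * K d) * E₁ d * x d τ| ≤ 2 * L * |x d τ| :=
      hm (by rw [abs_le] at *; constructor <;> linarith) (hE₁ d)
    have a7 : |(2 * H d + K d) * E₂ d * n d τ| ≤ 3 * L * |n d τ| :=
      hm (by rw [abs_le] at *; constructor <;> linarith) (hE₂ d)
    have a8 : |2 * (H d + K d) * E₁ d * x d τ| ≤ 4 * L * |x d τ| :=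
      hm (by rw [abs_le] at *; constructor <;> linarith) (hE₁ d)
    have a9 : |K d * 1 * s d τ| ≤ L * |s d τ| := hm h2 (by simp)
    have p1 := mul_nonneg hL0 (abs_nonneg (s d τ))
    have p2 := mul_nonneg hL0 (abs_nonneg (x d τ))
    have p3 := mul_nonneg hL0 (abs_nonneg (n d τ))
    have hβ2 : |β d ^ 2| ≤ 1 := by
      rw [abs_pow]; exact pow_le_one₀ (abs_nonneg _) (hβ d)
    have hb : ∀ {b z : ℝ}, |b| ≤ 1 → |z| ≤ 4 * L * (|s d τ| + |x d τ| + |n d τ|) →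
        |b * z| ≤ 4 * L * (|s d τ| + |x d τ| + |n d τ|) := fun {b z} hb hz => by
      rw [abs_mul]
      nlinarith [abs_nonneg z, abs_nonneg b]
    refine ⟨?_, hb (hβ d) ?_, hb hβ2 ?_⟩
    · rw [abs_le] at *
      constructor <;> linarith
    · rw [abs_le] at a4 a5 a6 ⊢
      constructor <;> linarith
    · rw [abs_le] at a7 a8 a9 ⊢
      constructor <;> linarith
  -- the a-priori bound on `s`, `x`, `n`
  obtain ⟨A, hA⟩ : ∃ A : ℝ, ∀ᶠ d in atTop, ∀ τ ∈ Icc 0 T, |s d τ| + |x d τ| + |n d τ| ≤ A := by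
    have hE0 : Tendsto (fun d => s d 0 ^ 2 + x d 0 ^ 2 + n d 0 ^ 2) atTop (𝓝 (r ^ 2)) := by
      simpa using ((hs0.pow 2).add (hx0.pow 2)).add (hn0.pow 2)
    set Q : ℝ := (r ^ 2 + 1) * Real.exp (6 * (4 * L) * T) with hQ
    refine ⟨3 * (Q + 1), ?_⟩
    filter_upwards [hforce, hE0.eventually (gt_mem_nhds (lt_add_one _)),
      hG₁.eventually_ge_atTop 0, hG₂.eventually_ge_atTop 0] with d hf h0 h1 h2 τ hτ
    have h := sq_add_sq_add_sq_le_of_damped h1 h2 (by positivity : 0 ≤ 4 * L) (hs d) (hx d) (hn d)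
      (fun τ => (hf τ).1) (fun τ => (hf τ).2.1) (fun τ => (hf τ).2.2) τ hτ
    have h3 : s d τ ^ 2 + x d τ ^ 2 + n d τ ^ 2 ≤ Q := h.trans (by rw [hQ]; gcongr)
    have h4 : ∀ z : ℝ, z ^ 2 ≤ Q → |z| ≤ Q + 1 := fun z hz => by
      rw [← sq_abs] at hz
      nlinarith [sq_nonneg (|z| - 1)]
    have e1 := h4 (s d τ) (by nlinarith [sq_nonneg (x d τ), sq_nonneg (n d τ)])
    have e2 := h4 (x d τ) (by nlinarith [sq_nonneg (s d τ), sq_nonneg (n d τ)])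
    have e3 := h4 (n d τ) (by nlinarith [sq_nonneg (x d τ), sq_nonneg (s d τ)])
    linarith
  have hzero : ∀ {w g : ℕ → ℝ → ℝ} {G : ℕ → ℝ}, Tendsto G atTop atTop →
      (∀ d τ, HasDerivAt (w d) (-G d * w d τ + g d τ) τ) →
      (∀ᶠ d in atTop, ∀ τ, |g d τ| ≤ 4 * L * (|s d τ| + |x d τ| + |n d τ|)) →
      Tendsto (fun d => w d 0) atTop (𝓝 0) →
      TendstoUniformlyOn w (fun _ => 0) atTop (Icc 0 T) := by
    intro w g G hG hw hg h0
    -- a component with a nonpositive rate is replaced by zero: only large `d` matter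
    let w' : ℕ → ℝ → ℝ := fun d => if 0 < G d then w d else 0
    have hw' : ∀ d τ, HasDerivAt (w' d)
        (-G d * (w' d τ - if 0 < G d then g d τ / G d else 0)) τ := by
      intro d τ
      by_cases h : 0 < G d
      · simp only [w', if_pos h]
        exact (hw d τ).congr_deriv (by field_simp; ring)
      · simp only [w', if_neg h]
        simp
    have hlarge := hG.eventually_gt_atTop 0
    have hu := tendstoUniformlyOn_relaxation (F := fun _ => 0) (F' := fun _ => 0) (K := 0) (T := T)
      hG hw' (fun τ => hasDerivAt_const τ _) (fun τ _ => by simp)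
      (tendstoUniformlyOn_zero_of_abs_le (hG.const_div_atTop (4 * L * A)) (by
        filter_upwards [hg, hA, hlarge] with d hgd hAd h τ hτ
        rw [if_pos h, abs_div, abs_of_pos h]
        gcongr
        exact (hgd τ).trans (by gcongr; exact hAd τ hτ)))
      (h0.congr' (by filter_upwards [hlarge] with d h; simp [w', if_pos h]))
    refine hu.congr ?_
    filter_upwards [hlarge] with d h τ _
    simp [w', if_pos h]
  have ux := hzero hG₁ hx (hforce.mono fun d h τ => (h τ).2.1) hx0
  have un := hzero hG₂ hn (hforce.mono fun d h τ => (h τ).2.2) hn0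
  refine ⟨?_, ux, un⟩
  refine tendstoUniformlyOn_exp_of_hasDerivAt (hK.sub (hH.const_mul 2)) hs ?_ hs0
  have hcoef : ∀ᶠ d in atTop, |2 * (K d - H d) * E₁ d| ≤ 4 * L ∧ |K d * E₂ d| ≤ L := by
    filter_upwards [hHL, hKL] with d h1 h2
    constructor
    · simpa using hm (c := 1) (A := 4 * L) (a := 2 * (K d - H d))
        (by rw [abs_le] at *; constructor <;> linarith) (hE₁ d)
    · simpa using hm (c := 1) h2 (hE₂ d)
  have h := (tendstoUniformlyOn_bdd_mul_zero (hcoef.mono fun d h => h.1) ux).add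
    (tendstoUniformlyOn_bdd_mul_zero (hcoef.mono fun d h => h.2) un)
  simpa [Pi.add_def] using h

end Slaving

/-! ### Below resonance -/

section BelowResonance

/-- The part of the assumptions on a family of instances that every regime uses. -/
structure Admissible (P : ℕ → Params) : Prop where
  p_pos : ∀ d, 0 < ((P d).p : ℝ)
  B_pos : ∀ d, 0 < (P d).B
  ε_pos : ∀ d, 0 < (P d).ε
  ε_le_one : ∀ d, (P d).ε ≤ 1
  η_pos : ∀ d, 0 < (P d).η

variable {P : ℕ → Params}

theorem tendsto_drift_mul_p (hP : Admissible P)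
    (hρ : Tendsto (fun d => (P d).η * (P d).p / (P d).ε) atTop (𝓝 0)) :
    Tendsto (fun d => (P d).drift * (P d).p) atTop (𝓝 0) := by
  refine squeeze_zero (fun d => ?_) (fun d => ?_) hρ
  · have := hP.η_pos d; have := hP.p_pos d; have := hP.ε_pos d
    have : 0 ≤ 1 - (P d).ε := by linarith [hP.ε_le_one d]
    unfold Params.drift; positivity
  · have := hP.η_pos d; have := hP.p_pos d; have := hP.ε_pos d
    unfold Params.drift
    rw [div_mul_eq_mul_div]
    gcongr
    nlinarith

/-- Both damping rates are large compared with the rate `η 𝓑₁` of the risk. -/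
theorem tendsto_rates_atTop (hP : Admissible P) {Θ : ℕ → ℝ} {e : ℝ} (he : 0 < e)
    (hH : Tendsto (fun d => Θ d * ((P d).η * (P d).signal)) atTop (𝓝 e))
    (hρ : Tendsto (fun d => (P d).η * (P d).p / (P d).ε) atTop (𝓝 0))
    (hh : Tendsto (fun d => (P d).η * (P d).signal) atTop (𝓝 0)) :
    Tendsto (fun d => Θ d * (P d).gap₁) atTop atTop ∧
    Tendsto (fun d => Θ d * (P d).gap₂) atTop atTop := by
  have hh0 : ∀ d, 0 < (P d).η * (P d).signal := fun d =>
    mul_pos (hP.η_pos d) (signal_pos (hP.p_pos d) (hP.B_pos d))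
  -- `η 𝓑₁ (P_batch + ε) / ε = η p / ε + η 𝓑₁`
  have hsum : Tendsto (fun d => 2 * ((P d).η * (P d).p / (P d).ε + (P d).η * (P d).signal)) atTop
      (𝓝 0) := by simpa using (hρ.add hh).const_mul 2
  have key : ∀ g : ℕ → ℝ, (∀ d, (P d).ε / (2 * ((P d).pBatch + (P d).ε)) ≤ g d) →
      Tendsto (fun d => Θ d * g d) atTop atTop := by
    intro g hg
    have hg0 : ∀ d, 0 < g d := fun d => by
      have := pBatch_pos (hP.p_pos d) (hP.B_pos d); have := hP.ε_pos d
      exact lt_of_lt_of_le (by positivity) (hg d)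
    have h1 : Tendsto (fun d => (P d).η * (P d).signal / g d) atTop (𝓝[>] 0) := by
      refine tendsto_nhdsWithin_iff.2 ⟨squeeze_zero (fun d => (div_pos (hh0 d) (hg0 d)).le)
        (fun d => ?_) hsum, Eventually.of_forall fun d => div_pos (hh0 d) (hg0 d)⟩
      have hPb := pBatch_pos (hP.p_pos d) (hP.B_pos d)
      have hε := hP.ε_pos d
      have h2 : (P d).η * (P d).signal / g d ≤
          (P d).η * (P d).signal / ((P d).ε / (2 * ((P d).pBatch + (P d).ε))) :=
        div_le_div_of_nonneg_left (hh0 d).le (by positivity) (hg d)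
      refine h2.trans_eq ?_
      unfold Params.signal
      field_simp
    refine (h1.inv_tendsto_nhdsGT_zero.atTop_mul_pos he hH).congr fun d => ?_
    have := (hP.η_pos d).ne'
    have := (signal_pos (hP.p_pos d) (hP.B_pos d)).ne'
    have := (hg0 d).ne'
    simp only [Pi.inv_apply]
    field_simp
  refine ⟨key _ fun d => ?_, key _ fun d => ?_⟩
  · have hPb := pBatch_pos (hP.p_pos d) (hP.B_pos d)
    have hε := hP.ε_pos d
    rw [gap₁_eq hPb hε]
    have := idle_denom_pos hPb (show 1 - (P d).ε ≤ 1 by linarith)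
    have := denom₁_le (P := P d) hε
    gcongr
    linarith
  · have hPb := pBatch_pos (hP.p_pos d) (hP.B_pos d)
    have hε := hP.ε_pos d
    have hε1 := hP.ε_le_one d
    rw [gap₂_eq hPb hε hε1]
    have := idle_denom_pos hPb
      (show (1 - (P d).ε) ^ 2 ≤ 1 from pow_le_one₀ (by linarith) (by linarith))
    refine div_le_div₀ (mul_nonneg hε.le (by linarith)) (by nlinarith) this (denom₂_le hε hε1)

/-- Convergence below resonance, in a time unit in which the rate `η 𝓑₁` of the risk tends to
`e`. The condition `η p / ε → 0` says that the momentum forgets faster than the risk moves. It gives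
`c p → 0` for the drift `c`, so that `S`, `c Y` and `c² V` form a slow component and two damped ones
that start near zero. The energy and the correlation, in units of their slaved values, then relax
towards multiples of the risk. -/
theorem below_resonance (hP : Admissible P) {Θ : ℕ → ℝ} {e r₀ v₀ c₀ : ℝ} (hΘ : ∀ d, 0 ≤ Θ d)
    (he : 0 < e)
    (hH : Tendsto (fun d => Θ d * ((P d).η * (P d).signal)) atTop (𝓝 e))
    (hq : Tendsto (fun d => (P d).η * (P d).noise d / (P d).signal) atTop (𝓝 e))
    (hρ : Tendsto (fun d => (P d).η * (P d).p / (P d).ε) atTop (𝓝 0))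
    (hh : Tendsto (fun d => (P d).η * (P d).signal) atTop (𝓝 0))
    {θstar : ∀ d, Vec d} {μ₀ : ∀ d, Measure (State d)}
    (hprob : ∀ d, IsProbabilityMeasure (μ₀ d))
    (hθ : ∀ d, MemLp (fun z : State d => z.1) 2 (μ₀ d))
    (hm : ∀ d, MemLp (fun z : State d => z.2) 2 (μ₀ d))
    (hr : Tendsto (fun d => risk (θstar d) (μ₀ d)) atTop (𝓝 r₀))
    (hv : Tendsto (fun d => energy (μ₀ d) / ((P d).p : ℝ) ^ 2) atTop (𝓝 v₀))
    (hc : Tendsto (fun d => corr (θstar d) (μ₀ d) / ((P d).p : ℝ)) atTop (𝓝 c₀)) :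
    (∀ T : ℝ, TendstoUniformlyOn
      (fun d τ => risk (θstar d) (lawAt (P d) (θstar d) (μ₀ d) (Θ d * τ)))
      (fun τ => r₀ * Real.exp ((e ^ 2 - 2 * e) * τ)) atTop (Icc 0 T)) ∧
    ∀ δ T : ℝ, 0 < δ →
      TendstoUniformlyOn
        (fun d τ => energy (lawAt (P d) (θstar d) (μ₀ d) (Θ d * τ)) / (P d).slavedV d)
        (fun τ => r₀ * Real.exp ((e ^ 2 - 2 * e) * τ)) atTop (Icc δ T) ∧
      TendstoUniformlyOn
        (fun d τ => (corr (θstar d) (lawAt (P d) (θstar d) (μ₀ d) (Θ d * τ)) -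
          (P d).slavedC d * risk (θstar d) (lawAt (P d) (θstar d) (μ₀ d) (Θ d * τ))) /
          (((P d).pBatch + (P d).ε) * (P d).signal)) (fun _ => 0) atTop (Icc δ T) := by
  choose S Y V hode hS0 hY0 hV0 hobs using fun d =>
    exists_isMomentTrajectory (θstar := θstar d) (μ := μ₀ d) (hP.p_pos d) (hP.B_pos d)
      (hP.ε_pos d) (hP.ε_le_one d) (hθ d) (hm d) (hΘ d)
  have hPb : ∀ d, 0 < ((P d).pBatch : ℝ) := fun d => pBatch_pos (hP.p_pos d) (hP.B_pos d)
  have hsig : ∀ d, 0 < (P d).signal := fun d => signal_pos (hP.p_pos d) (hP.B_pos d)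
  have hnoise : ∀ d, 0 < (P d).noise d := fun d => noise_pos (hP.p_pos d) (hP.B_pos d) d
  have hβ0 : ∀ d, 0 ≤ 1 - (P d).ε := fun d => by linarith [hP.ε_le_one d]
  have hβ1 : ∀ d, 1 - (P d).ε ≤ 1 := fun d => by linarith [hP.ε_pos d]
  have hβ21 : ∀ d, (1 - (P d).ε) ^ 2 ≤ 1 := fun d => pow_le_one₀ (hβ0 d) (hβ1 d)
  have hg1 : ∀ d, 0 < (P d).gap₁ := fun d => gap₁_pos (hPb d) (hP.ε_pos d)
  have hg2 : ∀ d, 0 < (P d).gap₂ := fun d => gap₂_pos (hPb d) (hP.ε_pos d) (hP.ε_le_one d)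
  have hD1 : ∀ d, 0 < 1 - (1 - ((P d).pBatch : ℝ)) * (1 - (P d).ε) := fun d =>
    idle_denom_pos (hPb d) (hβ1 d)
  have hD2 : ∀ d, 0 < 1 - (1 - ((P d).pBatch : ℝ)) * (1 - (P d).ε) ^ 2 := fun d =>
    idle_denom_pos (hPb d) (hβ21 d)
  have hcε : ∀ d, (P d).drift * (P d).ε = (P d).η * (1 - (P d).ε) := fun d =>
    drift_mul_ε (hP.ε_pos d).ne'
  have hcp := tendsto_drift_mul_p hP hρ
  obtain ⟨hG1, hG2⟩ := tendsto_rates_atTop hP he hH hρ hh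
  have hE1 : ∀ d, |(P d).idle (1 - (P d).ε)| ≤ 1 := fun d => by
    rw [abs_of_nonneg (idle_nonneg (hβ0 d) (hβ1 d))]; exact idle_le_one (hβ1 d)
  have hE2 : ∀ d, |(P d).idle ((1 - (P d).ε) ^ 2)| ≤ 1 := fun d => by
    rw [abs_of_nonneg (idle_nonneg (sq_nonneg _) (hβ21 d))]; exact idle_le_one (hβ21 d)
  -- initial values of the balanced fast components
  have hcc : Tendsto (fun d => (P d).drift * corr (θstar d) (μ₀ d)) atTop (𝓝 0) := by
    have h := hcp.mul hc
    rw [zero_mul] at h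
    refine h.congr fun d => ?_
    have := (hP.p_pos d).ne'
    field_simp
  have hcv : Tendsto (fun d => (P d).drift ^ 2 * energy (μ₀ d)) atTop (𝓝 0) := by
    have h := (hcp.pow 2).mul hv
    rw [zero_pow two_ne_zero, zero_mul] at h
    refine h.congr fun d => ?_
    have := (hP.p_pos d).ne'
    field_simp
  have hK : Tendsto (fun d => Θ d * ((P d).η ^ 2 * (P d).noise d)) atTop (𝓝 (e ^ 2)) := by
    rw [sq]
    refine (hH.mul hq).congr fun d => ?_
    have := (hsig d).ne'
    field_simp
  have hmain := tendstoUniformlyOn_of_damped (s := S) (x := fun d τ => (P d).drift * Y d τ)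
    (n := fun d τ => (P d).drift ^ 2 * V d τ) (β := fun d => 1 - (P d).ε)
    (H := fun d => Θ d * ((P d).η * (P d).signal))
    (K := fun d => Θ d * ((P d).η ^ 2 * (P d).noise d))
    (G₁ := fun d => Θ d * (P d).gap₁) (G₂ := fun d => Θ d * (P d).gap₂)
    (E₁ := fun d => (P d).idle (1 - (P d).ε)) (E₂ := fun d => (P d).idle ((1 - (P d).ε) ^ 2))
    (e := e) (r := r₀)
    (fun d τ => ((hode d).hasDerivAt_S τ).congr_deriv (by ring))
    (fun d τ => (((hode d).hasDerivAt_Y τ).const_mul (P d).drift).congr_deriv (by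
      linear_combination (Θ d * ((P d).signal * (S d τ - (P d).drift ^ 2 *
        (P d).idle ((1 - (P d).ε) ^ 2) * V d τ) - (P d).η * (P d).noise d *
        (S d τ + 2 * ((P d).drift * (P d).idle (1 - (P d).ε) * Y d τ) +
        (P d).drift ^ 2 * (P d).idle ((1 - (P d).ε) ^ 2) * V d τ))) * hcε d))
    (fun d τ => (((hode d).hasDerivAt_V τ).const_mul ((P d).drift ^ 2)).congr_deriv (by
      linear_combination (Θ d * (2 * (1 - (P d).ε) * (P d).signal * (P d).drift *
        ((P d).idle (1 - (P d).ε) * Y d τ + (P d).drift * (P d).idle ((1 - (P d).ε) ^ 2) * V d τ) +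
        ((P d).drift * (P d).ε + (P d).η * (1 - (P d).ε)) * (P d).noise d *
        (S d τ + 2 * ((P d).drift * (P d).idle (1 - (P d).ε) * Y d τ) +
        (P d).drift ^ 2 * (P d).idle ((1 - (P d).ε) ^ 2) * V d τ))) * hcε d))
    (fun d => by rw [abs_of_nonneg (hβ0 d)]; exact hβ1 d) hE1 hE2 hH hK hG1 hG2
    (by
      simp only [hS0]
      simpa [mul_assoc] using (hr.sub (hcc.const_mul 2)).add hcv)
    (by
      simp only [hY0]
      refine Tendsto.congr (fun d => ?_) (by simpa using hcc.sub hcv)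
      ring)
    (by simpa only [hV0] using hcv)
  set F : ℝ → ℝ := fun τ => r₀ * Real.exp ((e ^ 2 - 2 * e) * τ) with hFdef
  have hFderiv : ∀ τ, HasDerivAt F ((e ^ 2 - 2 * e) * F τ) τ := fun τ =>
    ((((hasDerivAt_id τ).const_mul (e ^ 2 - 2 * e)).exp).const_mul r₀).congr_deriv
      (by simp [F]; ring)
  have hFcont : Continuous F := by fun_prop
  have hFb : ∀ T : ℝ, ∃ A, ∀ τ ∈ Icc 0 T, |F τ| ≤ A := fun T => by
    obtain ⟨A, hA⟩ := (isCompact_Icc (a := (0 : ℝ)) (b := T)).exists_bound_of_continuousOn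
      hFcont.continuousOn
    exact ⟨A, by simpa using hA⟩
  have hrisk : ∀ T : ℝ, TendstoUniformlyOn
      (fun d τ => risk (θstar d) (lawAt (P d) (θstar d) (μ₀ d) (Θ d * τ))) F atTop (Icc 0 T) := by
    intro T
    obtain ⟨us, ux, un⟩ := hmain T
    have h2 : ∀ᶠ _d : ℕ in atTop, |(2 : ℝ)| ≤ 2 := Eventually.of_forall fun _ => by simp
    refine (((us.add (tendstoUniformlyOn_bdd_mul_zero h2 ux)).add un).congr
      (Eventually.of_forall fun d τ hτ => ?_)).congr_right fun τ _ => ?_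
    · rw [(hobs d τ hτ.1).1]
      simp only [Pi.add_apply]; ring
    · simp
  refine ⟨hrisk, fun δ T hδ => ?_⟩
  obtain ⟨us, ux, un⟩ := hmain T
  obtain ⟨A, hA⟩ := hFb T
  have hqb : ∀ᶠ d in atTop, |(P d).η * (P d).noise d / (P d).signal| ≤ e + 1 := by
    filter_upwards [hq.abs.eventually (gt_mem_nhds (lt_add_one _))] with d hd
    rw [abs_of_pos he] at hd
    exact hd.le
  have hq0 : ∀ d, 0 < (P d).η * (P d).noise d / (P d).signal := fun d =>
    div_pos (mul_pos (hP.η_pos d) (hnoise d)) (hsig d)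
  have hsub : Icc δ T ⊆ Icc 0 T := Icc_subset_Icc_left hδ.le
  -- the coefficients of the fast components in the forcing terms stay bounded
  have ux' := tendstoUniformlyOn_bdd_mul_zero (Eventually.of_forall hE1) ux
  have un' := tendstoUniformlyOn_bdd_mul_zero (Eventually.of_forall hE2) un
  -- relaxation of the energy
  have uv : TendstoUniformlyOn (fun d τ => V d τ / (P d).slavedV d) F atTop (Icc δ T) := by
    refine tendstoUniformlyOn_relaxation_layer hδ hG2 (K := |e ^ 2 - 2 * e| * A) (K₀ := 1)
      (f := fun d τ => S d τ + 2 * ((P d).drift * (P d).idle (1 - (P d).ε) * Y d τ) +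
        (P d).drift ^ 2 * (P d).idle ((1 - (P d).ε) ^ 2) * V d τ +
        2 * ((P d).η * (P d).noise d / (P d).signal)⁻¹ * ((P d).idle (1 - (P d).ε) *
        ((P d).drift * Y d τ) + (P d).idle ((1 - (P d).ε) ^ 2) * ((P d).drift ^ 2 * V d τ)))
      (fun d τ => (((hode d).hasDerivAt_V τ).div_const _).congr_deriv ?_) hFderiv
      (fun τ hτ => by rw [abs_mul]; gcongr; exact hA τ hτ) ?_ ?_
    · have := (hsig d).ne'; have := (hnoise d).ne'; have := (hg2 d).ne'
      have := (hP.ε_pos d).ne'; have := (hP.η_pos d).ne'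
      unfold Params.slavedV
      generalize (P d).gap₂ = g at *
      generalize (P d).idle (1 - (P d).ε) = E at *
      generalize (P d).idle ((1 - (P d).ε) ^ 2) = E' at *
      have hc' : (P d).drift = (P d).η * (1 - (P d).ε) / (P d).ε := rfl
      rw [hc']
      field_simp
      ring
    · have hqi : ∀ᶠ d in atTop, |2 * ((P d).η * (P d).noise d / (P d).signal)⁻¹| ≤
          2 * e⁻¹ + 1 := by
        have h1 := ((hq.inv₀ he.ne').const_mul 2).abs
        filter_upwards [h1.eventually (gt_mem_nhds (lt_add_one _))] with d hd
        rw [abs_of_pos (by positivity : 0 < 2 * e⁻¹)] at hd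
        exact hd.le
      have h2 : ∀ᶠ _d : ℕ in atTop, |(2 : ℝ)| ≤ 2 := Eventually.of_forall fun _ => by simp
      refine ((((us.add (tendstoUniformlyOn_bdd_mul_zero h2 ux')).add un').add
        ((tendstoUniformlyOn_bdd_mul_zero hqi ux').add
          (tendstoUniformlyOn_bdd_mul_zero hqi un'))).congr
        (Eventually.of_forall fun d τ _ => ?_)).congr_right fun τ _ => ?_
      · simp only [Pi.add_apply]; ring
      · simp [F]
    · -- `p² / V_sl = (η p / ε) (2 - ε) P_batch / (D₂ q)`, with `D₂ ≥ P_batch` and `q → e`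
      have h1 : Tendsto (fun d => 2 * ((P d).η * (P d).p / (P d).ε) *
          ((P d).η * (P d).noise d / (P d).signal)⁻¹ *
          |energy (μ₀ d) / ((P d).p : ℝ) ^ 2|) atTop (𝓝 0) := by
        simpa using ((hρ.const_mul 2).mul (hq.inv₀ he.ne')).mul hv.abs
      filter_upwards [h1.eventually (gt_mem_nhds zero_lt_one)] with d hd
      refine le_trans ?_ hd.le
      have hp := hP.p_pos d; have hε := hP.ε_pos d; have hη := hP.η_pos d
      have := hsig d; have := hnoise d; have := hD2 d; have hP0 := hPb d
      have e1 : V d 0 / (P d).slavedV d = (2 - (P d).ε) * (((P d).pBatch : ℝ) /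
          (1 - (1 - ((P d).pBatch : ℝ)) * (1 - (P d).ε) ^ 2)) *
          ((P d).η * (P d).p / (P d).ε) * ((P d).η * (P d).noise d / (P d).signal)⁻¹ *
          (energy (μ₀ d) / ((P d).p : ℝ) ^ 2) := by
        rw [hV0, Params.slavedV, gap₂_eq hP0 hε (hP.ε_le_one d), Params.signal]
        generalize 1 - (1 - ((P d).pBatch : ℝ)) * (1 - (P d).ε) ^ 2 = D at *
        field_simp
      rw [e1, abs_mul]
      refine mul_le_mul_of_nonneg_right ?_ (abs_nonneg _)
      have h2 : ((P d).pBatch : ℝ) / (1 - (1 - ((P d).pBatch : ℝ)) * (1 - (P d).ε) ^ 2) ≤ 1 :=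
        div_le_one_of_le₀ (pBatch_le_denom₂ hε (hP.ε_le_one d)) (hD2 d).le
      have h3 : 0 ≤ ((P d).pBatch : ℝ) / (1 - (1 - ((P d).pBatch : ℝ)) * (1 - (P d).ε) ^ 2) := by
        positivity
      have h4 : 0 ≤ 2 - (P d).ε := by linarith [hP.ε_le_one d]
      rw [abs_of_nonneg (by positivity)]
      gcongr
      nlinarith
  -- relaxation of the correlation of the spent error with the momentum
  have uy : TendstoUniformlyOn (fun d τ => Y d τ /
      ((1 - (1 - ((P d).pBatch : ℝ)) * (1 - (P d).ε)) * (P d).signal))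
      (fun τ => (1 - e) * F τ) atTop (Icc δ T) := by
    have hy0 : Tendsto (fun d => corr (θstar d) (μ₀ d) / ((P d).p : ℝ) -
        (P d).drift * (P d).p * (energy (μ₀ d) / ((P d).p : ℝ) ^ 2)) atTop (𝓝 c₀) := by
      simpa using hc.sub (hcp.mul hv)
    refine tendstoUniformlyOn_relaxation_layer hδ hG1 (K := |(1 - e) * (e ^ 2 - 2 * e)| * A)
      (K₀ := |c₀| + 1) (F := fun τ => (1 - e) * F τ)
      (f := fun d τ => S d τ - (P d).drift ^ 2 * (P d).idle ((1 - (P d).ε) ^ 2) * V d τ -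
        ((P d).η * (P d).noise d / (P d).signal) *
        (S d τ + 2 * ((P d).drift * (P d).idle (1 - (P d).ε) * Y d τ) +
        (P d).drift ^ 2 * (P d).idle ((1 - (P d).ε) ^ 2) * V d τ))
      (fun d τ => (((hode d).hasDerivAt_Y τ).div_const _).congr_deriv ?_)
      (fun τ => ((hFderiv τ).const_mul (1 - e)))
      (fun τ hτ => by rw [← mul_assoc, abs_mul]; gcongr; exact hA τ hτ) ?_ ?_
    · have := (hsig d).ne'; have := (hD1 d).ne'
      rw [gap₁_eq (hPb d) (hP.ε_pos d)]
      generalize 1 - (1 - ((P d).pBatch : ℝ)) * (1 - (P d).ε) = D at *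
      field_simp
      ring
    · have hq2 : ∀ᶠ d in atTop, |-(2 * ((P d).η * (P d).noise d / (P d).signal))| ≤
          2 * (e + 1) := by
        filter_upwards [hqb] with d hd
        rw [abs_neg, abs_mul, abs_two]; linarith
      have hq1 : ∀ᶠ d in atTop, |-(1 + (P d).η * (P d).noise d / (P d).signal)| ≤ e + 2 := by
        filter_upwards [hqb] with d hd
        rw [abs_neg]
        refine (abs_add_le _ _).trans ?_
        rw [abs_one]; linarith
      refine (((tendstoUniformlyOn_mul (hq.const_sub 1) us hA).add
        (tendstoUniformlyOn_bdd_mul_zero hq2 ux')).add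
        (tendstoUniformlyOn_bdd_mul_zero hq1 un')).congr
        (Eventually.of_forall fun d τ _ => ?_) |>.congr_right fun τ _ => ?_
      · simp only [Pi.add_apply]; ring
      · simp [F]
    · filter_upwards [hy0.abs.eventually (gt_mem_nhds (lt_add_one _))] with d hd
      refine le_trans ?_ hd.le
      have hp := hP.p_pos d; have hε := hP.ε_pos d
      have hP0 := hPb d; have hD := hD1 d
      have e1 : Y d 0 / ((1 - (1 - ((P d).pBatch : ℝ)) * (1 - (P d).ε)) * (P d).signal) =
          (((P d).pBatch : ℝ) / (1 - (1 - ((P d).pBatch : ℝ)) * (1 - (P d).ε))) *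
          (corr (θstar d) (μ₀ d) / ((P d).p : ℝ) -
            (P d).drift * (P d).p * (energy (μ₀ d) / ((P d).p : ℝ) ^ 2)) := by
        rw [hY0, Params.signal]
        generalize 1 - (1 - ((P d).pBatch : ℝ)) * (1 - (P d).ε) = D at *
        field_simp
      rw [e1, abs_mul]
      refine mul_le_of_le_one_left (abs_nonneg _) ?_
      rw [abs_of_pos (by positivity)]
      refine div_le_one_of_le₀ ?_ hD.le
      have := (P d).pBatch.2.2
      nlinarith
  refine ⟨uv.congr (Eventually.of_forall fun d τ hτ => ?_), ?_⟩
  · beta_reduce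
    rw [(hobs d τ (hsub hτ).1).2.1]
  · have ur := (hrisk T).mono hsub
    have hAδ : ∀ τ ∈ Icc δ T, |F τ| ≤ A := fun τ hτ => hA τ (hsub hτ)
    have hb1 : ∀ᶠ d in atTop, |(1 - (1 - ((P d).pBatch : ℝ)) * (1 - (P d).ε)) /
        ((P d).pBatch + (P d).ε)| ≤ 1 := Eventually.of_forall fun d => by
      have := hPb d; have := hP.ε_pos d
      rw [abs_of_pos (div_pos (hD1 d) (by positivity))]
      exact div_le_one_of_le₀ (denom₁_le (hP.ε_pos d)) (by positivity)
    have hb2 : ∀ᶠ d in atTop, |(P d).drift * (P d).slavedV d /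
        (((P d).pBatch + (P d).ε) * (P d).signal)| ≤ 2 * (e + 1) := by
      filter_upwards [hqb] with d hd
      have hε := hP.ε_pos d; have hη := hP.η_pos d
      have := hsig d; have := hnoise d; have := hD2 d; have hP0 := hPb d
      have hε1 := hP.ε_le_one d
      have h2ε : 0 < 2 - (P d).ε := by linarith
      have e1 : (P d).drift * (P d).slavedV d / (((P d).pBatch + (P d).ε) * (P d).signal) =
          (1 - (P d).ε) / (2 - (P d).ε) * ((1 - (1 - ((P d).pBatch : ℝ)) * (1 - (P d).ε) ^ 2) /
          ((P d).pBatch + (P d).ε)) * ((P d).η * (P d).noise d / (P d).signal) := by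
        rw [Params.slavedV, gap₂_eq hP0 hε hε1, Params.drift]
        generalize 1 - (1 - ((P d).pBatch : ℝ)) * (1 - (P d).ε) ^ 2 = D at *
        field_simp
      rw [e1, abs_mul]
      have h3 : (1 - (P d).ε) / (2 - (P d).ε) ≤ 1 := div_le_one_of_le₀ (by linarith) h2ε.le
      have h4 : (1 - (1 - ((P d).pBatch : ℝ)) * (1 - (P d).ε) ^ 2) / ((P d).pBatch + (P d).ε) ≤ 2 :=
        (div_le_iff₀ (by positivity)).2 (denom₂_le hε hε1)
      have h5 : 0 ≤ (1 - (P d).ε) / (2 - (P d).ε) := div_nonneg (hβ0 d) h2ε.le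
      have h6 : 0 ≤ (1 - (1 - ((P d).pBatch : ℝ)) * (1 - (P d).ε) ^ 2) /
        ((P d).pBatch + (P d).ε) := by positivity
      rw [abs_of_nonneg (mul_nonneg h5 h6)]
      gcongr
      nlinarith
    have hdiff1 : TendstoUniformlyOn (fun d τ => Y d τ /
        ((1 - (1 - ((P d).pBatch : ℝ)) * (1 - (P d).ε)) * (P d).signal) -
        (1 - (P d).η * (P d).noise d / (P d).signal) *
        risk (θstar d) (lawAt (P d) (θstar d) (μ₀ d) (Θ d * τ))) (fun _ => 0) atTop (Icc δ T) :=
      (uy.sub (tendstoUniformlyOn_mul (hq.const_sub 1) ur hAδ)).congr_right fun τ _ => by simp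
    have hdiff2 : TendstoUniformlyOn (fun d τ => V d τ / (P d).slavedV d -
        risk (θstar d) (lawAt (P d) (θstar d) (μ₀ d) (Θ d * τ))) (fun _ => 0) atTop (Icc δ T) :=
      (uv.sub ur).congr_right fun τ _ => by simp
    refine (((tendstoUniformlyOn_bdd_mul_zero hb1 hdiff1).add
      (tendstoUniformlyOn_bdd_mul_zero hb2 hdiff2)).congr
      (Eventually.of_forall fun d τ hτ => ?_)).congr_right fun τ _ => by simp
    simp only [Pi.add_apply]
    rw [(hobs d τ (hsub hτ).1).2.2, slavedC_eq (hPb d) (hP.ε_pos d) (hP.ε_le_one d)]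
    have := (hsig d).ne'; have := (hD1 d).ne'
    have : (P d).slavedV d ≠ 0 :=
      (div_pos (mul_pos (pow_pos (hP.ε_pos d) 2) (hnoise d)) (hg2 d)).ne'
    have : ((P d).pBatch : ℝ) + (P d).ε ≠ 0 := (add_pos (hPb d) (hP.ε_pos d)).ne'
    generalize 1 - (1 - ((P d).pBatch : ℝ)) * (1 - (P d).ε) = D at *
    generalize risk (θstar d) (lawAt (P d) (θstar d) (μ₀ d) (Θ d * τ)) = R at *
    field_simp
    ring

end BelowResonance

/-! ### Power-law asymptotics -/

section PowerLaws

/-- `f d ~ L d^(-α)` as `d → ∞`. -/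
def Scales (f : ℕ → ℝ) (α L : ℝ) : Prop :=
  Tendsto (fun d : ℕ => f d * (d : ℝ) ^ α) atTop (𝓝 L)

variable {f g : ℕ → ℝ} {α β L M : ℝ}

theorem Scales.mul (hf : Scales f α L) (hg : Scales g β M) :
    Scales (fun d => f d * g d) (α + β) (L * M) := by
  refine (Tendsto.mul hf hg).congr' ?_
  filter_upwards [eventually_gt_atTop 0] with d hd
  rw [Real.rpow_add (by exact_mod_cast hd)]
  ring

theorem Scales.div (hf : Scales f α L) (hg : Scales g β M) (hM : M ≠ 0) :
    Scales (fun d => f d / g d) (α - β) (L / M) := by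
  refine (Tendsto.div hf hg hM).congr' ?_
  filter_upwards [eventually_gt_atTop 0] with d hd
  have : (0 : ℝ) < (d : ℝ) ^ β := Real.rpow_pos_of_pos (by exact_mod_cast hd) _
  rw [Real.rpow_sub (by exact_mod_cast hd)]
  simp only [Pi.div_apply]
  field_simp

theorem Scales.tendsto (hf : Scales f 0 L) : Tendsto f atTop (𝓝 L) := by
  simpa [Scales] using hf

theorem Scales.tendsto_zero (hf : Scales f α L) (hα : 0 < α) : Tendsto f atTop (𝓝 0) := by
  have h : Tendsto (fun d : ℕ => (d : ℝ) ^ (-α)) atTop (𝓝 0) :=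
    (tendsto_rpow_neg_atTop hα).comp tendsto_natCast_atTop_atTop
  have h2 := Tendsto.mul hf h
  rw [mul_zero] at h2
  refine h2.congr' ?_
  filter_upwards [eventually_gt_atTop 0] with d hd
  have hd' : (0 : ℝ) < d := by exact_mod_cast hd
  rw [mul_assoc, ← Real.rpow_add hd', add_neg_cancel, Real.rpow_zero, mul_one]

theorem Scales.tendsto_atTop (hf : Scales f α L) (hα : α < 0) (hL : 0 < L) :
    Tendsto f atTop atTop := by
  have h : Tendsto (fun d : ℕ => (d : ℝ) ^ (-α)) atTop atTop :=
    (tendsto_rpow_atTop (neg_pos.2 hα)).comp tendsto_natCast_atTop_atTop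
  refine (h.atTop_mul_pos hL hf).congr' ?_
  filter_upwards [eventually_gt_atTop 0] with d hd
  have hd' : (0 : ℝ) < d := by exact_mod_cast hd
  rw [mul_comm, mul_assoc, ← Real.rpow_add hd', add_neg_cancel, Real.rpow_zero, mul_one]

theorem scales_rpow_mul_const (a K : ℝ) : Scales (fun d => (d : ℝ) ^ a * K) (-a) K := by
  refine tendsto_const_nhds.congr' ?_
  filter_upwards [eventually_gt_atTop 0] with d hd
  have hd' : (0 : ℝ) < d := by exact_mod_cast hd
  rw [mul_right_comm, ← Real.rpow_add hd', add_neg_cancel, Real.rpow_zero, one_mul]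

theorem scales_natCast_add (K : ℝ) : Scales (fun d => (d : ℝ) + K) (-1) 1 := by
  have h : Tendsto (fun d : ℕ => 1 + K / (d : ℝ)) atTop (𝓝 1) := by
    simpa using (tendsto_const_div_atTop_nhds_zero_nat K).const_add 1
  refine h.congr' ?_
  filter_upwards [eventually_gt_atTop 0] with d hd
  have hd' : (d : ℝ) ≠ 0 := by exact_mod_cast hd.ne'
  rw [Real.rpow_neg_one]
  field_simp

theorem Scales.congr_params (hf : Scales f α L) (hα : α = β) (hL : L = M) : Scales f β M :=
  hα ▸ hL ▸ hf

end PowerLaws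

/-! ### The co-scaling limits -/

section CoScalingLimits

variable {κ σ γ pS BS εS ηS : ℝ} {P : ℕ → Params}

theorem CoScaling.admissible (hP : CoScaling κ σ γ pS BS εS ηS P) : Admissible P :=
  ⟨hP.p_pos, hP.B_pos, hP.ε_pos, hP.ε_le_one, hP.η_pos⟩

theorem CoScaling.scales_p (hP : CoScaling κ σ γ pS BS εS ηS P) :
    Scales (fun d => ((P d).p : ℝ)) κ pS := hP.tendsto_p

theorem CoScaling.scales_B (hP : CoScaling κ σ γ pS BS εS ηS P) :
    Scales (fun d => ((P d).B : ℝ)) (-σ) BS := by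
  refine hP.tendsto_B.congr fun d => ?_
  rw [Real.rpow_neg d.cast_nonneg, div_eq_mul_inv]

theorem CoScaling.pS_le_one (hP : CoScaling κ 0 γ pS BS εS ηS P) (hκ : κ = 0) : pS ≤ 1 := by
  subst hκ
  exact le_of_tendsto hP.scales_p.tendsto (Eventually.of_forall fun d => (P d).p.2.2)

theorem CoScaling.PStar_pos (hP : CoScaling κ σ γ pS BS εS ηS P) : 0 < PStar κ σ pS BS := by
  have h := mul_pos hP.pS_pos hP.BS_pos
  unfold PStar
  split_ifs with h1 h2 h3
  · exact one_pos
  · exact h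
  · subst h3
    have h4 := hP.pS_le_one (le_antisymm (not_lt.1 h2) (not_lt.1 h1))
    exact sub_pos.2 (Real.rpow_lt_one (by linarith) (by linarith [hP.pS_pos]) hP.BS_pos)
  · rw [sub_pos, Real.exp_lt_one_iff]
    linarith

/-- `1 - e^(-pB) ≤ P_batch`. -/
theorem one_sub_exp_le_pBatch (P : Params) :
    1 - Real.exp (-((P.p : ℝ) * P.B)) ≤ P.pBatch := by
  rw [pBatch_eq]
  have h1 : (1 - (P.p : ℝ)) ^ P.B ≤ Real.exp (-(P.p : ℝ)) ^ P.B :=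
    pow_le_pow_left₀ (by linarith [P.p.2.2]) (by linarith [Real.add_one_le_exp (-(P.p : ℝ))]) _
  rw [← Real.exp_nat_mul] at h1
  have h2 : (P.B : ℝ) * -(P.p : ℝ) = -((P.p : ℝ) * P.B) := by ring
  rw [h2] at h1
  linarith

theorem pBatch_le_mul (P : Params) : (P.pBatch : ℝ) ≤ P.p * P.B := by
  rw [pBatch_eq]
  have := one_add_mul_le_pow (show (-2 : ℝ) ≤ -(P.p : ℝ) by linarith [P.p.2.2]) P.B
  rw [← sub_eq_add_neg] at this
  linarith

/-- `P_batch ~ P⋆ d^(-κ_eff)`. -/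
theorem CoScaling.scales_pBatch (hP : CoScaling κ σ γ pS BS εS ηS P) :
    Scales (fun d => ((P d).pBatch : ℝ)) (κeff κ σ) (PStar κ σ pS BS) := by
  have hz := hP.scales_p.mul hP.scales_B
  have hz0 : ∀ d, 0 ≤ ((P d).p : ℝ) * (P d).B := fun d => mul_nonneg (P d).p.2.1 (Nat.cast_nonneg _)
  unfold PStar κeff
  split_ifs with h1 h2 h3
  · -- many active samples per batch: `P_batch → 1`
    rw [max_eq_left (by linarith)]
    have h := hz.tendsto_atTop (by linarith) (mul_pos hP.pS_pos hP.BS_pos)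
    have h2 : Tendsto (fun d => 1 - Real.exp (-(((P d).p : ℝ) * (P d).B))) atTop (𝓝 1) := by
      simpa using (Real.tendsto_exp_neg_atTop_nhds_zero.comp h).const_sub 1
    have h3 := tendsto_of_tendsto_of_tendsto_of_le_of_le h2 tendsto_const_nhds
      (fun d => one_sub_exp_le_pBatch (P d)) (fun d => (P d).pBatch.2.2)
    simpa [Scales] using h3
  · -- rare active batches: `pB / (1 + pB) ≤ P_batch ≤ pB`
    rw [max_eq_right (by linarith)]
    rw [← sub_eq_add_neg] at hz
    have h0 := hz.tendsto_zero (by linarith)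
    have hlow : Tendsto (fun d : ℕ => ((P d).p : ℝ) * (P d).B * (d : ℝ) ^ (κ - σ) /
        (1 + (P d).p * (P d).B)) atTop (𝓝 (pS * BS)) := by
      simpa [Pi.div_def] using Tendsto.div hz (h0.const_add 1) (by simp)
    refine tendsto_of_tendsto_of_tendsto_of_le_of_le hlow hz (fun d => ?_) fun d => ?_
    · have h4 : ((P d).p : ℝ) * (P d).B / (1 + (P d).p * (P d).B) ≤ (P d).pBatch := by
        refine le_trans ?_ (one_sub_exp_le_pBatch (P d))
        have h5 := Real.add_one_le_exp (((P d).p : ℝ) * (P d).B)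
        have h6 := hz0 d
        rw [Real.exp_neg]
        have h7 := inv_anti₀ (by positivity) h5
        have h8 : ((P d).p : ℝ) * (P d).B / (1 + (P d).p * (P d).B) =
            1 - (((P d).p : ℝ) * (P d).B + 1)⁻¹ := by
          field_simp
          ring
        linarith
      simp only [mul_div_right_comm _ ((d : ℝ) ^ (κ - σ))]
      exact mul_le_mul_of_nonneg_right h4 (by positivity)
    · beta_reduce
      gcongr
      exact pBatch_le_mul (P d)
  · -- bounded sparsity and batch size
    subst h3
    obtain rfl : κ = 0 := le_antisymm (not_lt.1 h2) (not_lt.1 h1)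
    have hp := hP.scales_p.tendsto
    have hB := hP.scales_B
    rw [neg_zero] at hB
    have h := ((hp.const_sub 1).rpow hB.tendsto (Or.inr hP.BS_pos)).const_sub 1
    simpa [Scales, pBatch_eq] using h
  · -- Poisson regime: `e^(-pB / (1 - p)) ≤ (1 - p)^B ≤ e^(-pB)`
    obtain rfl : κ = σ := le_antisymm (not_lt.1 h2) (not_lt.1 h1)
    have hκ : 0 < κ := lt_of_le_of_ne hP.κ_nonneg (Ne.symm h3)
    rw [sub_self, max_self]
    rw [add_neg_cancel] at hz
    have hp := hP.scales_p.tendsto_zero hκ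
    have hlow : Tendsto (fun d => 1 - Real.exp (-(((P d).p : ℝ) * (P d).B))) atTop
        (𝓝 (1 - Real.exp (-(pS * BS)))) :=
      ((Real.continuous_exp.tendsto _).comp hz.tendsto.neg).const_sub 1
    have hup : Tendsto (fun d => 1 - Real.exp (-(((P d).p : ℝ) * (P d).B / (1 - (P d).p)))) atTop
        (𝓝 (1 - Real.exp (-(pS * BS)))) := by
      have h := hz.tendsto.div (hp.const_sub 1) (by simp)
      rw [sub_zero, div_one] at h
      exact ((Real.continuous_exp.tendsto _).comp h.neg).const_sub 1
    have h := tendsto_of_tendsto_of_tendsto_of_le_of_le' (f := fun d => ((P d).pBatch : ℝ))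
      hlow hup (Eventually.of_forall fun d => one_sub_exp_le_pBatch (P d)) (by
        filter_upwards [hp.eventually (gt_mem_nhds zero_lt_one)] with d hd
        have hd' : 0 < 1 - ((P d).p : ℝ) := by linarith
        rw [pBatch_eq]
        have h4 : (1 - ((P d).p : ℝ))⁻¹ ≤ Real.exp ((P d).p / (1 - (P d).p)) := by
          refine le_trans (le_of_eq ?_) (Real.add_one_le_exp _)
          field_simp
          ring
        have h5 : Real.exp (-((P d).p / (1 - (P d).p) : ℝ)) ≤ 1 - (P d).p := by
          rw [Real.exp_neg]
          exact inv_le_of_inv_le₀ hd' h4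
        have h6 := pow_le_pow_left₀ (Real.exp_pos _).le h5 (P d).B
        rw [← Real.exp_nat_mul] at h6
        have h7 : ((P d).B : ℝ) * -((P d).p / (1 - (P d).p)) =
            -(((P d).p : ℝ) * (P d).B / (1 - (P d).p)) := by ring
        rw [h7] at h6
        linarith)
    simpa [Scales] using h

theorem noise_eq {P : Params} (hB : 0 < P.B) (d : ℕ) :
    P.noise d = P.signal * (((d : ℝ) + 2) / P.B + P.p * (((P.B : ℝ) - 1) / P.B)) := by
  have : (P.B : ℝ) ≠ 0 := by exact_mod_cast hB.ne'
  unfold Params.noise Params.signal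
  field_simp

theorem abs_natCast_sub_one_div_le (n : ℕ) : |((n : ℝ) - 1) / n| ≤ 1 := by
  rcases n.eq_zero_or_pos with rfl | hn
  · simp
  have h : (1 : ℝ) ≤ n := by exact_mod_cast hn
  rw [abs_of_nonneg (div_nonneg (by linarith) (by linarith))]
  exact div_le_one_of_le₀ (by linarith) (by linarith)

/-- The scaling limits below resonance. -/
theorem CoScaling.below_limits (hP : CoScaling κ σ γ pS BS εS ηS P) (hγ : γ < 1 - σ + κ) :
    Tendsto (fun d : ℕ => (P d).η * d / (P d).B) atTop (𝓝 (ηS / BS)) ∧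
    Tendsto (fun d : ℕ => (d : ℝ) ^ (1 - σ + κ - κeff κ σ) * (PStar κ σ pS BS / (pS * BS)) *
      ((P d).η * (P d).signal)) atTop (𝓝 (ηS / BS)) ∧
    Tendsto (fun d => (P d).η * (P d).noise d / (P d).signal) atTop (𝓝 (ηS / BS)) ∧
    Tendsto (fun d => (P d).η * (P d).p / (P d).ε) atTop (𝓝 0) ∧
    Tendsto (fun d => (P d).η * (P d).signal) atTop (𝓝 0) := by
  have hη : Scales (fun d => (P d).η) (1 - σ) ηS := by
    have h := hP.tendsto_η
    rwa [max_eq_right (by linarith)] at h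
  have hγ0 := hP.γ_nonneg
  have hPS := hP.PStar_pos
  have hpS := hP.pS_pos
  have hBS := hP.BS_pos
  have hh := hη.mul (hP.scales_p.div hP.scales_pBatch hPS.ne')
  have hηB : ∀ K : ℝ, Tendsto (fun d : ℕ => (P d).η * ((d : ℝ) + K) / (P d).B) atTop
      (𝓝 (ηS / BS)) := fun K => (((hη.mul (scales_natCast_add K)).div hP.scales_B
        hBS.ne').congr_params (by ring) (by rw [mul_one])).tendsto
  refine ⟨by simpa using hηB 0, ?_, ?_, ?_, ?_⟩
  · exact (((scales_rpow_mul_const (1 - σ + κ - κeff κ σ) (PStar κ σ pS BS / (pS * BS))).mul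
      hh).congr_params (by ring) (by field_simp)).tendsto
  · have h1 : Tendsto (fun d => (P d).η * (P d).p * ((((P d).B : ℝ) - 1) / (P d).B)) atTop
        (𝓝 0) :=
      ((hη.mul hP.scales_p).tendsto_zero (by linarith)).zero_mul_isBoundedUnder_le
        (isBoundedUnder_of ⟨1, fun d => abs_natCast_sub_one_div_le (P d).B⟩)
    have h2 := (hηB 2).add h1
    rw [add_zero] at h2
    refine h2.congr fun d => ?_
    have := (signal_pos (hP.p_pos d) (hP.B_pos d)).ne'
    rw [noise_eq (hP.B_pos d)]
    field_simp
  · exact ((hη.mul hP.scales_p).div hP.tendsto_ε hP.εS_pos.ne').tendsto_zero (by linarith)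
  · refine hh.tendsto_zero ?_
    unfold κeff
    rcases max_cases 0 (κ - σ) with h | h <;> linarith

/-- The scaling limits on and above the resonance line. -/
theorem CoScaling.above_limits (hP : CoScaling κ σ γ pS BS εS ηS P) (hγ : 1 - σ + κ ≤ γ)
    (hγ0 : 0 < γ) :
    Tendsto (fun d => (P d).η * (P d).p / (P d).ε) atTop (𝓝 (ηS * pS / εS)) ∧
    Tendsto (fun d : ℕ => (d : ℝ) ^ (γ - κeff κ σ) * (PStar κ σ pS BS / εS) *
      ((P d).ε / (P d).pBatch)) atTop (𝓝 1) ∧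
    Tendsto (fun d => (P d).ε) atTop (𝓝 0) ∧
    Tendsto (fun d => (P d).ε / (P d).pBatch) atTop (𝓝 0) ∧
    Tendsto (fun d : ℕ => (P d).ε * ((P d).noise d / ((P d).signal * (P d).p))) atTop
      (𝓝 (if γ = 1 - σ + κ then εS / (pS * BS) else 0)) := by
  have hη : Scales (fun d => (P d).η) (γ - κ) ηS := by
    have h := hP.tendsto_η
    rwa [max_eq_left (by linarith)] at h
  have hε : Scales (fun d => (P d).ε) γ εS := hP.tendsto_ε
  have hPS := hP.PStar_pos
  have hpS := hP.pS_pos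
  have hBS := hP.BS_pos
  have hεS := hP.εS_pos
  have hεP := hε.div hP.scales_pBatch hPS.ne'
  refine ⟨?_, ?_, hε.tendsto_zero hγ0, ?_, ?_⟩
  · exact (((hη.mul hP.scales_p).div hε hεS.ne').congr_params (by ring) rfl).tendsto
  · exact (((scales_rpow_mul_const (γ - κeff κ σ) (PStar κ σ pS BS / εS)).mul
      hεP).congr_params (by ring) (by field_simp)).tendsto
  · refine hεP.tendsto_zero ?_
    unfold κeff
    rcases max_cases 0 (κ - σ) with h | h <;> linarith
  · have h1 : Tendsto (fun d => (P d).ε * ((((P d).B : ℝ) - 1) / (P d).B)) atTop (𝓝 0) :=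
      (hε.tendsto_zero hγ0).zero_mul_isBoundedUnder_le
        (isBoundedUnder_of ⟨1, fun d => abs_natCast_sub_one_div_le (P d).B⟩)
    have h2 := (hε.mul (scales_natCast_add 2)).div (hP.scales_p.mul hP.scales_B)
      (mul_pos hpS hBS).ne'
    have h3 : Tendsto (fun d : ℕ => (P d).ε * ((d : ℝ) + 2) / ((P d).p * (P d).B)) atTop
        (𝓝 (if γ = 1 - σ + κ then εS / (pS * BS) else 0)) := by
      split_ifs with h
      · exact (h2.congr_params (by rw [h]; ring) (by rw [mul_one])).tendsto
      · have : 1 - σ + κ < γ := lt_of_le_of_ne hγ (Ne.symm h)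
        exact h2.tendsto_zero (by linarith)
    have h4 := h3.add h1
    rw [add_zero] at h4
    refine h4.congr fun d => ?_
    have := (signal_pos (hP.p_pos d) (hP.B_pos d)).ne'
    have := (hP.p_pos d).ne'
    have : ((P d).B : ℝ) ≠ 0 := by exact_mod_cast (hP.B_pos d).ne'
    rw [noise_eq (hP.B_pos d)]
    field_simp

end CoScalingLimits

/-! ### The limiting moment system -/

section MomentFlow

open scoped Matrix

/-- The coefficient matrix of the limiting moment system in the variables `(R, V, C)`. -/
def momentMatrix (ηbar ζ : ℝ) : Matrix (Fin 3) (Fin 3) ℝ :=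
  !![0, 0, -2 * ηbar; ζ, -2, 2; 1, -ηbar, -1]

variable {ηbar ζ : ℝ}

theorem hasDerivAt_momentFlow (u : Fin 3 → ℝ) (τ : ℝ) :
    HasDerivAt (fun τ => linearFlow (momentMatrix ηbar ζ) u τ 0)
      (-2 * ηbar * linearFlow (momentMatrix ηbar ζ) u τ 2) τ ∧
    HasDerivAt (fun τ => linearFlow (momentMatrix ηbar ζ) u τ 1)
      (2 * linearFlow (momentMatrix ηbar ζ) u τ 2 - 2 * linearFlow (momentMatrix ηbar ζ) u τ 1 +
        ζ * linearFlow (momentMatrix ηbar ζ) u τ 0) τ ∧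
    HasDerivAt (fun τ => linearFlow (momentMatrix ηbar ζ) u τ 2)
      (linearFlow (momentMatrix ηbar ζ) u τ 0 - ηbar * linearFlow (momentMatrix ηbar ζ) u τ 1 -
        linearFlow (momentMatrix ηbar ζ) u τ 2) τ := by
  have h := hasDerivAt_pi.1 (hasDerivAt_linearFlow (momentMatrix ηbar ζ) u τ)
  generalize hw : linearFlow (momentMatrix ηbar ζ) u τ = w at h ⊢
  refine ⟨(h 0).congr_deriv ?_, (h 1).congr_deriv ?_, (h 2).congr_deriv ?_⟩ <;>
  · simp [momentMatrix, Matrix.mulVec, dotProduct, Fin.sum_univ_three]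
    try ring

theorem isMomentFlow_linearFlow (u : Fin 3 → ℝ) :
    IsMomentFlow ηbar ζ (fun τ => linearFlow (momentMatrix ηbar ζ) u τ 0)
      (fun τ => linearFlow (momentMatrix ηbar ζ) u τ 1)
      (fun τ => linearFlow (momentMatrix ηbar ζ) u τ 2) := fun τ _ =>
  ⟨(hasDerivAt_momentFlow u τ).1.hasDerivWithinAt, (hasDerivAt_momentFlow u τ).2.1.hasDerivWithinAt,
    (hasDerivAt_momentFlow u τ).2.2.hasDerivWithinAt⟩

/-- The moment system has a unique solution, given by the matrix exponential. -/
theorem eq_momentFlow {R V C : ℝ → ℝ} (hR : ∀ τ, HasDerivAt R (-2 * ηbar * C τ) τ)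
    (hV : ∀ τ, HasDerivAt V (2 * C τ - 2 * V τ + ζ * R τ) τ)
    (hC : ∀ τ, HasDerivAt C (R τ - ηbar * V τ - C τ) τ) (τ : ℝ) :
    ![R τ, V τ, C τ] = linearFlow (momentMatrix ηbar ζ) ![R 0, V 0, C 0] τ := by
  refine eq_linearFlow (w := fun τ => ![R τ, V τ, C τ]) (fun τ => hasDerivAt_pi.2 fun i => ?_) τ
  fin_cases i
  · exact (hR τ).congr_deriv (by
      simp [momentMatrix, Matrix.mulVec, dotProduct, Fin.sum_univ_three])
  · exact (hV τ).congr_deriv (by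
      simp [momentMatrix, Matrix.mulVec, dotProduct, Fin.sum_univ_three]; ring)
  · exact (hC τ).congr_deriv (by
      simp [momentMatrix, Matrix.mulVec, dotProduct, Fin.sum_univ_three]; ring)

/-- Without noise the moment system contains the deterministic heavy-ball dynamics. -/
theorem exists_heavyBallFlow (ηbar x₀ y₀ : ℝ) :
    ∃ x y : ℝ → ℝ, IsHeavyBallFlow ηbar x y ∧ x 0 = x₀ ∧ y 0 = y₀ ∧
      ∀ τ, linearFlow (momentMatrix ηbar 0) ![x₀ ^ 2, y₀ ^ 2, x₀ * y₀] τ =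
        ![x τ ^ 2, y τ ^ 2, x τ * y τ] := by
  set w : ℝ → Fin 2 → ℝ := linearFlow !![0, -ηbar; 1, -1] ![x₀, y₀] with hw
  have h0 : w 0 = ![x₀, y₀] := linearFlow_zero _ _
  have h := fun τ => hasDerivAt_pi.1 (hasDerivAt_linearFlow !![0, -ηbar; 1, -1] ![x₀, y₀] τ)
  rw [← hw] at h
  have hx : ∀ τ, HasDerivAt (fun τ => w τ 0) (-ηbar * w τ 1) τ := fun τ =>
    (h τ 0).congr_deriv (by simp [Matrix.mulVec, dotProduct])
  have hy : ∀ τ, HasDerivAt (fun τ => w τ 1) (w τ 0 - w τ 1) τ := fun τ =>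
    (h τ 1).congr_deriv (by simp [Matrix.mulVec, dotProduct]; ring)
  refine ⟨fun τ => w τ 0, fun τ => w τ 1,
    fun τ _ => ⟨(hx τ).hasDerivWithinAt, (hy τ).hasDerivWithinAt⟩, by simp [h0], by simp [h0],
    fun τ => ?_⟩
  have := eq_momentFlow (ηbar := ηbar) (ζ := 0) (R := fun τ => w τ 0 ^ 2)
    (V := fun τ => w τ 1 ^ 2) (C := fun τ => w τ 0 * w τ 1)
    (fun τ => ((hx τ).fun_pow 2).congr_deriv (by simp; ring))
    (fun τ => ((hy τ).fun_pow 2).congr_deriv (by simp; ring))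
    (fun τ => ((hx τ).fun_mul (hy τ)).congr_deriv (by ring)) τ
  rw [this]
  simp [h0]

/-- With noise the moment system is irreducibly three-dimensional. A solution on the cone
`R V = C²` satisfies `0 = (R V - C²)' = ζ R²`. In the solution that starts at
`(R, V, C) = (0, 1, 0)` one has `R = R' = 0` but `R'' = 2 η̄²` at time zero, which no
relation `R'' = a₁ R' + a₀ R` allows. -/
theorem irreducibleMomentFlow (hη : ηbar ≠ 0) (hζ : ζ ≠ 0) : IrreducibleMomentFlow ηbar ζ := by
  constructor
  · intro x y h
    have hx : ∀ τ ∈ Ici (0 : ℝ), x τ = 0 := by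
      intro τ hτ
      obtain ⟨hR, hV, hC⟩ := h τ hτ
      have h1 := (hR.fun_mul hV).fun_sub (hC.fun_pow 2)
      have h2 : (fun τ => x τ ^ 2 * y τ ^ 2 - (x τ * y τ) ^ 2) = fun _ => 0 := by
        funext τ; ring
      rw [h2] at h1
      have h3 := (uniqueDiffOn_Ici (0 : ℝ) τ hτ).eq_deriv _ h1 (hasDerivWithinAt_const τ _ (0 : ℝ))
      have h4 : ζ * (x τ ^ 2) ^ 2 = 0 := by
        rw [← h3]; push_cast; ring
      simpa [hζ] using h4
    intro τ hτ
    refine ⟨hx τ hτ, ?_⟩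
    obtain ⟨-, -, hC⟩ := h τ hτ
    have h1 : HasDerivWithinAt (fun τ => x τ * y τ) 0 (Ici 0) τ :=
      (hasDerivWithinAt_const τ _ (0 : ℝ)).congr (fun s hs => by simp [hx s hs])
        (by simp [hx τ hτ])
    have h2 := (uniqueDiffOn_Ici (0 : ℝ) τ hτ).eq_deriv _ hC h1
    simpa [hx τ hτ, hη] using h2
  · intro a₀ a₁
    set w := linearFlow (momentMatrix ηbar ζ) ![0, 1, 0] with hw
    have hw0 : w 0 = ![0, 1, 0] := linearFlow_zero _ _
    refine ⟨fun τ => w τ 0, fun τ => w τ 1, fun τ => w τ 2, fun τ => -2 * ηbar * w τ 2,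
      fun τ => -2 * ηbar * (w τ 0 - ηbar * w τ 1 - w τ 2), isMomentFlow_linearFlow _,
      fun τ _ => ⟨(hasDerivAt_momentFlow _ τ).1.hasDerivWithinAt,
        ((hasDerivAt_momentFlow _ τ).2.2.const_mul _).hasDerivWithinAt⟩, 0, self_mem_Ici, ?_⟩
    simp [hw0, hη]

end MomentFlow

/-! ### On and above the resonance line -/

section Resonance

open scoped Matrix

/-- The coefficient matrix of the equations for the balanced moments `(S, Y / p, V / p²)` in a time
unit of `Θ` active updates, in terms of `H = Θ η 𝓑₁`, `K = Θ η² 𝓑₂`, the idle averages `E₁`, `E₂`,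
the balanced drift `c`, the damping rates `G₁`, `G₂`, the rate `a = Θ ε / P_batch`, the noise
intensities `l`, `z` of the last two components, and the momentum decay `β`. -/
def balancedMatrix (H K E₁ E₂ c G₁ G₂ a l z β : ℝ) : Matrix (Fin 3) (Fin 3) ℝ :=
  !![-2 * H + K, -2 * H * (c * E₁) + 2 * K * (c * E₁), K * (c ^ 2 * E₂);
    a - l, -G₁ - 2 * l * (c * E₁), -a * (c ^ 2 * E₂) - l * (c ^ 2 * E₂);
    z, 2 * β * a * E₁ + 2 * z * (c * E₁), -G₂ + 2 * β * a * (c * E₂) + z * (c ^ 2 * E₂)]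

theorem tendsto_balancedMatrix {H K E₁ E₂ c G₁ G₂ a l z β : ℕ → ℝ}
    {H' K' E₁' E₂' c' G₁' G₂' a' l' z' β' : ℝ} (hH : Tendsto H atTop (𝓝 H'))
    (hK : Tendsto K atTop (𝓝 K')) (hE₁ : Tendsto E₁ atTop (𝓝 E₁'))
    (hE₂ : Tendsto E₂ atTop (𝓝 E₂')) (hc : Tendsto c atTop (𝓝 c'))
    (hG₁ : Tendsto G₁ atTop (𝓝 G₁')) (hG₂ : Tendsto G₂ atTop (𝓝 G₂'))
    (ha : Tendsto a atTop (𝓝 a')) (hl : Tendsto l atTop (𝓝 l')) (hz : Tendsto z atTop (𝓝 z'))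
    (hβ : Tendsto β atTop (𝓝 β')) :
    Tendsto (fun d => balancedMatrix (H d) (K d) (E₁ d) (E₂ d) (c d) (G₁ d) (G₂ d) (a d) (l d)
      (z d) (β d)) atTop (𝓝 (balancedMatrix H' K' E₁' E₂' c' G₁' G₂' a' l' z' β')) := by
  have hcE₁ := hc.mul hE₁
  have hcE₂ := hc.mul hE₂
  have hccE₂ := (hc.pow 2).mul hE₂
  refine tendsto_pi_nhds.2 fun i => tendsto_pi_nhds.2 fun j => ?_
  fin_cases i <;> fin_cases j
  · exact (hH.const_mul (-2)).add hK
  · exact ((hH.const_mul (-2)).mul hcE₁).add ((hK.const_mul 2).mul hcE₁)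
  · exact hK.mul hccE₂
  · exact ha.sub hl
  · exact hG₁.neg.sub ((hl.const_mul 2).mul hcE₁)
  · exact (ha.neg.mul hccE₂).sub (hl.mul hccE₂)
  · exact hz
  · exact (((hβ.const_mul 2).mul ha).mul hE₁).add ((hz.const_mul 2).mul hcE₁)
  · exact (hG₂.neg.add (((hβ.const_mul 2).mul ha).mul hcE₂)).add (hz.mul hccE₂)

/-- The balanced moments solve the linear system of `balancedMatrix`. -/
theorem IsMomentTrajectory.eq_linearFlow {P : Params} {d : ℕ} {Θ : ℝ} {S Y V : ℝ → ℝ}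
    (h : IsMomentTrajectory P d Θ S Y V) (hp : 0 < (P.p : ℝ)) (hB : 0 < P.B) (hη : 0 < P.η)
    (τ : ℝ) :
    ![S τ, Y τ / P.p, V τ / (P.p : ℝ) ^ 2] =
      linearFlow (balancedMatrix (Θ * (P.η * P.signal)) (Θ * (P.η ^ 2 * P.noise d))
        (P.idle (1 - P.ε)) (P.idle ((1 - P.ε) ^ 2)) (P.drift * P.p) (Θ * P.gap₁) (Θ * P.gap₂)
        (Θ * (P.ε / P.pBatch)) (Θ * (P.η * P.ε * P.noise d / P.p))
        (Θ * (P.ε ^ 2 * P.noise d / (P.p : ℝ) ^ 2)) (1 - P.ε))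
        ![S 0, Y 0 / P.p, V 0 / (P.p : ℝ) ^ 2] τ := by
  have hPb := pBatch_pos hp hB
  refine SparseMomentum.eq_linearFlow (w := fun τ => ![S τ, Y τ / P.p, V τ / (P.p : ℝ) ^ 2])
    (fun τ => hasDerivAt_pi.2 fun i => ?_) τ
  fin_cases i
  · refine (h.hasDerivAt_S τ).congr_deriv ?_
    simp [balancedMatrix, Matrix.mulVec, dotProduct, Fin.sum_univ_three]
    field_simp
    ring
  · refine ((h.hasDerivAt_Y τ).div_const _).congr_deriv ?_
    simp [balancedMatrix, Matrix.mulVec, dotProduct, Fin.sum_univ_three, Params.signal]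
    field_simp
    ring
  · refine ((h.hasDerivAt_V τ).div_const _).congr_deriv ?_
    simp [balancedMatrix, Matrix.mulVec, dotProduct, Fin.sum_univ_three, Params.signal]
    field_simp
    ring

theorem tendsto_idle {P : ℕ → Params} (hP : Admissible P)
    (hε : Tendsto (fun d => (P d).ε) atTop (𝓝 0))
    (hεP : Tendsto (fun d => (P d).ε / (P d).pBatch) atTop (𝓝 0)) :
    Tendsto (fun d => (P d).idle (1 - (P d).ε)) atTop (𝓝 1) ∧
    Tendsto (fun d => (P d).idle ((1 - (P d).ε) ^ 2)) atTop (𝓝 1) := by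
  constructor
  · have h := ((hεP.const_add 1).sub hε).inv₀ (by simp)
    simp only [add_zero, sub_zero, inv_one] at h
    refine h.congr fun d => ?_
    have := (pBatch_pos (hP.p_pos d) (hP.B_pos d)).ne'
    unfold Params.idle
    rw [inv_eq_one_div]
    rw [show 1 + (P d).ε / ((P d).pBatch : ℝ) - (P d).ε =
      (1 - (1 - ((P d).pBatch : ℝ)) * (1 - (P d).ε)) / (P d).pBatch by field_simp; ring]
    rw [one_div_div]
  · have h := (((hεP.sub hε).mul (hε.const_sub 2)).const_add 1).inv₀ (by simp)
    simp only [sub_zero, zero_mul, add_zero, inv_one] at h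
    refine h.congr fun d => ?_
    have := (pBatch_pos (hP.p_pos d) (hP.B_pos d)).ne'
    unfold Params.idle
    rw [inv_eq_one_div]
    rw [show 1 + ((P d).ε / ((P d).pBatch : ℝ) - (P d).ε) * (2 - (P d).ε) =
      (1 - (1 - ((P d).pBatch : ℝ)) * (1 - (P d).ε) ^ 2) / (P d).pBatch by field_simp; ring]
    rw [one_div_div]

/-- Convergence on and above resonance. The parameter `ζ` is the limit of
`ε 𝓑₂ / (𝓑₁ p)`, the intensity of the gradient noise that survives the averaging by the momentum. -/
theorem balancedConvergence {P : ℕ → Params} (hP : Admissible P) {Θ : ℕ → ℝ}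
    {ηbar ζ r₀ v₀ c₀ : ℝ} (hΘ : ∀ d, 0 ≤ Θ d)
    (hρ : Tendsto (fun d => (P d).η * (P d).p / (P d).ε) atTop (𝓝 ηbar))
    (ha : Tendsto (fun d => Θ d * ((P d).ε / (P d).pBatch)) atTop (𝓝 1))
    (hε : Tendsto (fun d => (P d).ε) atTop (𝓝 0))
    (hεP : Tendsto (fun d => (P d).ε / (P d).pBatch) atTop (𝓝 0))
    (hζ : Tendsto (fun d => (P d).ε * ((P d).noise d / ((P d).signal * (P d).p))) atTop (𝓝 ζ))
    {θstar : ∀ d, Vec d} {μ₀ : ∀ d, Measure (State d)}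
    (hprob : ∀ d, IsProbabilityMeasure (μ₀ d))
    (hθ : ∀ d, MemLp (fun z : State d => z.1) 2 (μ₀ d))
    (hm : ∀ d, MemLp (fun z : State d => z.2) 2 (μ₀ d))
    (hr : Tendsto (fun d => risk (θstar d) (μ₀ d)) atTop (𝓝 r₀))
    (hv : Tendsto (fun d => energy (μ₀ d) / ((P d).p : ℝ) ^ 2) atTop (𝓝 v₀))
    (hc : Tendsto (fun d => corr (θstar d) (μ₀ d) / ((P d).p : ℝ)) atTop (𝓝 c₀)) :
    BalancedConvergence P θstar (fun d τ => lawAt (P d) (θstar d) (μ₀ d) (Θ d * τ))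
      (fun τ => linearFlow (momentMatrix ηbar ζ) ![r₀, v₀, c₀] τ 0)
      (fun τ => linearFlow (momentMatrix ηbar ζ) ![r₀, v₀, c₀] τ 1)
      (fun τ => linearFlow (momentMatrix ηbar ζ) ![r₀, v₀, c₀] τ 2) := by
  choose S Y V hode hS0 hY0 hV0 hobs using fun d =>
    exists_isMomentTrajectory (θstar := θstar d) (μ := μ₀ d) (hP.p_pos d) (hP.B_pos d)
      (hP.ε_pos d) (hP.ε_le_one d) (hθ d) (hm d) (hΘ d)
  have hPb : ∀ d, 0 < ((P d).pBatch : ℝ) := fun d => pBatch_pos (hP.p_pos d) (hP.B_pos d)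
  obtain ⟨hE1, hE2⟩ := tendsto_idle hP hε hεP
  have hβ : Tendsto (fun d => 1 - (P d).ε) atTop (𝓝 1) := by simpa using hε.const_sub 1
  have hcp : Tendsto (fun d => (P d).drift * (P d).p) atTop (𝓝 ηbar) := by
    have h := hβ.mul hρ
    rw [one_mul] at h
    refine h.congr fun d => ?_
    unfold Params.drift
    ring
  have hH : Tendsto (fun d => Θ d * ((P d).η * (P d).signal)) atTop (𝓝 ηbar) := by
    have h := ha.mul hρ
    rw [one_mul] at h
    refine h.congr fun d => ?_
    have := (hP.ε_pos d).ne'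
    unfold Params.signal
    field_simp
  have hz : Tendsto (fun d => Θ d * ((P d).ε ^ 2 * (P d).noise d / ((P d).p : ℝ) ^ 2)) atTop
      (𝓝 ζ) := by
    have h := ha.mul hζ
    rw [one_mul] at h
    refine h.congr fun d => ?_
    have := (hPb d).ne'; have := (hP.p_pos d).ne'
    unfold Params.signal
    field_simp
  have hl : Tendsto (fun d => Θ d * ((P d).η * (P d).ε * (P d).noise d / (P d).p)) atTop
      (𝓝 (ηbar * ζ)) := by
    refine (hρ.mul hz).congr fun d => ?_
    have := (hP.ε_pos d).ne'; have := (hP.p_pos d).ne'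
    field_simp
  have hK : Tendsto (fun d => Θ d * ((P d).η ^ 2 * (P d).noise d)) atTop
      (𝓝 (ηbar ^ 2 * ζ)) := by
    refine ((hρ.pow 2).mul hz).congr fun d => ?_
    have := (hP.ε_pos d).ne'; have := (hP.p_pos d).ne'
    field_simp
  have hG1 : Tendsto (fun d => Θ d * (P d).gap₁) atTop (𝓝 1) := by
    have h := ha.mul hE1
    rw [one_mul] at h
    refine h.congr fun d => ?_
    have := (hPb d).ne'
    rw [gap₁_eq (hPb d) (hP.ε_pos d)]
    unfold Params.idle
    field_simp
  have hG2 : Tendsto (fun d => Θ d * (P d).gap₂) atTop (𝓝 2) := by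
    have h := (ha.mul hE2).mul (hε.const_sub 2)
    rw [one_mul, one_mul, sub_zero] at h
    refine h.congr fun d => ?_
    have := (hPb d).ne'
    rw [gap₂_eq (hPb d) (hP.ε_pos d) (hP.ε_le_one d)]
    unfold Params.idle
    field_simp
  have hL := tendsto_balancedMatrix hH hK hE1 hE2 hcp hG1 hG2 ha hl hz hβ
  have hu : Tendsto (fun d => ![S d 0, Y d 0 / (P d).p, V d 0 / ((P d).p : ℝ) ^ 2]) atTop
      (𝓝 ![r₀ - 2 * ηbar * c₀ + ηbar ^ 2 * v₀, c₀ - ηbar * v₀, v₀]) := by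
    rw [tendsto_pi_nhds]
    intro i
    fin_cases i
    · refine ((hr.sub ((hcp.const_mul 2).mul hc)).add ((hcp.pow 2).mul hv)).congr fun d => ?_
      have := (hP.p_pos d).ne'
      simp only [Fin.zero_eta, Matrix.cons_val_zero, hS0]
      field_simp
    · refine (hc.sub (hcp.mul hv)).congr fun d => ?_
      have := (hP.p_pos d).ne'
      simp only [Fin.mk_one, Matrix.cons_val_one, Matrix.cons_val_zero, hY0]
      field_simp
    · simpa [hV0] using hv
  -- the limit, read off in the variables `(R, V, C)`
  set L := balancedMatrix ηbar (ηbar ^ 2 * ζ) 1 1 ηbar 1 2 1 (ηbar * ζ) ζ 1 with hLdef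
  set u : Fin 3 → ℝ := ![r₀ - 2 * ηbar * c₀ + ηbar ^ 2 * v₀, c₀ - ηbar * v₀, v₀] with hudef
  have hlim : ∀ τ, ![![1, 2 * ηbar, ηbar ^ 2] ⬝ᵥ linearFlow L u τ, ![0, 0, 1] ⬝ᵥ linearFlow L u τ,
      ![0, 1, ηbar] ⬝ᵥ linearFlow L u τ] = linearFlow (momentMatrix ηbar ζ) ![r₀, v₀, c₀] τ := by
    have hd := fun τ => hasDerivAt_pi.1 (hasDerivAt_linearFlow L u τ)
    intro τ
    simp only [dotProduct, Fin.sum_univ_three, Matrix.cons_val_zero, Matrix.cons_val_one,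
      Matrix.cons_val]
    rw [eq_momentFlow (ηbar := ηbar) (ζ := ζ)
      (R := fun τ => 1 * linearFlow L u τ 0 + 2 * ηbar * linearFlow L u τ 1 +
        ηbar ^ 2 * linearFlow L u τ 2)
      (V := fun τ => 0 * linearFlow L u τ 0 + 0 * linearFlow L u τ 1 + 1 * linearFlow L u τ 2)
      (C := fun τ => 0 * linearFlow L u τ 0 + 1 * linearFlow L u τ 1 + ηbar * linearFlow L u τ 2)
      (fun τ => ((((hd τ 0).const_mul _).fun_add ((hd τ 1).const_mul _)).fun_add
        ((hd τ 2).const_mul _)).congr_deriv ?_)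
      (fun τ => ((((hd τ 0).const_mul _).fun_add ((hd τ 1).const_mul _)).fun_add
        ((hd τ 2).const_mul _)).congr_deriv ?_)
      (fun τ => ((((hd τ 0).const_mul _).fun_add ((hd τ 1).const_mul _)).fun_add
        ((hd τ 2).const_mul _)).congr_deriv ?_) τ]
    · congr 1
      ext i
      fin_cases i
      · simp [linearFlow_zero, hudef]; ring
      · simp [linearFlow_zero, hudef]
      · simp [linearFlow_zero, hudef]
    all_goals
      generalize linearFlow L u τ = w
      simp [hLdef, balancedMatrix, Matrix.mulVec, dotProduct, Fin.sum_univ_three]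
      ring
  have hconv : ∀ {b : ℕ → Fin 3 → ℝ} {b' : Fin 3 → ℝ}, Tendsto b atTop (𝓝 b') → ∀ T : ℝ,
      TendstoUniformlyOn (fun d τ => b d ⬝ᵥ ![S d τ, Y d τ / (P d).p, V d τ / ((P d).p : ℝ) ^ 2])
        (fun τ => b' ⬝ᵥ linearFlow L u τ) atTop (Icc 0 T) := fun {b b'} hb T =>
    (tendstoUniformlyOn_linearFlow hL hu hb T).congr (Eventually.of_forall fun d τ _ => by
      beta_reduce
      rw [(hode d).eq_linearFlow (hP.p_pos d) (hP.B_pos d) (hP.η_pos d) τ])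
  have hb0 : Tendsto (fun d => ![1, 2 * ((P d).drift * (P d).p), ((P d).drift * (P d).p) ^ 2])
      atTop (𝓝 ![1, 2 * ηbar, ηbar ^ 2]) := by
    rw [tendsto_pi_nhds]
    intro i
    fin_cases i
    · exact tendsto_const_nhds
    · exact hcp.const_mul 2
    · exact hcp.pow 2
  have hb2 : Tendsto (fun d => ![0, 1, (P d).drift * (P d).p]) atTop (𝓝 ![0, 1, ηbar]) := by
    rw [tendsto_pi_nhds]
    intro i
    fin_cases i
    · exact tendsto_const_nhds
    · exact tendsto_const_nhds
    · exact hcp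
  intro T
  refine ⟨((hconv hb0 T).congr (Eventually.of_forall fun d τ hτ => ?_)).congr_right
      fun τ _ => congrFun (hlim τ) 0,
    ((hconv (tendsto_const_nhds (x := ![0, 0, 1])) T).congr
      (Eventually.of_forall fun d τ hτ => ?_)).congr_right fun τ _ => congrFun (hlim τ) 1,
    ((hconv hb2 T).congr (Eventually.of_forall fun d τ hτ => ?_)).congr_right
      fun τ _ => congrFun (hlim τ) 2⟩ <;>
  have hp := (hP.p_pos d).ne' <;>
  simp only [dotProduct, Fin.sum_univ_three, Matrix.cons_val_zero, Matrix.cons_val_one,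
    Matrix.cons_val]
  · rw [(hobs d τ hτ.1).1]
    field_simp
  · rw [(hobs d τ hτ.1).2.1]
    ring
  · rw [(hobs d τ hτ.1).2.2]
    field_simp
    ring

end Resonance

end SparseMomentum

theorem theorem3 (κ σ γ pS BS εS ηS : ℝ) (P : ℕ → Params)
    (hP : CoScaling κ σ γ pS BS εS ηS P)
    (θstar : ∀ d, Vec d) (μ₀ : ∀ d, Measure (State d))
    (hprob : ∀ d, IsProbabilityMeasure (μ₀ d))
    (hθ : ∀ d, MemLp (fun z : State d => z.1) 2 (μ₀ d))
    (hm : ∀ d, MemLp (fun z : State d => z.2) 2 (μ₀ d))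
    (r₀ v₀ c₀ : ℝ)
    (hr : Tendsto (fun d => risk (θstar d) (μ₀ d)) atTop (𝓝 r₀))
    (hv : Tendsto (fun d => energy (μ₀ d) / ((P d).p : ℝ) ^ 2) atTop (𝓝 v₀))
    (hc : Tendsto (fun d => corr (θstar d) (μ₀ d) / ((P d).p : ℝ)) atTop (𝓝 c₀)) :
    -- below resonance
    (γ < 1 - σ + κ →
      Tendsto (fun d : ℕ => (P d).η * d / (P d).B) atTop (𝓝 (ηS / BS)) ∧
      ∃ R : ℝ → ℝ, IsSGDFlow (ηS / BS) R ∧ R 0 = r₀ ∧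
        (∀ T : ℝ, TendstoUniformlyOn
          (fun d τ => risk (θstar d) (lawAt (P d) (θstar d) (μ₀ d) (sgdClock κ σ pS BS d τ)))
          R atTop (Icc 0 T)) ∧
        (∀ δ T : ℝ, 0 < δ →
          TendstoUniformlyOn
            (fun d τ => energy (lawAt (P d) (θstar d) (μ₀ d) (sgdClock κ σ pS BS d τ))
              / (P d).slavedV d) R atTop (Icc δ T) ∧
          TendstoUniformlyOn
            (fun d τ => (corr (θstar d)
                  (lawAt (P d) (θstar d) (μ₀ d) (sgdClock κ σ pS BS d τ))
                - (P d).slavedC d * risk (θstar d)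
                  (lawAt (P d) (θstar d) (μ₀ d) (sgdClock κ σ pS BS d τ)))
              / (((P d).pBatch + (P d).ε) * (P d).signal))
            (fun _ => 0) atTop (Icc δ T))) ∧
    -- above resonance
    (1 - σ + κ < γ → 0 < γ →
      ∃ R V C : ℝ → ℝ, IsMomentFlow (ηS * pS / εS) 0 R V C ∧
        R 0 = r₀ ∧ V 0 = v₀ ∧ C 0 = c₀ ∧
        BalancedConvergence P θstar
          (fun d τ => lawAt (P d) (θstar d) (μ₀ d) (momentumClock κ σ γ pS BS εS d τ)) R V C ∧
        ∀ x₀ y₀ : ℝ, r₀ = x₀ ^ 2 → v₀ = y₀ ^ 2 → c₀ = x₀ * y₀ →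
          ∃ x y : ℝ → ℝ, IsHeavyBallFlow (ηS * pS / εS) x y ∧ x 0 = x₀ ∧ y 0 = y₀ ∧
            ∀ τ ∈ Ici (0 : ℝ), R τ = x τ ^ 2 ∧ V τ = y τ ^ 2 ∧ C τ = x τ * y τ) ∧
    -- on the resonance line
    (γ = 1 - σ + κ → 0 < γ →
      IrreducibleMomentFlow (ηS * pS / εS) (εS / (pS * BS)) ∧
      ∃ R V C : ℝ → ℝ, IsMomentFlow (ηS * pS / εS) (εS / (pS * BS)) R V C ∧
        R 0 = r₀ ∧ V 0 = v₀ ∧ C 0 = c₀ ∧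
        BalancedConvergence P θstar
          (fun d τ => lawAt (P d) (θstar d) (μ₀ d) (momentumClock κ σ γ pS BS εS d τ))
          R V C) := by
  have hA := hP.admissible
  have hPS := hP.PStar_pos
  have hpB := mul_pos hP.pS_pos hP.BS_pos
  refine ⟨fun hγ => ?_, fun hγ hγ0 => ?_, fun hγ hγ0 => ?_⟩
  · obtain ⟨hηd, hH, hq, hρ, hh⟩ := hP.below_limits hγ
    have hb := below_resonance hA (fun d => mul_nonneg (Real.rpow_nonneg d.cast_nonneg _)
      (div_nonneg hPS.le hpB.le)) (div_pos hP.ηS_pos hP.BS_pos) hH hq hρ hh hprob hθ hm hr hv hc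
    refine ⟨hηd, _, fun τ _ => HasDerivAt.hasDerivWithinAt ?_, by simp, hb.1, hb.2⟩
    exact ((((hasDerivAt_id τ).const_mul _).exp).const_mul r₀).congr_deriv (by simp; ring)
  · obtain ⟨hρ, ha, hε, hεP, hζ⟩ := hP.above_limits hγ.le hγ0
    rw [if_neg hγ.ne'] at hζ
    refine ⟨_, _, _, isMomentFlow_linearFlow ![r₀, v₀, c₀], ?_, ?_, ?_,
      balancedConvergence hA (fun d => mul_nonneg (Real.rpow_nonneg d.cast_nonneg _)
        (div_nonneg hPS.le hP.εS_pos.le)) hρ ha hε hεP hζ hprob hθ hm hr hv hc, ?_⟩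
    iterate 3 simp [linearFlow_zero]
    rintro x₀ y₀ rfl rfl rfl
    obtain ⟨x, y, hxy, hx0, hy0, h⟩ := exists_heavyBallFlow (ηS * pS / εS) x₀ y₀
    exact ⟨x, y, hxy, hx0, hy0, fun τ _ => by simp [h]⟩
  · obtain ⟨hρ, ha, hε, hεP, hζ⟩ := hP.above_limits hγ.ge hγ0
    rw [if_pos hγ] at hζ
    refine ⟨irreducibleMomentFlow
        (div_pos (mul_pos hP.ηS_pos hP.pS_pos) hP.εS_pos).ne' (div_pos hP.εS_pos hpB).ne',
      _, _, _, isMomentFlow_linearFlow ![r₀, v₀, c₀], ?_, ?_, ?_,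
      balancedConvergence hA (fun d => mul_nonneg (Real.rpow_nonneg d.cast_nonneg _)
        (div_nonneg hPS.le hP.εS_pos.le)) hρ ha hε hεP hζ hprob hθ hm hr hv hc⟩
    iterate 3 simp [linearFlow_zero]
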